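/- **Setting.** Let $K$ be a finite linearly ordered set of keys, extended by sentinel keys $-\infty$ and $+\infty$. A concurrent directed graph is stored as a linked list of vertex nodes sorted by key, between a head with key $-\infty$ (VertexHead) and a tail with key $+\infty$. A vertex node has a key, a next pointer, a boolean *marked*, a lock and a pointer to the head of its own sorted linked list of edge nodes, again between sentinels $-\infty,+\infty$. An edge node has a key, a next pointer, a lock and a status in $\{transit, marked, added\}$; edge sentinels are always *added*, a new edge node starts as *transit*. Threads run the methods below, interleaving atomic reads and writes of these fields and atomic lock acquisitions and releases in an arbitrary way (sequential consistency); an acquisition of a held lock is blocked. Initially the graph is empty and no call is pending. A node, once created, is never freed. - *Locate–lock–validate (vertices), key $k$.* Repeat: traverse the vertex list from VertexHead without locks to the first node $v_2$ with key $\ge k$, with predecessor $v_1$ in the traversal; lock $v_1$, then $v_2$; if both are unmarked and $v_1.next=v_2$, stop, else release both and retry. - *AddVertex(k)*: locate; if $v_2$ does not have key $k$, link a new node with key $k$ between $v_1$ and $v_2$; release both locks; return true. *RemoveVertex(k)*: locate; if $v_2$ has key $k$, mark $v_2$, then set $v_1.next:=v_2.next$; release both locks; return whether the key was found. - *ContainsVertex(k)*: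 traverse without locks to the first node with key $\ge k$; return whether it has key $k$ and is unmarked. - *HelpSearchEdge($k_1,k_2$)*: find without locks, in one traversal and first the smaller key, the vertex nodes with keys $k_1,k_2$, and fail if one of them is absent or marked (for $k_1=k_2$ it fails). - *Locate–lock–validate (edges), key $k_2$ in the edge list of vertex node $v$.* Repeat: traverse the edge list from its head without locks to the first node $e_2$ with key $\ge k_2$, with predecessor $e_1$; lock $e_1$, then $e_2$; if the statuses of both pass the test and $e_1.next=e_2$, stop, else release both and retry. The test is "$\ne marked$", except in AcyclicRemoveEdge, where it is "$=added$". - *AcyclicRemoveEdge($k_1,k_2$)*: HelpSearchEdge, then test again that both vertices are unmarked (return false on failure); locate $k_2$ in the edge list of $k_1$; if $e_2$ has key $k_2$, set its status to *marked*, then $e_1.next:=e_2.next$; release both locks; return true. - *AcyclicAddEdge($k_1,k_2$)*: the same search and tests; locate $k_2$ in the edge list of $k_1$; if $e_2$ has key $k_2$, release both locks and return true. Otherwise link a new *transit* node $e_3$ with key $k_2$ between $e_1$ and $e_2$, release both locks and run PathExists($k_2,k_1$). If it returns false, set $e_3$'s status to *added* and return true. If it returns true, locate $k_2$ again in the same edge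 list, giving locked nodes $(ne_1,ne_2)$, set $e_3$'s status to *marked*, set $ne_1.next:=e_3.next$, release the locks of $ne_1,ne_2$ and return false. - *AcyclicContainsEdge($k_1,k_2$)*: HelpSearchEdge (return false on failure), traverse the edge list of $k_1$ without locks to the first node with key $\ge k_2$; return whether it has key $k_2$ and status *added*. - *PathExists($k_1,k_2$)*: keep a local set $R$ of reached keys and a set $X$ of explored keys, both initially empty. Explore $k_1$; then, while $R\not\subseteq X$, explore any key of $R\setminus X$. Exploring $x$ means: find without locks the vertex node with key $x$; if it is present and unmarked, add to $R$ the keys of all unmarked edge nodes met in a traversal of its edge list, and return true if now $k_2\in R$; put $x$ into $X$. If $k_1$ itself is absent or marked, or if $R\subseteq X$, return false. AddVertex, RemoveVertex, AcyclicAddEdge, AcyclicRemoveEdge are called update methods. An execution is *fair* if every thread that has a pending call and is infinitely often able to perform its next step takes infinitely many steps (so locks are starvation-free: a thread waiting for a lock that is free infinitely often eventually gets it). **Lemma (progress).** 1. *The update methods are deadlock-free.* Let the number of threads be finite. In every fair execution, whenever a call of an update method is pending, some call of an update method returns at that time or later. Moreover, in every execution (fair or not) and at every time, no threads wait for each other's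 locks in a cycle; every thread with a pending update call can perform its next step or waits for a lock held by another thread; and a thread that requests the lock of a node holds only locks of nodes of the same kind (vertex or edge) with strictly smaller keys. 2. *ContainsVertex, AcyclicContainsEdge and PathExists are wait-free.* There is a bound $B$ that depends only on $K$ (not on the number of threads or the execution) such that in every execution, a thread executing one of these methods holds no lock, is never blocked, and returns within at most $B$ of its own steps, whatever the other threads do. The same holds for the call of PathExists inside AcyclicAddEdge (holding no lock, never blocked, left after at most $B$ own steps). -/

import Mathlib

/-!
A lock-based concurrent directed graph with an acyclicity invariant, as a transition system of
threads that interleave atomic accesses to a shared heap.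

The graph is a sorted linked list of vertex nodes; every vertex node owns a sorted linked list of
edge nodes.  Both kinds of lists are delimited by sentinel nodes with keys `-∞` and `+∞`.
-/

namespace AcyclicGraph

/-- Keys together with the sentinel keys `⊥ = -∞` and `⊤ = +∞`. -/
abbrev Key (K : Type*) := WithBot (WithTop K)

/-- A proper key, seen among the extended keys. -/
def key {K : Type*} (k : K) : Key K := ((k : WithTop K) : WithBot (WithTop K))

/-- The status of an edge node. -/
inductive Status
  | transit
  | marked
  | added
  deriving DecidableEq

/-- A vertex node, allocated at an address in `ℕ`.  The fields `val` and `edgeHead` are never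
written after construction.  `vnext = none` is the null pointer, `lock` is the owner of the lock. -/
structure VNode (K T : Type*) where
  val : Key K
  vnext : Option ℕ
  edgeHead : ℕ
  marked : Bool
  lock : Option T

/-- An edge node.  The field `val` is never written after construction. -/
structure ENode (K T : Type*) where
  val : Key K
  enext : Option ℕ
  status : Status
  lock : Option T

/-- The shared memory.  The addresses below `vcount` and `ecount` are the allocated ones;
memory is never freed. -/
structure Heap (K T : Type*) where
  vnode : ℕ → VNode K T
  enode : ℕ → ENode K T
  vcount : ℕ
  ecount : ℕ

namespace Heap

variable {K T : Type*}

def modV (h : Heap K T) (a : ℕ) (f : VNode K T → VNode K T) : Heap K T :=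
  { h with vnode := Function.update h.vnode a (f (h.vnode a)) }

def modE (h : Heap K T) (a : ℕ) (f : ENode K T → ENode K T) : Heap K T :=
  { h with enode := Function.update h.enode a (f (h.enode a)) }

def setVNext (h : Heap K T) (a : ℕ) (x : Option ℕ) : Heap K T :=
  h.modV a fun n => { n with vnext := x }

def setMarked (h : Heap K T) (a : ℕ) : Heap K T :=
  h.modV a fun n => { n with marked := true }

def setVLock (h : Heap K T) (a : ℕ) (x : Option T) : Heap K T :=
  h.modV a fun n => { n with lock := x }

def setENext (h : Heap K T) (a : ℕ) (x : Option ℕ) : Heap K T :=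
  h.modE a fun n => { n with enext := x }

def setStatus (h : Heap K T) (a : ℕ) (x : Status) : Heap K T :=
  h.modE a fun n => { n with status := x }

def setELock (h : Heap K T) (a : ℕ) (x : Option T) : Heap K T :=
  h.modE a fun n => { n with lock := x }

/-- `new vnode(k)`: a fresh unmarked vertex node at address `h.vcount`, with its two edge
sentinels, which are permanently in the edge list and have status `added`. -/
def newV (h : Heap K T) (k : Key K) : Heap K T where
  vnode := Function.update h.vnode h.vcount ⟨k, none, h.ecount, false, none⟩
  enode := Function.update
    (Function.update h.enode h.ecount ⟨⊥, some (h.ecount + 1), Status.added, none⟩)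
    (h.ecount + 1) ⟨⊤, none, Status.added, none⟩
  vcount := h.vcount + 1
  ecount := h.ecount + 2

/-- `new enode(k)`: a fresh edge node at address `h.ecount`, with status `transit`. -/
def newE (h : Heap K T) (k : Key K) : Heap K T :=
  { h with
    enode := Function.update h.enode h.ecount ⟨k, none, Status.transit, none⟩
    ecount := h.ecount + 1 }

/-- No node at all (the node contents at unallocated addresses are irrelevant). -/
def empty : Heap K T where
  vnode := fun _ => ⟨⊤, none, 0, false, none⟩
  enode := fun _ => ⟨⊤, none, Status.added, none⟩
  vcount := 0
  ecount := 0

/-- The empty graph: `VertexHead` (key `-∞`) at address `0`, followed by the tail sentinel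
(key `+∞`) at address `1`. -/
def initial : Heap K T := ((empty.newV ⊥).newV ⊤).setVNext 0 (some 1)

end Heap

/-- The address of `VertexHead`. -/
def vertexHead : ℕ := 0

/-- The methods of the data structure. -/
inductive Method
  | addVertex
  | removeVertex
  | acyclicAddEdge
  | acyclicRemoveEdge
  | containsVertex
  | acyclicContainsEdge
  | pathExists

/-- The methods that may change the graph. -/
def Method.IsUpdate : Method → Prop
  | addVertex | removeVertex | acyclicAddEdge | acyclicRemoveEdge => True
  | containsVertex | acyclicContainsEdge | pathExists => False

/-- The methods that only read the graph. -/
def Method.IsReadOnly : Method → Prop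
  | containsVertex | acyclicContainsEdge | pathExists => True
  | addVertex | removeVertex | acyclicAddEdge | acyclicRemoveEdge => False

/-- The two vertex updates, which share the procedure that locates and locks a position in the
vertex list. -/
inductive VJob
  | add
  | remove

/-- The three callers of the procedure that searches for the two end vertices of an edge. -/
inductive EOp
  | add
  | remove
  | contains

/-- The three callers of the procedure that locates and locks a position in an edge list: the
first phase of `AcyclicAddEdge`, `AcyclicRemoveEdge`, and the phase of `AcyclicAddEdge` that
withdraws its transit edge node `e3` after a cycle was detected. -/
inductive EJob
  | add
  | remove
  | undo (e3 : ℕ)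

/-- The test that the validation applies to the status of a locked edge node: `AcyclicRemoveEdge`
requires `added`, the other callers require that the node be not `marked`. -/
def EJob.ok : EJob → Status → Prop
  | remove, s => s = Status.added
  | add, s | undo _, s => s ≠ Status.marked

instance (j : EJob) (s : Status) : Decidable (j.ok s) := by
  cases j <;> unfold EJob.ok <;> infer_instance

/-- What follows the release of the two locks on edge nodes: return, or (in `AcyclicAddEdge` of
the edge `(k1, k2)`, after the insertion of `e3` into the list of the vertex node `v1`) cycle
detection. -/
inductive After (K : Type*)
  | ret (b : Bool)
  | detect (k1 k2 : K) (v1 e3 : ℕ)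

/-- The caller of `PathExists`: it is either invoked as a method of its own, or called inside
`AcyclicAddEdge` of the edge `(k1, k2)` with transit edge node `e3` in the list of `v1`. -/
inductive PCaller (K : Type*)
  | method
  | addEdge (k1 k2 : K) (v1 e3 : ℕ)

/-- The local variables of `PathExists`: the key `cur` that is being explored, whether this is the
first one, the key `dst` that is looked for, the set `R` of keys reached and the set `X` of keys
explored. -/
structure PVars (K : Type*) where
  caller : PCaller K
  dst : K
  cur : Key K
  first : Bool
  R : Finset (Key K)
  X : Finset (Key K)

/-- The control state of a thread: the program point of its next atomic step, with the values of
its live local variables. -/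
inductive Loc (K : Type*)
  /- no call is pending; the last call, if any, returned `res` -/
  | idle (res : Option Bool)
  /- `ContainsVertex` -/
  | cvScan (k : K) (v : ℕ)
  | cvMark (v : ℕ)
  /- locating, locking and validating a position `(v1, v2)` of the vertex list -/
  | vStart (j : VJob) (k : K)
  | vScan (j : VJob) (k : K) (v1 v2 : ℕ)
  | vAcq1 (j : VJob) (k : K) (v1 v2 : ℕ)
  | vAcq2 (j : VJob) (k : K) (v1 v2 : ℕ)
  | vVal1 (j : VJob) (k : K) (v1 v2 : ℕ)
  | vVal2 (j : VJob) (k : K) (v1 v2 : ℕ)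
  | vVal3 (j : VJob) (k : K) (v1 v2 : ℕ)
  | vRetry1 (j : VJob) (k : K) (v1 v2 : ℕ)
  | vRetry2 (j : VJob) (k : K) (v2 : ℕ)
  /- the body of `AddVertex` or `RemoveVertex`, with the locks on `v1` and `v2` held -/
  | vBody (j : VJob) (k : K) (v1 v2 : ℕ)
  | vLink3 (v1 v2 v3 : ℕ)
  | vLink1 (v1 v2 v3 : ℕ)
  | vReadNext (v1 v2 : ℕ)
  | vUnlink (v1 v2 : ℕ) (x : Option ℕ)
  | vRel1 (j : VJob) (res : Bool) (v1 v2 : ℕ)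
  | vRel2 (j : VJob) (res : Bool) (v2 : ℕ)
  /- `HelpSearchEdge`: the search for the end vertices, first the one with the smaller key -/
  | hsScan1 (o : EOp) (k1 k2 : K) (v : ℕ)
  | hsMark1 (o : EOp) (k1 k2 : K) (v : ℕ)
  | hsNext (o : EOp) (k1 k2 : K) (v : ℕ)
  | hsScan2 (o : EOp) (k1 k2 : K) (v w : ℕ)
  | hsMark2 (o : EOp) (k1 k2 : K) (v w : ℕ)
  /- `AcyclicContainsEdge`, after the search for the vertices -/
  | ceScan (k2 : K) (e : ℕ)
  | ceStatus (e : ℕ)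
  /- `AcyclicLocateEdge` and `NewLocateEdge` -/
  | eMark1 (j : EJob) (k1 k2 : K) (v1 v2 : ℕ)
  | eMark2 (j : EJob) (k1 k2 : K) (v1 v2 : ℕ)
  | eStart (j : EJob) (k1 k2 : K) (v1 : ℕ)
  | eScan (j : EJob) (k1 k2 : K) (v1 e1 e2 : ℕ)
  | eAcq1 (j : EJob) (k1 k2 : K) (v1 e1 e2 : ℕ)
  | eAcq2 (j : EJob) (k1 k2 : K) (v1 e1 e2 : ℕ)
  | eVal1 (j : EJob) (k1 k2 : K) (v1 e1 e2 : ℕ)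
  | eVal2 (j : EJob) (k1 k2 : K) (v1 e1 e2 : ℕ)
  | eVal3 (j : EJob) (k1 k2 : K) (v1 e1 e2 : ℕ)
  | eRetry1 (j : EJob) (k1 k2 : K) (v1 e1 e2 : ℕ)
  | eRetry2 (j : EJob) (k1 k2 : K) (v1 e2 : ℕ)
  /- the bodies of the edge updates, with the locks on `e1` and `e2` held -/
  | eBody (j : EJob) (k1 k2 : K) (v1 e1 e2 : ℕ)
  | eLink3 (k1 k2 : K) (v1 e1 e2 e3 : ℕ)
  | eLink1 (k1 k2 : K) (v1 e1 e2 e3 : ℕ)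
  | eReadNext (j : EJob) (e1 e2 d : ℕ)
  | eUnlink (j : EJob) (e1 e2 : ℕ) (x : Option ℕ)
  | eRel1 (j : EJob) (a : After K) (e1 e2 : ℕ)
  | eRel2 (j : EJob) (a : After K) (e2 : ℕ)
  /- `AcyclicAddEdge`: no cycle was detected, the transit edge becomes `added` -/
  | eCommit (e3 : ℕ)
  /- `PathExists` -/
  | pScan (p : PVars K) (v : ℕ)
  | pMark (p : PVars K) (v : ℕ)
  | pTest (p : PVars K) (e : ℕ)
  | pStatus (p : PVars K) (e : ℕ)
  | pNext (p : PVars K) (e : ℕ)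
  | pCheck (p : PVars K)
  | pPick (p : PVars K)

namespace Loc

variable {K : Type*}

def ofVJob : VJob → Method
  | .add => .addVertex
  | .remove => .removeVertex

def ofEOp : EOp → Method
  | .add => .acyclicAddEdge
  | .remove => .acyclicRemoveEdge
  | .contains => .acyclicContainsEdge

def ofEJob : EJob → Method
  | .add => .acyclicAddEdge
  | .remove => .acyclicRemoveEdge
  | .undo _ => .acyclicAddEdge

def ofPCaller : PCaller K → Method
  | .method => .pathExists
  | .addEdge _ _ _ _ => .acyclicAddEdge

/-- The method whose call is pending. -/
def method : Loc K → Option Method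
  | idle _ => none
  | cvScan _ _ | cvMark _ => some .containsVertex
  | vStart j _ | vScan j _ _ _ | vAcq1 j _ _ _ | vAcq2 j _ _ _ | vVal1 j _ _ _ | vVal2 j _ _ _
  | vVal3 j _ _ _ | vRetry1 j _ _ _ | vRetry2 j _ _ | vBody j _ _ _ | vRel1 j _ _ _
  | vRel2 j _ _ => some (ofVJob j)
  | vLink3 _ _ _ | vLink1 _ _ _ => some .addVertex
  | vReadNext _ _ | vUnlink _ _ _ => some .removeVertex
  | hsScan1 o _ _ _ | hsMark1 o _ _ _ | hsNext o _ _ _ | hsScan2 o _ _ _ _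
  | hsMark2 o _ _ _ _ => some (ofEOp o)
  | ceScan _ _ | ceStatus _ => some .acyclicContainsEdge
  | eMark1 j _ _ _ _ | eMark2 j _ _ _ _ | eStart j _ _ _ | eScan j _ _ _ _ _ | eAcq1 j _ _ _ _ _
  | eAcq2 j _ _ _ _ _ | eVal1 j _ _ _ _ _ | eVal2 j _ _ _ _ _ | eVal3 j _ _ _ _ _
  | eRetry1 j _ _ _ _ _ | eRetry2 j _ _ _ _ | eBody j _ _ _ _ _ | eReadNext j _ _ _
  | eUnlink j _ _ _ | eRel1 j _ _ _ | eRel2 j _ _ => some (ofEJob j)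
  | eLink3 _ _ _ _ _ _ | eLink1 _ _ _ _ _ _ | eCommit _ => some .acyclicAddEdge
  | pScan p _ | pMark p _ | pTest p _ | pStatus p _ | pNext p _ | pCheck p
  | pPick p => some (ofPCaller p.caller)

/-- The thread executes the code of `PathExists`, as a method of its own or within
`AcyclicAddEdge`. -/
def InPathExists : Loc K → Prop
  | pScan _ _ | pMark _ _ | pTest _ _ | pStatus _ _ | pNext _ _ | pCheck _ | pPick _ => True
  | _ => False

/-- `HelpSearchEdge` has found the vertex nodes `v1` and `v2`: control returns to its caller. -/
def found {T : Type*} (h : Heap K T) (k1 k2 : K) (v1 v2 : ℕ) : EOp → Loc K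
  | .add => eMark1 .add k1 k2 v1 v2
  | .remove => eMark1 .remove k1 k2 v1 v2
  | .contains => ceScan k2 (h.vnode v1).edgeHead

/-- `PathExists(k1, k2)` is entered. -/
def enterPath (c : PCaller K) (k1 k2 : K) : Loc K :=
  pScan ⟨c, k2, key k1, true, ∅, ∅⟩ vertexHead

/-- `PathExists` returns `b` to its caller.  Inside `AcyclicAddEdge`, a detected cycle starts the
withdrawal of the transit edge node. -/
def exitPath : PCaller K → Bool → Loc K
  | .method, b => idle (some b)
  | .addEdge k1 k2 v1 e3, true => eStart (.undo e3) k1 k2 v1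
  | .addEdge _ _ _ e3, false => eCommit e3

/-- The control state after both edge locks are released. -/
def afterRelease : After K → Loc K
  | .ret b => idle (some b)
  | .detect k1 k2 v1 e3 => enterPath (.addEdge k1 k2 v1 e3) k2 k1

/-- The control states in which a thread has just invoked a method with some arguments. -/
inductive Entry : Loc K → Prop
  | addVertex (k : K) : Entry (vStart .add k)
  | removeVertex (k : K) : Entry (vStart .remove k)
  | acyclicAddEdge (k1 k2 : K) : Entry (hsScan1 .add k1 k2 vertexHead)
  | acyclicRemoveEdge (k1 k2 : K) : Entry (hsScan1 .remove k1 k2 vertexHead)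
  | containsVertex (k : K) : Entry (cvScan k vertexHead)
  | acyclicContainsEdge (k1 k2 : K) : Entry (hsScan1 .contains k1 k2 vertexHead)
  | pathExists (k1 k2 : K) : Entry (enterPath .method k1 k2)

end Loc

open Loc in
/-- The possible outcomes of the next atomic step of thread `t`.  A step makes at most one access
to the mutable fields of the nodes (or creates a node that is still private to the thread), besides
reads of the immutable fields `val` and `edgeHead`.  There is no outcome when the thread is idle,
when it tries to acquire a lock that is held, or when it is about to dereference a null pointer. -/
def next {K T : Type*} [LinearOrder K] (t : T) (h : Heap K T) : Loc K → Set (Heap K T × Loc K)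
  | idle _ => ∅
  -- ContainsVertex(k)
  | cvScan k v =>
    if (h.vnode v).val < key k then
      match (h.vnode v).vnext with
      | some w => {(h, cvScan k w)}
      | none => ∅
    else if (h.vnode v).val ≠ key k then {(h, idle (some false))}
    else {(h, cvMark v)}
  | cvMark v => {(h, idle (some (!(h.vnode v).marked)))}
  -- while (true): traverse the vertex list without locks, lock (v1, v2), validate
  | vStart j k =>
    match (h.vnode vertexHead).vnext with
    | some v2 => {(h, vScan j k vertexHead v2)}
    | none => ∅
  | vScan j k v1 v2 =>
    if (h.vnode v2).val < key k then
      match (h.vnode v2).vnext with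
      | some w => {(h, vScan j k v2 w)}
      | none => ∅
    else {(h, vAcq1 j k v1 v2)}
  | vAcq1 j k v1 v2 =>
    if (h.vnode v1).lock.isNone then {(h.setVLock v1 (some t), vAcq2 j k v1 v2)} else ∅
  | vAcq2 j k v1 v2 =>
    if (h.vnode v2).lock.isNone then {(h.setVLock v2 (some t), vVal1 j k v1 v2)} else ∅
  | vVal1 j k v1 v2 =>
    if (h.vnode v1).marked then {(h, vRetry1 j k v1 v2)} else {(h, vVal2 j k v1 v2)}
  | vVal2 j k v1 v2 =>
    if (h.vnode v2).marked then {(h, vRetry1 j k v1 v2)} else {(h, vVal3 j k v1 v2)}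
  | vVal3 j k v1 v2 =>
    if (h.vnode v1).vnext = some v2 then {(h, vBody j k v1 v2)} else {(h, vRetry1 j k v1 v2)}
  | vRetry1 j k v1 v2 => {(h.setVLock v1 none, vRetry2 j k v2)}
  | vRetry2 j k v2 => {(h.setVLock v2 none, vStart j k)}
  -- AddVertex(k): insert a new node, unless the key is present
  | vBody .add k v1 v2 =>
    if (h.vnode v2).val ≠ key k then {(h.newV (key k), vLink3 v1 v2 h.vcount)}
    else {(h, vRel1 .add true v1 v2)}
  | vLink3 v1 v2 v3 => {(h.setVNext v3 (some v2), vLink1 v1 v2 v3)}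
  | vLink1 v1 v2 v3 => {(h.setVNext v1 (some v3), vRel1 .add true v1 v2)}
  -- RemoveVertex(k): logical, then physical removal, if the key is present
  | vBody .remove k v1 v2 =>
    if (h.vnode v2).val = key k then {(h.setMarked v2, vReadNext v1 v2)}
    else {(h, vRel1 .remove false v1 v2)}
  | vReadNext v1 v2 => {(h, vUnlink v1 v2 (h.vnode v2).vnext)}
  | vUnlink v1 v2 x => {(h.setVNext v1 x, vRel1 .remove true v1 v2)}
  | vRel1 j r v1 v2 => {(h.setVLock v1 none, vRel2 j r v2)}
  | vRel2 _ r v2 => {(h.setVLock v2 none, idle (some r))}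
  -- HelpSearchEdge(k1, k2)
  | hsScan1 o k1 k2 v =>
    if (h.vnode v).val < key (min k1 k2) then
      match (h.vnode v).vnext with
      | some w => {(h, hsScan1 o k1 k2 w)}
      | none => ∅
    else if (h.vnode v).val ≠ key (min k1 k2) then {(h, idle (some false))}
    else {(h, hsMark1 o k1 k2 v)}
  | hsMark1 o k1 k2 v =>
    if (h.vnode v).marked then {(h, idle (some false))} else {(h, hsNext o k1 k2 v)}
  | hsNext o k1 k2 v =>
    match (h.vnode v).vnext with
    | some w => {(h, hsScan2 o k1 k2 v w)}
    | none => ∅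
  | hsScan2 o k1 k2 v w =>
    if (h.vnode w).val < key (max k1 k2) then
      match (h.vnode w).vnext with
      | some x => {(h, hsScan2 o k1 k2 v x)}
      | none => ∅
    else if (h.vnode w).val ≠ key (max k1 k2) then {(h, idle (some false))}
    else {(h, hsMark2 o k1 k2 v w)}
  | hsMark2 o k1 k2 v w =>
    if (h.vnode w).marked then {(h, idle (some false))}
    else if k1 < k2 then {(h, found h k1 k2 v w o)}
    else {(h, found h k1 k2 w v o)}
  -- AcyclicContainsEdge(k1, k2): traverse the edge list of vertex k1 without locks
  | ceScan k2 e =>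
    if (h.enode e).val < key k2 then
      match (h.enode e).enext with
      | some f => {(h, ceScan k2 f)}
      | none => ∅
    else if (h.enode e).val ≠ key k2 then {(h, idle (some false))}
    else {(h, ceStatus e)}
  | ceStatus e => {(h, idle (some (decide ((h.enode e).status = Status.added))))}
  -- AcyclicLocateEdge: both vertices are tested again
  | eMark1 j k1 k2 v1 v2 =>
    if (h.vnode v1).marked then {(h, idle (some false))} else {(h, eMark2 j k1 k2 v1 v2)}
  | eMark2 j k1 k2 v1 v2 =>
    if (h.vnode v2).marked then {(h, idle (some false))} else {(h, eStart j k1 k2 v1)}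
  -- while (true): traverse the edge list without locks, lock (e1, e2), validate
  | eStart j k1 k2 v1 =>
    match (h.enode (h.vnode v1).edgeHead).enext with
    | some e2 => {(h, eScan j k1 k2 v1 (h.vnode v1).edgeHead e2)}
    | none => ∅
  | eScan j k1 k2 v1 e1 e2 =>
    if (h.enode e2).val < key k2 then
      match (h.enode e2).enext with
      | some f => {(h, eScan j k1 k2 v1 e2 f)}
      | none => ∅
    else {(h, eAcq1 j k1 k2 v1 e1 e2)}
  | eAcq1 j k1 k2 v1 e1 e2 =>
    if (h.enode e1).lock.isNone then {(h.setELock e1 (some t), eAcq2 j k1 k2 v1 e1 e2)} else ∅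
  | eAcq2 j k1 k2 v1 e1 e2 =>
    if (h.enode e2).lock.isNone then {(h.setELock e2 (some t), eVal1 j k1 k2 v1 e1 e2)} else ∅
  | eVal1 j k1 k2 v1 e1 e2 =>
    if j.ok (h.enode e1).status then {(h, eVal2 j k1 k2 v1 e1 e2)}
    else {(h, eRetry1 j k1 k2 v1 e1 e2)}
  | eVal2 j k1 k2 v1 e1 e2 =>
    if j.ok (h.enode e2).status then {(h, eVal3 j k1 k2 v1 e1 e2)}
    else {(h, eRetry1 j k1 k2 v1 e1 e2)}
  | eVal3 j k1 k2 v1 e1 e2 =>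
    if (h.enode e1).enext = some e2 then {(h, eBody j k1 k2 v1 e1 e2)}
    else {(h, eRetry1 j k1 k2 v1 e1 e2)}
  | eRetry1 j k1 k2 v1 e1 e2 => {(h.setELock e1 none, eRetry2 j k1 k2 v1 e2)}
  | eRetry2 j k1 k2 v1 e2 => {(h.setELock e2 none, eStart j k1 k2 v1)}
  -- AcyclicAddEdge(k1, k2): insert a transit edge node, unless the key is present
  | eBody .add k1 k2 v1 e1 e2 =>
    if (h.enode e2).val ≠ key k2 then {(h.newE (key k2), eLink3 k1 k2 v1 e1 e2 h.ecount)}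
    else {(h, eRel1 .add (.ret true) e1 e2)}
  | eLink3 k1 k2 v1 e1 e2 e3 => {(h.setENext e3 (some e2), eLink1 k1 k2 v1 e1 e2 e3)}
  | eLink1 k1 k2 v1 e1 e2 e3 =>
    {(h.setENext e1 (some e3), eRel1 .add (.detect k1 k2 v1 e3) e1 e2)}
  -- AcyclicRemoveEdge(k1, k2): logical, then physical removal, if the key is present
  | eBody .remove _ k2 _ e1 e2 =>
    if (h.enode e2).val = key k2 then
      {(h.setStatus e2 Status.marked, eReadNext .remove e1 e2 e2)}
    else {(h, eRel1 .remove (.ret true) e1 e2)}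
  -- AcyclicAddEdge after detection of a cycle: logical, then physical removal of e3
  | eBody (.undo e3) _ _ _ e1 e2 =>
    {(h.setStatus e3 Status.marked, eReadNext (.undo e3) e1 e2 e3)}
  -- physical removal of the marked node d
  | eReadNext j e1 e2 d => {(h, eUnlink j e1 e2 (h.enode d).enext)}
  | eUnlink .remove e1 e2 x => {(h.setENext e1 x, eRel1 .remove (.ret true) e1 e2)}
  | eUnlink j e1 e2 x => {(h.setENext e1 x, eRel1 j (.ret false) e1 e2)}
  | eRel1 j a e1 e2 => {(h.setELock e1 none, eRel2 j a e2)}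
  | eRel2 _ a e2 => {(h.setELock e2 none, afterRelease a)}
  | eCommit e3 => {(h.setStatus e3 Status.added, idle (some true))}
  -- PathExists: look for the vertex node with key p.cur
  | pScan p v =>
    if (h.vnode v).val < p.cur then
      match (h.vnode v).vnext with
      | some w => {(h, pScan p w)}
      | none => ∅
    else if (h.vnode v).val = p.cur then {(h, pMark p v)}
    else if p.first then {(h, exitPath p.caller false)}
    else {(h, pPick { p with X := insert p.cur p.X })}
  | pMark p v =>
    if (h.vnode v).marked = false then {(h, pTest p (h.vnode v).edgeHead)}
    else if p.first then {(h, exitPath p.caller false)}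
    else {(h, pPick { p with X := insert p.cur p.X })}
  -- collect the keys of its unmarked edge nodes
  | pTest p e => if (h.enode e).enext = none then {(h, pCheck p)} else {(h, pStatus p e)}
  | pStatus p e =>
    if (h.enode e).status ≠ Status.marked then
      {(h, pNext { p with R := insert (h.enode e).val p.R } e)}
    else {(h, pNext p e)}
  | pNext p e =>
    match (h.enode e).enext with
    | some f => {(h, pTest p f)}
    | none => ∅
  | pCheck p =>
    if key p.dst ∈ p.R then {(h, exitPath p.caller true)}
    else {(h, pPick { p with X := insert p.cur p.X })}
  -- explore any key that was reached but not explored, if there is one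
  | pPick p =>
    if p.R ⊆ p.X then {(h, exitPath p.caller false)}
    else {c | ∃ x ∈ p.R \ p.X, c = (h, pScan { p with cur := x, first := false } vertexHead)}

/-- A global state: the shared memory and the control state of every thread. -/
structure State (K T : Type*) where
  heap : Heap K T
  loc : T → Loc K

/-- The empty graph, all threads idle. -/
def State.initial (K T : Type*) : State K T := ⟨Heap.initial, fun _ => Loc.idle none⟩

/-- The transitions of thread `t`: an idle thread may invoke a method, a thread with a pending call
may perform its next atomic step. -/
inductive Act {K T : Type*} [LinearOrder K] [DecidableEq T] (t : T) :
    State K T → State K T → Prop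
  | invoke (s : State K T) (r : Option Bool) (l : Loc K) (hr : s.loc t = Loc.idle r)
      (hl : l.Entry) : Act t s ⟨s.heap, Function.update s.loc t l⟩
  | step (s : State K T) (h : Heap K T) (l : Loc K) (hn : (h, l) ∈ next t s.heap (s.loc t)) :
      Act t s ⟨h, Function.update s.loc t l⟩

/-- Thread `t` has a pending call whose next step can be performed now. -/
def State.CanStep {K T : Type*} [LinearOrder K] (s : State K T) (t : T) : Prop :=
  (next t s.heap (s.loc t)).Nonempty

/-- An execution: an infinite interleaving of the transitions of the threads, in any order and at
any relative speed.  `actor n` is the thread that moves at time `n`; nothing happens at time `n` if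
`actor n = none` (so finite executions are included). -/
structure Execution (K T : Type*) [LinearOrder K] [DecidableEq T] where
  state : ℕ → State K T
  actor : ℕ → Option T
  start : state 0 = State.initial K T
  idle_step : ∀ n, actor n = none → state (n + 1) = state n
  act_step : ∀ n t, actor n = some t → Act t (state n) (state (n + 1))

/-- Nodes that can be locked: vertex nodes and edge nodes. -/
inductive Node
  | vertex (a : ℕ)
  | edge (a : ℕ)

/-- The owner of the lock of a node. -/
def Heap.owner {K T : Type*} (h : Heap K T) : Node → Option T
  | .vertex a => (h.vnode a).lock
  | .edge a => (h.enode a).lock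

/-- The node whose lock the thread is about to acquire, if any. -/
def Loc.request {K : Type*} : Loc K → Option Node
  | vAcq1 _ _ v1 _ => some (.vertex v1)
  | vAcq2 _ _ _ v2 => some (.vertex v2)
  | eAcq1 _ _ _ _ e1 _ => some (.edge e1)
  | eAcq2 _ _ _ _ _ e2 => some (.edge e2)
  | _ => none

/-- `n` is a node of the same kind as `m`, with a strictly larger key. -/
def Heap.Before {K T : Type*} [LinearOrder K] (h : Heap K T) : Node → Node → Prop
  | .vertex a, .vertex b => (h.vnode a).val < (h.vnode b).val
  | .edge a, .edge b => (h.enode a).val < (h.enode b).val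
  | _, _ => False

/-- Thread `t` waits for a lock held by thread `u`. -/
def State.WaitsFor {K T : Type*} (s : State K T) (t u : T) : Prop :=
  ∃ n, (s.loc t).request = some n ∧ s.heap.owner n = some u

/-- Thread `t` has a pending call of an update method. -/
def State.Updating {K T : Type*} (s : State K T) (t : T) : Prop :=
  ∃ μ, (s.loc t).method = some μ ∧ μ.IsUpdate

namespace Execution

variable {K T : Type*} [LinearOrder K] [DecidableEq T]

/-- Fair scheduling with starvation-free locks: a thread whose pending call can perform its next
step infinitely often moves infinitely often.  In particular a thread that is never blocked keeps
moving, and a thread that waits for a lock which is free again and again eventually gets it. -/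
def Fair (σ : Execution K T) : Prop :=
  ∀ t, (∃ᶠ n in Filter.atTop, (σ.state n).CanStep t) → ∃ᶠ n in Filter.atTop, σ.actor n = some t

/-- The call pending for `t` at time `n` returns a value to `t` in the transition at time `n`. -/
def Returns (σ : Execution K T) (t : T) (n : ℕ) : Prop :=
  σ.actor n = some t ∧ (∃ μ, ((σ.state n).loc t).method = some μ) ∧
    ∃ b, (σ.state (n + 1)).loc t = Loc.idle (some b)

/-- Whenever a call of an update method is pending, some call of an update method returns later. -/
def UpdatesProgress (σ : Execution K T) : Prop :=
  ∀ n t, (σ.state n).Updating t → ∃ m, n ≤ m ∧ ∃ u, (σ.state m).Updating u ∧ σ.Returns u m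

/-- At all times, the threads do not wait for each other in a cycle, and every thread that is
executing an update method can move or waits for a lock held by another thread. -/
def NoDeadlock (σ : Execution K T) : Prop :=
  ∀ n t, ¬ Relation.TransGen (σ.state n).WaitsFor t t ∧
    ((σ.state n).Updating t → (σ.state n).CanStep t ∨ ∃ u, u ≠ t ∧ (σ.state n).WaitsFor t u)

/-- A thread that requests a lock holds only locks of nodes of the same kind with smaller keys. -/
def LocksOrdered (σ : Execution K T) : Prop :=
  ∀ n t c, ((σ.state n).loc t).request = some c →
    ∀ d, (σ.state n).heap.owner d = some t → (σ.state n).heap.Before d c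

/-- The number of moves of `t` at the times `k` with `n ≤ k < m`. -/
def moves (σ : Execution K T) (t : T) (n m : ℕ) : ℕ :=
  ((Finset.Ico n m).filter fun k => σ.actor k = some t).card

/-- Whenever thread `t` is executing the method `μ`, it holds no lock, it can move, and if it moves
at least `B` times until time `m`, the call has returned by then, whatever the others do. -/
def WaitFree (σ : Execution K T) (B : ℕ) (μ : Method) : Prop :=
  ∀ n t, ((σ.state n).loc t).method = some μ →
    (∀ c, (σ.state n).heap.owner c ≠ some t) ∧ (σ.state n).CanStep t ∧
      ∀ m, B ≤ σ.moves t n m → ∃ k, n ≤ k ∧ k < m ∧ σ.Returns t k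

/-- The same for the code of `PathExists` when it may be called from `AcyclicAddEdge`. -/
def PathExistsWaitFree (σ : Execution K T) (B : ℕ) : Prop :=
  ∀ n t, ((σ.state n).loc t).InPathExists →
    (∀ c, (σ.state n).heap.owner c ≠ some t) ∧ (σ.state n).CanStep t ∧
      ∀ m, B ≤ σ.moves t n m → ∃ k, n < k ∧ k ≤ m ∧ ¬ ((σ.state k).loc t).InPathExists

end Execution

end AcyclicGraph

/-! ### Locks and list operations on abstract nodes: auxiliary state, steps, invariant -/

namespace AcyclicGraph

/-! Safety rests on one inductive invariant. Every address is unallocated, fresh, live (in its list)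
or dead (unlinked), and has a home list. Along the next pointer of a live or dead node the key
strictly increases and the list stays the same, and only a node with key `⊤` lacks a successor. Live
nodes of one list have distinct keys, and the successor of a live node is live with no live node of
the list strictly between. A live marked node is being removed by a thread that has not unlinked it
yet. A transit node belongs to the call of `AcyclicAddEdge` that created it; since
`AcyclicRemoveEdge` accepts only `added` nodes, no other thread can remove it, so its owner finds it
again by its key. Vertex lists and edge lists obey the same rules, so this is proved once for
abstract cells (`AInv.step`) and transferred to the program by `view` and `Loc.abs`
(`NStep.preserved`).

Locks: the second lock that a thread acquires is on a node with a larger key than the first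
(`Inv.before`). Hence requested keys increase along any chain of waiting threads, and there is no
cycle. Pointers that are followed are never null, so a pending call is blocked only by a held lock
(`next_nonempty`).

Wait-freedom: traversals climb in the finite set of keys and `PathExists` explores each key at most
once. So a natural number, `rank`, drops with every own step outside the locate-lock-validate loop
(`NStep.rank`), and steps of other threads do not change it. The read-only methods never enter that
loop.

Progress: suppose that no update call returns from some time on. Ranks of pending updates then never
increase. As there are finitely many threads, from some time on all moves of updates stay inside the
loop; by fairness no update is left outside, where nothing blocks it. From then on the heap is
frozen except for the locks (`Stuck`). A holder of a lock can wait only for a larger key, so by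
induction on keys every thread keeps moving (`exists_move`) and starts new attempts
(`exists_start`). Every node reachable in the frozen lists is live, and unmarked because a thread
about to unlink it would be outside the loop. So an attempt whose test is "not marked" succeeds, a
contradiction. Only `AcyclicRemoveEdge` remains, and only a transit node could make it fail; but the
owner of a transit node would be in the loop, withdrawing it with the weaker test, which is already
excluded. -/

noncomputable instance : DecidableEq Node := Classical.decEq Node

/-- The mutable and immutable data that vertex nodes and edge nodes have in common. -/
structure Cell (K T : Type*) where
  val : Key K
  next : Option Node
  status : Status
  lock : Option T

/-- The life cycle of an address. -/
inductive Place
  | unalloc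
  | fresh
  | live
  | dead

/-- Auxiliary state: the life cycle of each node and the head of the list for which it was made. -/
structure Ghost where
  place : Node → Place
  home : Node → Node

namespace Ghost

/-- Published nodes are those that other threads may stand on. Dead nodes count: a traversal that is
overtaken by a removal continues from the unlinked node. -/
def Pub (g : Ghost) (n : Node) : Prop := g.place n = .live ∨ g.place n = .dead

noncomputable def setPlace (g : Ghost) (n : Node) (p : Place) : Ghost :=
  { g with place := Function.update g.place n p }

noncomputable def setHome (g : Ghost) (n m : Node) : Ghost :=
  { g with home := Function.update g.home n m }

end Ghost

/-- The part of the control state that matters for locks and list operations, common to the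
procedures on vertex lists and on edge lists.  The argument `tr` is the transit node owned by the
thread, if any. -/
inductive ALoc
  | free (tr : Option Node)
  | one (tr : Option Node) (n : Node)
  | both (tr : Option Node) (n1 n2 : Node)
  | val2 (b : Bool) (tr : Option Node) (n1 n2 : Node)
  | val3 (b : Bool) (tr : Option Node) (n1 n2 : Node)
  | body (b : Bool) (tr : Option Node) (n1 n2 : Node)
  | link3 (tr : Option Node) (n1 n2 n3 : Node)
  | link1 (tr : Option Node) (n1 n2 n3 : Node)
  | readNext (n1 n2 d : Node)
  | unlink (n1 n2 : Node) (x : Option Node)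

/-- The validation test, strict or not. -/
def Passes (b : Bool) (s : Status) : Prop :=
  (b = true → s = Status.added) ∧ s ≠ Status.marked

namespace ALoc

def held : ALoc → Node → Prop
  | free _, _ => False
  | one _ n, m => m = n
  | both _ n1 n2, m | val2 _ _ n1 n2, m | val3 _ _ n1 n2, m | body _ _ n1 n2, m
  | link3 _ n1 n2 _, m | link1 _ n1 n2 _, m | readNext n1 n2 _, m
  | unlink n1 n2 _, m => m = n1 ∨ m = n2

/-- Ownership of a transit node ends when it is marked, hence `none` in the last two cases. -/
def tr : ALoc → Option Node
  | free tr | one tr _ | both tr _ _ | val2 _ tr _ _ | val3 _ tr _ _ | body _ tr _ _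
  | link3 tr _ _ _ | link1 tr _ _ _ => tr
  | readNext _ _ _ | unlink _ _ _ => none

/-- The node that the thread has created and not yet linked. -/
def fr : ALoc → Option Node
  | link3 _ _ _ n3 | link1 _ _ _ n3 => some n3
  | _ => none

/-- The node that the thread has marked and not yet unlinked. -/
def rm : ALoc → Option Node
  | readNext _ n2 _ | unlink _ n2 _ => some n2
  | _ => none

variable {K T : Type*}

/-- What the thread has learnt and still relies on. Every clause speaks of nodes that it has locked
or of its own fresh node; this is what protects it from the steps of others. -/
def Claim (c : Node → Cell K T) (g : Ghost) : ALoc → Prop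
  | free _ | one _ _ | both _ _ _ => True
  | val2 b _ n1 _ => Passes b (c n1).status
  | val3 b _ n1 n2 => Passes b (c n1).status ∧ Passes b (c n2).status
  | body b _ n1 n2 => Passes b (c n1).status ∧ Passes b (c n2).status ∧ (c n1).next = some n2
  | link3 _ n1 n2 n3 => (c n1).status ≠ .marked ∧ (c n1).next = some n2 ∧ g.place n3 = .fresh ∧
      (c n3).status ≠ .marked
  | link1 _ n1 n2 n3 => (c n1).status ≠ .marked ∧ (c n1).next = some n2 ∧ g.place n3 = .fresh ∧
      (c n3).status ≠ .marked ∧ (c n3).next = some n2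
  | readNext n1 n2 d => (c n1).status ≠ .marked ∧ (c n1).next = some n2 ∧ g.place n2 = .live ∧
      (c n2).status = .marked ∧ d = n2
  | unlink n1 n2 x => (c n1).status ≠ .marked ∧ (c n1).next = some n2 ∧ g.place n2 = .live ∧
      (c n2).status = .marked ∧ (c n2).next = x

end ALoc

/-- Steps of a thread `t`, as far as locks and list operations are concerned. -/
inductive AStep {K T : Type*} [LinearOrder K] (t : T) :
    (Node → Cell K T) → Ghost → ALoc → (Node → Cell K T) → Ghost → ALoc → Prop
  | reloc (c : Node → Cell K T) (g : Ghost) (a a' : ALoc) (h1 : a'.held = a.held)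
      (h2 : a'.tr = a.tr) (h3 : a'.fr = a.fr) (h4 : a'.rm = a.rm)
      (h5 : a.Claim c g → a'.Claim c g) : AStep t c g a c g a'
  | commit (c : Node → Cell K T) (g : Ghost) (e : Node) :
      AStep t c g (.free (some e)) (Function.update c e { c e with status := .added }) g
        (.free none)
  | acq1 (c : Node → Cell K T) (g : Ghost) (tr : Option Node) (n : Node)
      (h1 : (c n).lock = none) (h2 : g.Pub n) :
      AStep t c g (.free tr) (Function.update c n { c n with lock := some t }) g (.one tr n)
  | acq2 (c : Node → Cell K T) (g : Ghost) (tr : Option Node) (n1 n2 : Node)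
      (h1 : (c n2).lock = none) (h2 : g.Pub n2) :
      AStep t c g (.one tr n1) (Function.update c n2 { c n2 with lock := some t }) g
        (.both tr n1 n2)
  | rel1 (c : Node → Cell K T) (g : Ghost) (tr : Option Node) (n1 n2 : Node) (h1 : n1 ≠ n2) :
      AStep t c g (.both tr n1 n2) (Function.update c n1 { c n1 with lock := none }) g (.one tr n2)
  | rel2 (c : Node → Cell K T) (g : Ghost) (tr : Option Node) (n : Node) :
      AStep t c g (.one tr n) (Function.update c n { c n with lock := none }) g (.free tr)
  | alloc (c : Node → Cell K T) (g : Ghost) (b : Bool) (n1 n2 n3 : Node) (tr : Option Node)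
      (x : Cell K T) (h1 : g.place n3 = .unalloc) (h2 : x.next = none) (h3 : x.lock = none)
      (h4 : (x.status = .transit ∧ tr = some n3) ∨ (x.status = .added ∧ tr = none)) :
      AStep t c g (.body b none n1 n2) (Function.update c n3 x)
        ((g.setPlace n3 .fresh).setHome n3 (g.home n1)) (.link3 tr n1 n2 n3)
  | setNext (c : Node → Cell K T) (g : Ghost) (tr : Option Node) (n1 n2 n3 : Node) :
      AStep t c g (.link3 tr n1 n2 n3) (Function.update c n3 { c n3 with next := some n2 }) g
        (.link1 tr n1 n2 n3)
  | link (c : Node → Cell K T) (g : Ghost) (tr : Option Node) (n1 n2 n3 : Node)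
      (h1 : (c n1).val < (c n3).val) (h2 : (c n3).val < (c n2).val) (h3 : g.home n3 = g.home n1) :
      AStep t c g (.link1 tr n1 n2 n3) (Function.update c n1 { c n1 with next := some n3 })
        (g.setPlace n3 .live) (.both tr n1 n2)
  -- That `e` is `n2` is not required here; it follows from the key and the home of `e` under the
  -- invariant.
  | markOwn (c : Node → Cell K T) (g : Ghost) (b : Bool) (n1 n2 e : Node) (h1 : g.Pub e)
      (h2 : g.home e = g.home n1) (h3 : (c n1).val < (c e).val) (h4 : (c e).val ≤ (c n2).val) :
      AStep t c g (.body b (some e) n1 n2) (Function.update c e { c e with status := .marked }) g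
        (.readNext n1 n2 e)
  | mark (c : Node → Cell K T) (g : Ghost) (n1 n2 : Node) :
      AStep t c g (.body true none n1 n2) (Function.update c n2 { c n2 with status := .marked }) g
        (.readNext n1 n2 n2)
  | unlink (c : Node → Cell K T) (g : Ghost) (n1 n2 : Node) (x : Option Node)
      (h1 : (c n2).val ≠ ⊤) :
      AStep t c g (.unlink n1 n2 x) (Function.update c n1 { c n1 with next := x })
        (g.setPlace n2 .dead) (.both none n1 n2)

/-- The invariant of locks and lists. -/
structure AInv {K T : Type*} [LinearOrder K] (c : Node → Cell K T) (g : Ghost) (A : T → ALoc) :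
    Prop where
  lock : ∀ n t, (c n).lock = some t ↔ (A t).held n
  heldPub : ∀ t n, (A t).held n → g.Pub n
  claim : ∀ t, (A t).Claim c g
  frUnique : ∀ t u n, (A t).fr = some n → (A u).fr = some n → t = u
  trUnique : ∀ t u n, (A t).tr = some n → (A u).tr = some n → t = u
  trStatus : ∀ t n, (A t).tr = some n → (c n).status = .transit ∧ g.place n ≠ .unalloc
  trOwner : ∀ n, (c n).status = .transit → ∃ t, (A t).tr = some n
  -- Dead nodes are included, so that a traversal which left the list still climbs and ends.
  pubNext : ∀ n m, g.Pub n → (c n).next = some m →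
    g.Pub m ∧ (c n).val < (c m).val ∧ g.home m = g.home n
  pubNil : ∀ n, g.Pub n → (c n).next = none → (c n).val = ⊤
  inj : ∀ n m, g.place n = .live → g.place m = .live → g.home n = g.home m →
    (c n).val = (c m).val → n = m
  -- Sortedness is phrased by keys and not by reachability, so linking and unlinking only call for
  -- comparisons of keys.
  succ : ∀ n m, g.place n = .live → (c n).next = some m → g.place m = .live ∧
    ∀ d, g.place d = .live → g.home d = g.home n → (c d).val ≤ (c n).val ∨ (c m).val ≤ (c d).val
  liveMarked : ∀ n, g.place n = .live → (c n).status = .marked → ∃ t, (A t).rm = some n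
  deadMarked : ∀ n, g.place n = .dead → (c n).status = .marked

variable {K T : Type*}

/-- Nodes that another thread has locked or created are not affected, up to a commit. -/
theorem ALoc.Claim.frame {c c' : Node → Cell K T} {g g' : Ghost} {a : ALoc} (h : a.Claim c g)
    (hf : ∀ n, a.held n ∨ a.fr = some n → (c' n).next = (c n).next ∧ g'.place n = g.place n ∧
      ((c' n).status = (c n).status ∨ ((c n).status = .transit ∧ (c' n).status = .added))) :
    a.Claim c' g' := by
  -- A commit turns `transit` into `added`. The weak test survives because both are unmarked, and
  -- the strict test had already excluded `transit`.
  cases a <;> simp only [ALoc.Claim, ALoc.held, ALoc.fr, Passes] at h hf ⊢ <;> grind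

variable [LinearOrder K]

/-- Dead nodes are marked, so a published node found unmarked is still in its list. -/
theorem AInv.pub_of_ne {c : Node → Cell K T} {g : Ghost} {A : T → ALoc} (I : AInv c g A)
    {n : Node} (h : g.Pub n) (hm : (c n).status ≠ .marked) : g.place n = .live :=
  h.resolve_right fun hd => hm (I.deadMarked n hd)

theorem AInv.lock_none {c : Node → Cell K T} {g : Ghost} {A : T → ALoc} (I : AInv c g A)
    {n : Node} (h : ¬ g.Pub n) : (c n).lock = none := by
  rcases hl : (c n).lock with _ | t
  · rfl
  · exact absurd (I.heldPub t n ((I.lock n t).1 hl)) h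

theorem AInv.held_unique {c : Node → Cell K T} {g : Ghost} {A : T → ALoc} (I : AInv c g A)
    {n : Node} {t u : T} (ht : (A t).held n) (hu : (A u).held n) : t = u := by
  have h1 := (I.lock n t).2 ht
  have h2 := (I.lock n u).2 hu
  simpa [h1] using h2

theorem AInv.fr_fresh {c : Node → Cell K T} {g : Ghost} {A : T → ALoc} (I : AInv c g A)
    {n : Node} {t : T} (ht : (A t).fr = some n) : g.place n = .fresh := by
  have h := I.claim t
  revert ht h
  cases A t <;> simp only [ALoc.fr, ALoc.Claim] <;> grind

variable [DecidableEq T]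

theorem AInv.reloc {c : Node → Cell K T} {g : Ghost} {A : T → ALoc} (I : AInv c g A) (t : T)
    (a : ALoc) (h1 : a.held = (A t).held) (h2 : a.tr = (A t).tr) (h3 : a.fr = (A t).fr)
    (h4 : a.rm = (A t).rm) (h5 : a.Claim c g) : AInv c g (Function.update A t a) := by
  have e1 : ∀ u, (Function.update A t a u).held = (A u).held := by
    intro u; by_cases h : u = t
    · subst h; simp [h1]
    · simp [h]
  have e2 : ∀ u, (Function.update A t a u).tr = (A u).tr := by
    intro u; by_cases h : u = t
    · subst h; simp [h2]
    · simp [h]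
  have e3 : ∀ u, (Function.update A t a u).fr = (A u).fr := by
    intro u; by_cases h : u = t
    · subst h; simp [h3]
    · simp [h]
  have e4 : ∀ u, (Function.update A t a u).rm = (A u).rm := by
    intro u; by_cases h : u = t
    · subst h; simp [h4]
    · simp [h]
  refine { I with
    lock := by simpa [e1] using I.lock, heldPub := by simpa [e1] using I.heldPub, claim := ?_,
    frUnique := by simpa [e3] using I.frUnique, trUnique := by simpa [e2] using I.trUnique,
    trStatus := by simpa [e2] using I.trStatus, trOwner := by simpa [e2] using I.trOwner,
    liveMarked := by simpa [e4] using I.liveMarked }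
  intro u
  by_cases h : u = t
  · subst h; simpa using h5
  · simpa [h] using I.claim u

end AcyclicGraph

/-! ### Preservation of the invariant by commits, lock operations and creation of nodes -/

namespace AcyclicGraph

variable {K T : Type*} [LinearOrder K] [DecidableEq T]

/-- This write is made without a lock. It is harmless because no claim of another thread depends on
the difference between `transit` and `added` in a way that this change could refute. -/
theorem AInv.commit {c : Node → Cell K T} {g : Ghost} {A : T → ALoc} (I : AInv c g A) (t : T)
    (e : Node) (hA : A t = .free (some e)) :
    AInv (Function.update c e { c e with status := .added }) g
      (Function.update A t (.free none)) := by
  have hs := I.trStatus t e (by simp [hA, ALoc.tr])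
  generalize hc' : Function.update c e { c e with status := .added } = c'
  have e1 : ∀ n, (c' n).val = (c n).val := by intro n; rw [← hc', Function.update_apply]; grind
  have e2 : ∀ n, (c' n).next = (c n).next := by intro n; rw [← hc', Function.update_apply]; grind
  have e3 : ∀ n, (c' n).lock = (c n).lock := by intro n; rw [← hc', Function.update_apply]; grind
  have e4 : ∀ n, (c' n).status = if n = e then .added else (c n).status := by intro n; rw [← hc', Function.update_apply]; grind
  generalize hA' : Function.update A t (.free none) = A'
  have a1 : A' t = .free none := by simp [← hA']
  have a2 : ∀ u, u ≠ t → A' u = A u := by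
    intro u hu; simp [← hA', hu]
  have h0 : ∀ u n, (A' u).held n ↔ (A u).held n := by
    intro u n; by_cases hu : u = t
    · subst hu; simp [a1, hA, ALoc.held]
    · rw [a2 u hu]
  have h2 : ∀ u, (A' u).tr = if u = t then none else (A u).tr := by grind [ALoc.tr]
  have h3 : ∀ u, (A' u).fr = (A u).fr := by grind [ALoc.fr]
  have h4 : ∀ u, (A' u).rm = (A u).rm := by grind [ALoc.rm]
  have h5 : (A t).tr = some e := by grind [ALoc.tr]
  obtain ⟨i1, i2, i3, i4, i5, i6, i7, i8, i9, i10, i11, i12, i13⟩ := I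
  refine ⟨by grind, by grind, ?_, by grind, by grind, by grind, by grind, by grind, by grind,
    by grind, by grind, by grind, by grind⟩
  intro u
  by_cases hu : u = t
  · subst hu; rw [a1]; trivial
  · rw [a2 u hu]
    refine (i3 u).frame fun n hn => ⟨e2 n, rfl, ?_⟩
    grind

/-- Acquisition and release together: `hl` says that nobody else holds the lock, `hx` and `hh` that
the thread's own holdings change at `n` only. -/
theorem AInv.setLock {c : Node → Cell K T} {g : Ghost} {A : T → ALoc} (I : AInv c g A) (t : T)
    (n : Node) (x : Option T) (a : ALoc) (hn : g.Pub n)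
    (hl : ∀ u, u ≠ t → (A u).held n → False)
    (hx : (x = some t ∧ a.held n) ∨ (x = none ∧ ¬ a.held n))
    (hh : ∀ m, m ≠ n → (a.held m ↔ (A t).held m)) (htr : a.tr = (A t).tr) (hfr : a.fr = (A t).fr)
    (hrm : a.rm = (A t).rm) (hcl : a.Claim c g) :
    AInv (Function.update c n { c n with lock := x }) g (Function.update A t a) := by
  generalize hc' : Function.update c n { c n with lock := x } = c'
  have e1 : ∀ n, (c' n).val = (c n).val := by intro n; rw [← hc', Function.update_apply]; grind
  have e2 : ∀ n, (c' n).next = (c n).next := by intro n; rw [← hc', Function.update_apply]; grind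
  have e3 : ∀ m, (c' m).lock = if m = n then x else (c m).lock := by
    intro m; rw [← hc', Function.update_apply]; grind
  have e4 : ∀ n, (c' n).status = (c n).status := by intro n; rw [← hc', Function.update_apply]; grind
  generalize hA' : Function.update A t a = A'
  have a1 : A' t = a := by simp [← hA']
  have a2 : ∀ u, u ≠ t → A' u = A u := by
    intro u hu; simp [← hA', hu]
  have h2 : ∀ u, (A' u).tr = (A u).tr := by intro u; by_cases u = t <;> grind
  have h3 : ∀ u, (A' u).fr = (A u).fr := by intro u; by_cases u = t <;> grind
  have h4 : ∀ u, (A' u).rm = (A u).rm := by intro u; by_cases u = t <;> grind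
  obtain ⟨i1, i2, i3, i4, i5, i6, i7, i8, i9, i10, i11, i12, i13⟩ := I
  refine ⟨?_, ?_, ?_, by grind, by grind, by grind, by grind, by grind, by grind,
    by grind, by grind, by grind, by grind⟩
  · intro m u
    by_cases hu : u = t <;> by_cases hm : m = n <;> grind
  · intro u m
    by_cases hu : u = t <;> by_cases hm : m = n <;> grind
  intro u
  by_cases hu : u = t
  · subst hu; rw [a1]
    exact hcl.frame fun n hn => ⟨e2 n, rfl, by grind⟩
  · rw [a2 u hu]
    exact (i3 u).frame fun n hn => ⟨e2 n, rfl, by grind⟩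

/-- An unallocated node is unlocked, is nobody's transit or fresh node, and is not the successor of
a published node. So nothing that the invariant says about the other nodes is affected. -/
theorem AInv.alloc {c : Node → Cell K T} {g : Ghost} {A : T → ALoc} (I : AInv c g A) (t : T)
    (b : Bool) (n1 n2 n3 : Node) (tr : Option Node) (hA : A t = .body b none n1 n2)
    (x : Cell K T) (m : Node) (h1 : g.place n3 = .unalloc) (hx1 : x.next = none)
    (hx2 : x.lock = none)
    (hx : (x.status = .transit ∧ tr = some n3) ∨ (x.status = .added ∧ tr = none)) :
    AInv (Function.update c n3 x) ((g.setPlace n3 .fresh).setHome n3 m)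
      (Function.update A t (.link3 tr n1 n2 n3)) := by
  have hp : ¬ g.Pub n3 := by simp [Ghost.Pub, h1]
  have hk := I.lock_none hp
  have hcl := I.claim t
  have hf := fun u => I.fr_fresh (t := u) (n := n3)
  generalize hc' : Function.update c n3 x = c'
  have e1 : ∀ n, c' n = if n = n3 then x else c n := by
    intro n; rw [← hc', Function.update_apply]
  generalize hg' : (g.setPlace n3 .fresh).setHome n3 m = g'
  have g1 : ∀ n, g'.home n = if n = n3 then m else g.home n := by
    intro n; simp [← hg', Ghost.setHome, Ghost.setPlace, Function.update_apply]
  have g2 : ∀ n, g'.place n = if n = n3 then .fresh else g.place n := by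
    intro n; simp [← hg', Ghost.setHome, Ghost.setPlace, Function.update_apply]
  have p1 : ∀ n, g'.Pub n ↔ g.Pub n := by
    intro n; simp only [Ghost.Pub, g2]; grind
  generalize hA' : Function.update A t (.link3 tr n1 n2 n3) = A'
  have a1 : A' t = .link3 tr n1 n2 n3 := by simp [← hA']
  have a2 : ∀ u, u ≠ t → A' u = A u := by intro u hu; simp [← hA', hu]
  have h0 : ∀ u n, (A' u).held n ↔ (A u).held n := by
    intro u n; by_cases hu : u = t
    · subst hu; simp [a1, hA, ALoc.held]
    · rw [a2 u hu]
  have h2 : ∀ u, (A' u).tr = if u = t then tr else (A u).tr := by grind [ALoc.tr]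
  have h3 : ∀ u, (A' u).fr = if u = t then some n3 else (A u).fr := by grind [ALoc.fr]
  have h4 : ∀ u, (A' u).rm = (A u).rm := by grind [ALoc.rm]
  have h5 : (A t).tr = none := by grind [ALoc.tr]
  have h6 : (A t).fr = none := by grind [ALoc.fr]
  have q1 := I.heldPub t n1 (by simp [hA, ALoc.held])
  have q2 := I.heldPub t n2 (by simp [hA, ALoc.held])
  have q3 : ∀ n, g.Pub n → n ≠ n3 := by grind
  obtain ⟨i1, i2, i3, i4, i5, i6, i7, i8, i9, i10, i11, i12, i13⟩ := I
  refine ⟨?_, by grind, ?_, by grind, ?_, ?_, ?_, ?_, by grind, ?_, ?_, ?_, ?_⟩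
  · intro n u
    rw [h0, ← i1, e1]
    grind
  · intro u
    by_cases hu : u = t
    · subst hu; rw [a1]
      rw [hA] at hcl
      simp only [ALoc.Claim, Passes] at hcl ⊢
      grind
    · rw [a2 u hu]
      refine (i3 u).frame fun n hn => ?_
      have : n ≠ n3 := by grind
      grind
  · intro u v n hu hv
    by_cases u = t <;> by_cases v = t <;> grind
  · intro u n hu
    by_cases u = t <;> grind
  · intro n hn
    by_cases hn3 : n = n3
    · exact ⟨t, by grind⟩
    · obtain ⟨u, hu⟩ := i7 n (by grind)
      exact ⟨u, by grind⟩
  · intro n k hn hk'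
    have : n ≠ n3 := by grind
    have hh := i8 n k (by grind) (by grind)
    have : k ≠ n3 := by grind
    grind
  · intro n k hn hk'
    have : n ≠ n3 := by grind
    have : k ≠ n3 := by grind
    grind
  · intro n k hn hk'
    have : n ≠ n3 := by grind
    have hh := i11 n k (by grind) (by grind)
    have : k ≠ n3 := by grind
    refine ⟨by grind, fun d hd => ?_⟩
    have : d ≠ n3 := by grind
    grind
  · intro n hn hs
    obtain ⟨u, hu⟩ := i12 n (by grind) (by grind)
    exact ⟨u, by grind⟩
  · intro n hn
    have : n ≠ n3 := by grind
    grind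

/-- The two sentinels are live at once, although the vertex node that will own them is not linked
yet. By `hne` no older live node has the new head as home, so `inj` and `succ` compare the sentinels
only with each other. -/
theorem AInv.newList {c : Node → Cell K T} {g : Ghost} {A : T → ALoc} (I : AInv c g A)
    (n m : Node) (hnm : n ≠ m) (h1 : g.place n = .unalloc) (h2 : g.place m = .unalloc)
    (hne : ∀ k, g.place k = .live → g.home k ≠ n) :
    AInv (Function.update (Function.update c n ⟨⊥, some m, .added, none⟩) m
        ⟨⊤, none, .added, none⟩)
      ((((g.setPlace n .live).setPlace m .live).setHome n n).setHome m n) A := by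
  have hp : ¬ g.Pub n := by simp [Ghost.Pub, h1]
  have hp2 : ¬ g.Pub m := by simp [Ghost.Pub, h2]
  have hk := I.lock_none hp
  have hk2 := I.lock_none hp2
  have hf := fun u k => I.fr_fresh (t := u) (n := k)
  generalize hc' : Function.update (Function.update c n ⟨⊥, some m, .added, none⟩) m
        ⟨⊤, none, .added, none⟩ = c'
  have e1 : ∀ k, c' k = if k = m then ⟨⊤, none, .added, none⟩ else
      if k = n then ⟨⊥, some m, .added, none⟩ else c k := by
    intro k; rw [← hc', Function.update_apply, Function.update_apply]
  generalize hg' : (((g.setPlace n .live).setPlace m .live).setHome n n).setHome m n = g'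
  have g1 : ∀ k, g'.home k = if k = m then n else if k = n then n else g.home k := by
    intro k; simp [← hg', Ghost.setHome, Ghost.setPlace, Function.update_apply]
  have g2 : ∀ k, g'.place k = if k = m then .live else if k = n then .live else g.place k := by
    intro k; simp [← hg', Ghost.setHome, Ghost.setPlace, Function.update_apply]
  have p1 : ∀ k, g'.Pub k ↔ g.Pub k ∨ k = n ∨ k = m := by
    intro k; simp only [Ghost.Pub, g2]; grind
  obtain ⟨i1, i2, i3, i4, i5, i6, i7, i8, i9, i10, i11, i12, i13⟩ := I
  have q3 : ∀ k, g.Pub k → k ≠ n ∧ k ≠ m := by grind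
  have bt : (⊥ : Key K) < ⊤ := by simp
  refine ⟨?_, by grind, ?_, by grind, by grind, ?_, ?_, ?_, ?_, ?_, ?_, ?_, ?_⟩
  · intro k u
    rw [← i1, e1]
    grind
  · intro u
    refine (i3 u).frame fun k hn => ?_
    have : k ≠ n := by grind
    have : k ≠ m := by grind
    grind
  · intro u k hk
    have := i6 u k hk
    have : k ≠ n := by grind
    have : k ≠ m := by grind
    grind
  · intro k hk
    exact i7 k (by grind)
  · intro k l hk hl
    rcases (p1 k).1 hk with hk | rfl | rfl
    · have := q3 k hk
      have := i8 k l hk (by grind)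
      have := q3 l this.1
      grind
    · have : l = m := by grind
      grind
    · grind
  · intro k hk hl
    rcases (p1 k).1 hk with hk | rfl | rfl
    · have := q3 k hk
      grind
    · grind
    · grind
  · intro k l hk hl
    by_cases k = n <;> by_cases k = m <;> by_cases l = n <;> by_cases l = m <;> grind
  · intro k l hk hl
    by_cases hkn : k = n
    · have : l = m := by grind
      refine ⟨by grind, fun d hd hdk => ?_⟩
      by_cases d = n
      · left; grind
      by_cases d = m
      · right; grind
      · grind
    · have hkm : k ≠ m := by grind
      have hh := i11 k l (by grind) (by grind)
      refine ⟨by grind, fun d hd hdk => ?_⟩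
      have : d ≠ n := by grind
      have : d ≠ m := by grind
      have : l ≠ n := by grind
      have : l ≠ m := by grind
      grind
  · intro k hk hs
    have : k ≠ n := by grind
    have : k ≠ m := by grind
    exact i12 k (by grind) (by grind)
  · intro k hk
    have : k ≠ n := by grind
    have : k ≠ m := by grind
    grind

end AcyclicGraph

/-! ### Preservation of the invariant by linking, marking and unlinking -/

namespace AcyclicGraph

variable {K T : Type*} [LinearOrder K] [DecidableEq T]

/-- The node written is fresh, hence unpublished, and the list clauses do not see it. -/
theorem AInv.setNext {c : Node → Cell K T} {g : Ghost} {A : T → ALoc} (I : AInv c g A) (t : T)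
    (tr : Option Node) (n1 n2 n3 : Node) (hA : A t = .link3 tr n1 n2 n3) :
    AInv (Function.update c n3 { c n3 with next := some n2 }) g
      (Function.update A t (.link1 tr n1 n2 n3)) := by
  have hcl := I.claim t
  have hf := fun u k => I.fr_fresh (t := u) (n := k)
  have hfr : (A t).fr = some n3 := by simp [hA, ALoc.fr]
  have q1 := I.heldPub t n1 (by simp [hA, ALoc.held])
  have hne : ∀ k, g.Pub k → k ≠ n3 := by grind [Ghost.Pub]
  generalize hc' : Function.update c n3 { c n3 with next := some n2 } = c'
  have e1 : ∀ n, (c' n).val = (c n).val := by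
    intro n; rw [← hc', Function.update_apply]; grind
  have e2 : ∀ n, (c' n).next = if n = n3 then some n2 else (c n).next := by
    intro n; rw [← hc', Function.update_apply]; grind
  have e3 : ∀ n, (c' n).lock = (c n).lock := by
    intro n; rw [← hc', Function.update_apply]; grind
  have e4 : ∀ n, (c' n).status = (c n).status := by
    intro n; rw [← hc', Function.update_apply]; grind
  generalize hA' : Function.update A t (.link1 tr n1 n2 n3) = A'
  have a1 : A' t = .link1 tr n1 n2 n3 := by simp [← hA']
  have a2 : ∀ u, u ≠ t → A' u = A u := by intro u hu; simp [← hA', hu]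
  have h0 : ∀ u n, (A' u).held n ↔ (A u).held n := by
    intro u n; by_cases hu : u = t
    · subst hu; simp [a1, hA, ALoc.held]
    · rw [a2 u hu]
  have h2 : ∀ u, (A' u).tr = (A u).tr := by
    intro u; by_cases u = t <;> grind [ALoc.tr]
  have h3 : ∀ u, (A' u).fr = (A u).fr := by
    intro u; by_cases u = t <;> grind [ALoc.fr]
  have h4 : ∀ u, (A' u).rm = (A u).rm := by
    intro u; by_cases u = t <;> grind [ALoc.rm]
  obtain ⟨i1, i2, i3, i4, i5, i6, i7, i8, i9, i10, i11, i12, i13⟩ := I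
  refine ⟨?_, ?_, ?_, by grind, by grind, by grind, by grind, ?_, ?_,
    by grind, ?_, by grind, by grind⟩
  · intro n u; rw [h0, e3, i1]
  · intro n u; rw [h0]; exact i2 n u
  · intro u
    by_cases hu : u = t
    · subst hu; rw [a1]
      rw [hA] at hcl
      simp only [ALoc.Claim] at hcl ⊢
      grind
    · rw [a2 u hu]
      refine (i3 u).frame fun n hn => ?_
      have : n ≠ n3 := by grind
      grind
  · intro n k hn hk
    have := hne n hn
    grind
  · intro n hn hk
    have := hne n hn
    grind
  · intro n k hn hk
    have := hne n (.inl hn)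
    have := i11 n k hn (by grind)
    grind

/-- The locked node `n1` is unmarked, hence live, and `n2` is its successor. By `succ` no live node
of the list has a key strictly between theirs, so the key of `n3` is new and `n3` fits into the gap.
-/
theorem AInv.link {c : Node → Cell K T} {g : Ghost} {A : T → ALoc} (I : AInv c g A) (t : T)
    (tr : Option Node) (n1 n2 n3 : Node) (hA : A t = .link1 tr n1 n2 n3)
    (v1 : (c n1).val < (c n3).val) (v2 : (c n3).val < (c n2).val) (hh : g.home n3 = g.home n1) :
    AInv (Function.update c n1 { c n1 with next := some n3 }) (g.setPlace n3 .live)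
      (Function.update A t (.both tr n1 n2)) := by
  have hcl := I.claim t
  have hf := fun u k => I.fr_fresh (t := u) (n := k)
  have hfr : (A t).fr = some n3 := by simp [hA, ALoc.fr]
  have hh1 : (A t).held n1 := by simp [hA, ALoc.held]
  have q1 := I.heldPub t n1 (by simp [hA, ALoc.held])
  have q2 := I.heldPub t n2 (by simp [hA, ALoc.held])
  have hne : ∀ k, g.Pub k → k ≠ n3 := by grind [Ghost.Pub]
  rw [hA] at hcl
  obtain ⟨k1, k2, k3, k4, k5⟩ := hcl
  have l1 := I.pub_of_ne q1 k1
  have l2 := (I.succ n1 n2 l1 k2)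
  have l3 := I.pubNext n1 n2 q1 k2
  have hu := fun u => I.held_unique (n := n1) (t := t) (u := u) hh1
  generalize hc' : Function.update c n1 { c n1 with next := some n3 } = c'
  have e1 : ∀ n, (c' n).val = (c n).val := by
    intro n; rw [← hc', Function.update_apply]; grind
  have e2 : ∀ n, (c' n).next = if n = n1 then some n3 else (c n).next := by
    intro n; rw [← hc', Function.update_apply]; grind
  have e3 : ∀ n, (c' n).lock = (c n).lock := by
    intro n; rw [← hc', Function.update_apply]; grind
  have e4 : ∀ n, (c' n).status = (c n).status := by
    intro n; rw [← hc', Function.update_apply]; grind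
  generalize hg' : g.setPlace n3 .live = g'
  have g1 : g'.home = g.home := by simp [← hg', Ghost.setPlace]
  have g2 : ∀ n, g'.place n = if n = n3 then .live else g.place n := by
    intro n; simp [← hg', Ghost.setPlace, Function.update_apply]
  have p1 : ∀ n, g'.Pub n ↔ n = n3 ∨ g.Pub n := by
    intro n; simp only [Ghost.Pub, g2]; grind
  generalize hA' : Function.update A t (.both tr n1 n2) = A'
  have a1 : A' t = .both tr n1 n2 := by simp [← hA']
  have a2 : ∀ u, u ≠ t → A' u = A u := by intro u hu; simp [← hA', hu]
  have h0 : ∀ u n, (A' u).held n ↔ (A u).held n := by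
    intro u n; by_cases hu : u = t
    · subst hu; simp [a1, hA, ALoc.held]
    · rw [a2 u hu]
  have h2 : ∀ u, (A' u).tr = (A u).tr := by
    intro u; by_cases u = t <;> grind [ALoc.tr]
  have h3 : ∀ u, (A' u).fr = if u = t then none else (A u).fr := by
    intro u; by_cases u = t <;> grind [ALoc.fr]
  have h4 : ∀ u, (A' u).rm = (A u).rm := by
    intro u; by_cases u = t <;> grind [ALoc.rm]
  obtain ⟨i1, i2, i3, i4, i5, i6, i7, i8, i9, i10, i11, i12, i13⟩ := I
  have n13 : n1 ≠ n3 := hne n1 q1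
  have n23 : n2 ≠ n3 := hne n2 q2
  -- no live node of the list has the key of the new node
  have nk : ∀ d, g.place d = .live → g.home d = g.home n1 → (c d).val ≠ (c n3).val := by
    intro d hd hd' he
    rcases l2.2 d hd hd' with h | h
    · exact absurd v1 (not_lt.2 (he ▸ h))
    · exact absurd v2 (not_lt.2 (he ▸ h))
  refine ⟨?_, ?_, ?_, by grind, by grind, by grind, by grind, ?_, ?_, ?_, ?_, ?_, ?_⟩
  · intro n u; rw [h0, e3, i1]
  · intro n u; rw [h0, p1]; exact fun h => .inr (i2 n u h)
  · intro u
    by_cases hut : u = t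
    · subst hut; rw [a1]; trivial
    · rw [a2 u hut]
      refine (i3 u).frame fun n hn => ?_
      have : n ≠ n1 := by grind
      have : n ≠ n3 := by grind
      grind
  · intro n k hn hk
    rcases (p1 n).1 hn with rfl | hn
    · grind
    · have := hne n hn
      by_cases hn1 : n = n1
      · grind
      · have := i8 n k hn (by grind)
        grind
  · intro n hn hk
    rcases (p1 n).1 hn with rfl | hn <;> grind
  · intro n k hn hk he hv
    rw [e1, e1] at hv
    rw [g1] at he
    by_cases hn3 : n = n3 <;> by_cases hk3 : k = n3
    · grind
    · subst hn3
      exact absurd hv.symm (nk k (by grind) (by grind))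
    · subst hk3
      exact absurd hv (nk n (by grind) (by grind))
    · exact i10 n k (by grind) (by grind) he hv
  · intro n k hn hk
    by_cases hn3 : n = n3
    · have : k = n2 := by grind
      refine ⟨by grind, fun d hd hde => ?_⟩
      by_cases hd3 : d = n3
      · left; rw [hd3, hn3]
      · have := l2.2 d (by grind) (by grind)
        rcases this with h | h
        · left; rw [e1, e1, hn3]; exact h.trans v1.le
        · right; rw [e1, e1, this]; exact h
    by_cases hn1 : n = n1
    · have : k = n3 := by grind
      refine ⟨by grind, fun d hd hde => ?_⟩
      by_cases hd3 : d = n3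
      · right; rw [hd3, this]
      · have := l2.2 d (by grind) (by grind)
        rcases this with h | h
        · left; rw [e1, e1, hn1]; exact h
        · right; rw [e1, e1, this]; exact v2.le.trans h
    · have hh2 := i11 n k (by grind) (by grind)
      have : k ≠ n3 := by grind
      refine ⟨by grind, fun d hd hde => ?_⟩
      by_cases hd3 : d = n3
      -- The new node does not come between another live node `n` and its successor `k`. By `succ`,
      -- `n1` is at or below `n`, or at or above `k`. In the second case `n3` is above `k`; in the
      -- first, `n` differs from `n1` and is therefore at or above `n2`, so above `n3`.
      · rw [hd3, e1, e1, e1]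
        have hhn : g.home n = g.home n1 := by grind
        rcases hh2.2 n1 l1 hhn.symm with h | h
        · left
          rcases l2.2 n (by grind) hhn with h' | h'
          · exact absurd (i10 n n1 (by grind) l1 hhn (le_antisymm h' h)) hn1
          · exact v2.le.trans h'
        · right; exact h.trans v1.le
      · rw [e1, e1, e1]
        exact hh2.2 d (by grind) (by grind)
  · intro n hn hs
    have : n ≠ n3 := by grind
    obtain ⟨u, hu⟩ := i12 n (by grind) (by grind)
    exact ⟨u, by grind⟩
  · intro n hn
    have : n ≠ n3 := by grind
    grind

/-- Marking the second one of the two locked and validated nodes. -/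
theorem AInv.mark {c : Node → Cell K T} {g : Ghost} {A : T → ALoc} (I : AInv c g A) (t : T)
    (b : Bool) (tr : Option Node) (n1 n2 : Node) (hA : A t = .body b tr n1 n2)
    (hb : tr = some n2 ∨ (tr = none ∧ b = true)) :
    AInv (Function.update c n2 { c n2 with status := .marked }) g
      (Function.update A t (.readNext n1 n2 n2)) := by
  have hcl := I.claim t
  have hf := fun u k => I.fr_fresh (t := u) (n := k)
  have hh1 : (A t).held n2 := by simp [hA, ALoc.held]
  have htr : (A t).tr = tr := by simp [hA, ALoc.tr]
  have q1 := I.heldPub t n1 (by simp [hA, ALoc.held])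
  have q2 := I.heldPub t n2 (by simp [hA, ALoc.held])
  rw [hA] at hcl
  simp only [ALoc.Claim, Passes] at hcl
  obtain ⟨k1, k2, k3⟩ := hcl
  have l1 := I.pub_of_ne q1 k1.2
  have l2 := I.pub_of_ne q2 k2.2
  have l3 := I.pubNext n1 n2 q1 k3
  have hu := fun u => I.held_unique (n := n2) (t := t) (u := u) hh1
  have hr1 : (A t).rm = none := by simp [hA, ALoc.rm]
  -- Nobody else's transit node is marked: `n2` is either the thread's own one, or the strict test
  -- has found it `added`.
  have hntr : ∀ u, u ≠ t → (A u).tr ≠ some n2 := by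
    intro u hu h
    rcases hb with rfl | ⟨-, rfl⟩
    · exact hu (I.trUnique u t n2 h htr)
    · have := (I.trStatus u n2 h).1
      rw [k2.1 rfl] at this
      cases this
  generalize hc' : Function.update c n2 { c n2 with status := .marked } = c'
  have e1 : ∀ n, (c' n).val = (c n).val := by
    intro n; rw [← hc', Function.update_apply]; grind
  have e2 : ∀ n, (c' n).next = (c n).next := by
    intro n; rw [← hc', Function.update_apply]; grind
  have e3 : ∀ n, (c' n).lock = (c n).lock := by
    intro n; rw [← hc', Function.update_apply]; grind
  have e4 : ∀ n, (c' n).status = if n = n2 then .marked else (c n).status := by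
    intro n; rw [← hc', Function.update_apply]; grind
  generalize hA' : Function.update A t (.readNext n1 n2 n2) = A'
  have a1 : A' t = .readNext n1 n2 n2 := by simp [← hA']
  have a2 : ∀ u, u ≠ t → A' u = A u := by intro u hu; simp [← hA', hu]
  have h0 : ∀ u n, (A' u).held n ↔ (A u).held n := by
    intro u n; by_cases hu : u = t
    · subst hu; simp [a1, hA, ALoc.held]
    · rw [a2 u hu]
  have h2 : ∀ u, (A' u).tr = if u = t then none else (A u).tr := by
    intro u; by_cases u = t <;> grind [ALoc.tr]
  have h3 : ∀ u, (A' u).fr = (A u).fr := by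
    intro u; by_cases u = t <;> grind [ALoc.fr]
  have h4 : ∀ u, (A' u).rm = if u = t then some n2 else (A u).rm := by
    intro u; by_cases u = t <;> grind [ALoc.rm]
  have n12 : n1 ≠ n2 := by grind
  obtain ⟨i1, i2, i3, i4, i5, i6, i7, i8, i9, i10, i11, i12, i13⟩ := I
  refine ⟨?_, ?_, ?_, by grind, by grind, by grind, ?_, by grind, by grind, by grind, by grind,
    ?_, by grind⟩
  · intro n u; rw [h0, e3, i1]
  · intro n u; rw [h0]; exact i2 n u
  · intro u
    by_cases hut : u = t
    · subst hut; rw [a1]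
      simp only [ALoc.Claim]
      grind
    · rw [a2 u hut]
      refine (i3 u).frame fun n hn => ?_
      have : n ≠ n2 := by grind [Ghost.Pub]
      grind
  · intro n hn
    have hn2 : n ≠ n2 := by grind
    obtain ⟨u, hu⟩ := i7 n (by grind)
    have : u ≠ t := by grind
    exact ⟨u, by grind⟩
  · intro n hn hs
    by_cases hn2 : n = n2
    · exact ⟨t, by grind⟩
    · obtain ⟨u, hu⟩ := i12 n hn (by grind)
      exact ⟨u, by grind⟩

/-- The pointer `x` was read earlier, but the lock on `n2` keeps it current. It is not null since
`n2` is not the tail. The only live node strictly between `n1` and the new successor was `n2`, which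
is now dead. -/
theorem AInv.unlink {c : Node → Cell K T} {g : Ghost} {A : T → ALoc} (I : AInv c g A) (t : T)
    (n1 n2 : Node) (x : Option Node) (hA : A t = .unlink n1 n2 x) (ht : (c n2).val ≠ ⊤) :
    AInv (Function.update c n1 { c n1 with next := x }) (g.setPlace n2 .dead)
      (Function.update A t (.both none n1 n2)) := by
  have hcl := I.claim t
  have hf := fun u k => I.fr_fresh (t := u) (n := k)
  have hh1 : (A t).held n1 := by simp [hA, ALoc.held]
  have hh2 : (A t).held n2 := by simp [hA, ALoc.held]
  have htr : (A t).tr = none := by simp [hA, ALoc.tr]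
  have hrm : (A t).rm = some n2 := by simp [hA, ALoc.rm]
  have q1 := I.heldPub t n1 hh1
  have q2 := I.heldPub t n2 hh2
  rw [hA] at hcl
  obtain ⟨k1, k2, k3, k4, k5⟩ := hcl
  obtain ⟨f, rfl⟩ : ∃ f, x = some f := by
    rcases x with _ | f
    · exact absurd (I.pubNil n2 q2 k5) ht
    · exact ⟨f, rfl⟩
  have l1 := I.pub_of_ne q1 k1
  have l3 := I.pubNext n1 n2 q1 k2
  have l4 := I.pubNext n2 f q2 k5
  have s1 := I.succ n1 n2 l1 k2
  have s2 := I.succ n2 f k3 k5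
  have hu1 := fun u => I.held_unique (n := n1) (t := t) (u := u) hh1
  have hu2 := fun u => I.held_unique (n := n2) (t := t) (u := u) hh2
  have n12 : n1 ≠ n2 := by grind
  have nf2 : f ≠ n2 := by grind
  generalize hc' : Function.update c n1 { c n1 with next := some f } = c'
  have e1 : ∀ n, (c' n).val = (c n).val := by
    intro n; rw [← hc', Function.update_apply]; grind
  have e2 : ∀ n, (c' n).next = if n = n1 then some f else (c n).next := by
    intro n; rw [← hc', Function.update_apply]; grind
  have e3 : ∀ n, (c' n).lock = (c n).lock := by
    intro n; rw [← hc', Function.update_apply]; grind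
  have e4 : ∀ n, (c' n).status = (c n).status := by
    intro n; rw [← hc', Function.update_apply]; grind
  generalize hg' : g.setPlace n2 .dead = g'
  have g1 : g'.home = g.home := by simp [← hg', Ghost.setPlace]
  have g2 : ∀ n, g'.place n = if n = n2 then .dead else g.place n := by
    intro n; simp [← hg', Ghost.setPlace, Function.update_apply]
  have p1 : ∀ n, g'.Pub n ↔ g.Pub n := by
    intro n; simp only [Ghost.Pub, g2]; grind
  generalize hA' : Function.update A t (.both none n1 n2) = A'
  have a1 : A' t = .both none n1 n2 := by simp [← hA']
  have a2 : ∀ u, u ≠ t → A' u = A u := by intro u hu; simp [← hA', hu]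
  have h0 : ∀ u n, (A' u).held n ↔ (A u).held n := by
    intro u n; by_cases hu : u = t
    · subst hu; simp [a1, hA, ALoc.held]
    · rw [a2 u hu]
  have h2 : ∀ u, (A' u).tr = (A u).tr := by
    intro u; by_cases u = t <;> grind [ALoc.tr]
  have h3 : ∀ u, (A' u).fr = (A u).fr := by
    intro u; by_cases u = t <;> grind [ALoc.fr]
  have h4 : ∀ u, (A' u).rm = if u = t then none else (A u).rm := by
    intro u; by_cases u = t <;> grind [ALoc.rm]
  obtain ⟨i1, i2, i3, i4, i5, i6, i7, i8, i9, i10, i11, i12, i13⟩ := I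
  refine ⟨?_, ?_, ?_, by grind, by grind, by grind, by grind, ?_, ?_, ?_, ?_, ?_, ?_⟩
  · intro n u; rw [h0, e3, i1]
  · intro n u; rw [h0, p1]; exact i2 n u
  · intro u
    by_cases hut : u = t
    · subst hut; rw [a1]; trivial
    · rw [a2 u hut]
      refine (i3 u).frame fun n hn => ?_
      have : n ≠ n1 := by grind
      have : n ≠ n2 := by grind
      grind
  · intro n k hn hk
    rw [p1] at hn
    rw [p1, e1, e1, g1]
    by_cases hn1 : n = n1
    · have : k = f := by grind
      subst this hn1
      exact ⟨l4.1, l3.2.1.trans l4.2.1, l4.2.2.trans l3.2.2⟩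
    · exact i8 n k hn (by grind)
  · intro n hn hk
    rw [p1] at hn
    grind
  · intro n k hn hk he hv
    exact i10 n k (by grind) (by grind) (by grind) (by grind)
  · intro n k hn hk
    have hn2 : n ≠ n2 := by grind
    by_cases hn1 : n = n1
    · have : k = f := by grind
      subst this hn1
      refine ⟨by grind, fun d hd hde => ?_⟩
      have hd2 : d ≠ n2 := by grind
      rw [e1, e1, e1]
      rcases s1.2 d (by grind) (by grind) with h | h
      · exact .inl h
      · rcases s2.2 d (by grind) (by grind) with h' | h'
        · exact absurd (i10 d n2 (by grind) k3 (by grind) (le_antisymm h' h)) hd2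
        · exact .inr h'
    · have hh3 := i11 n k (by grind) (by grind)
      have hk' : (c n).next = some k := by grind
      -- Two live nodes of a list with the same successor would each have a key at most that of the
      -- other, so `n1` is the only live predecessor of `n2`.
      have : k ≠ n2 := by
        rintro rfl
        have hnl : g.place n = .live := by grind
        have hlt := i8 n k (.inl hnl) hk'
        refine hn1 (i10 n n1 hnl l1 (by grind) (le_antisymm ?_ ?_))
        · rcases s1.2 n hnl (by grind) with h | h
          · exact h
          · exact absurd hlt.2.1 (not_lt.2 h)
        · rcases hh3.2 n1 l1 (by grind) with h | h
          · exact h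
          · exact absurd l3.2.1 (not_lt.2 h)
      refine ⟨by grind, fun d hd hde => ?_⟩
      rw [e1, e1, e1]
      exact hh3.2 d (by grind) (by grind)
  · intro n hn hs
    obtain ⟨u, hu⟩ := i12 n (by grind) (by grind)
    exact ⟨u, by grind⟩
  · intro n hn
    by_cases n = n2 <;> grind

/-- Every step preserves the invariant. -/
theorem AInv.step {c c' : Node → Cell K T} {g g' : Ghost} {A : T → ALoc} (I : AInv c g A) {t : T}
    {a a' : ALoc} (hs : AStep t c g a c' g' a') (ha : A t = a) :
    AInv c' g' (Function.update A t a') := by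
  have hcl := I.claim t
  have hlk := fun n u => I.lock n u
  cases hs with
  | reloc _ _ h1 h2 h3 h4 h5 =>
    subst ha; exact I.reloc t _ h1 h2 h3 h4 (h5 hcl)
  | commit e => exact I.commit t e ha
  | acq1 tr n h1 h2 =>
    refine I.setLock t n _ _ h2 (fun u _ hu => ?_) (.inl ⟨rfl, rfl⟩) ?_ (by simp [ha, ALoc.tr])
      (by simp [ha, ALoc.fr]) (by simp [ha, ALoc.rm]) trivial
    · simpa [h1] using (hlk n u).2 hu
    · intro m hm; simp [ha, ALoc.held, hm]
  | acq2 tr n1 n2 h1 h2 =>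
    refine I.setLock t n2 _ _ h2 (fun u _ hu => ?_) (.inl ⟨rfl, .inr rfl⟩) ?_
      (by simp [ha, ALoc.tr]) (by simp [ha, ALoc.fr]) (by simp [ha, ALoc.rm]) trivial
    · simpa [h1] using (hlk n2 u).2 hu
    · intro m hm; simp [ha, ALoc.held, hm]
  | rel1 tr n1 n2 h1 =>
    have hh : (A t).held n1 := by simp [ha, ALoc.held]
    refine I.setLock t n1 _ _ (I.heldPub t n1 hh) (fun u hu h => hu (I.held_unique h hh))
      (.inr ⟨rfl, h1⟩) ?_ (by simp [ha, ALoc.tr]) (by simp [ha, ALoc.fr]) (by simp [ha, ALoc.rm])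
      trivial
    intro m hm; simp [ha, ALoc.held, hm]
  | rel2 tr n =>
    have hh : (A t).held n := by simp [ha, ALoc.held]
    refine I.setLock t n _ _ (I.heldPub t n hh) (fun u hu h => hu (I.held_unique h hh))
      (.inr ⟨rfl, id⟩) ?_ (by simp [ha, ALoc.tr]) (by simp [ha, ALoc.fr]) (by simp [ha, ALoc.rm])
      trivial
    intro m hm; simp [ha, ALoc.held, hm]
  | alloc b n1 n2 n3 tr x h1 h2 h3 h4 => exact I.alloc t b n1 n2 n3 tr ha x _ h1 h2 h3 h4
  | setNext tr n1 n2 n3 => exact I.setNext t tr n1 n2 n3 ha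
  | link tr n1 n2 n3 h1 h2 h3 => exact I.link t tr n1 n2 n3 ha h1 h2 h3
  | markOwn b n1 n2 e h1 h2 h3 h4 =>
    -- The thread's transit node is unmarked, hence live, with a key above `n1` and at most that of
    -- `n2`. As `n2` is the successor of `n1`, `succ` and `inj` leave only `e = n2`. So the
    -- withdrawal bypasses the right node.
    have he : e = n2 := by
      rw [ha] at hcl
      simp only [ALoc.Claim, Passes] at hcl
      obtain ⟨k1, k2, k3⟩ := hcl
      have q1 := I.heldPub t n1 (by simp [ha, ALoc.held])
      have q2 := I.heldPub t n2 (by simp [ha, ALoc.held])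
      have l1 := I.pub_of_ne q1 k1.2
      have l2 := I.pub_of_ne q2 k2.2
      have le := I.pub_of_ne h1 (by
        rw [(I.trStatus t e (by simp [ha, ALoc.tr])).1]; decide)
      refine I.inj e n2 le l2 (h2.trans (I.pubNext n1 n2 q1 k3).2.2.symm) (le_antisymm h4 ?_)
      exact ((I.succ n1 n2 l1 k3).2 e le h2).resolve_left (not_le.2 h3)
    subst he
    exact I.mark t b _ n1 e ha (.inl rfl)
  | mark n1 n2 => exact I.mark t true _ n1 n2 ha (.inr ⟨rfl, rfl⟩)
  | unlink n1 n2 x h1 => exact I.unlink t n1 n2 x ha h1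

end AcyclicGraph

/-! ### The steps of the program as an inductive relation -/

namespace AcyclicGraph

open Loc in
/-- The steps of `next`, one constructor for each outcome, with those conditions that matter. -/
inductive NStep {K T : Type*} [LinearOrder K] (t : T) (h : Heap K T) :
    Loc K → Heap K T → Loc K → Prop
  | cvScan_next (k : K) (v w : ℕ)
      (h1 : (h.vnode v).val < key k) (h2 : (h.vnode v).vnext = some w) :
      NStep t h (cvScan k v) h (cvScan k w)
  | cvScan_absent (k : K) (v : ℕ)
      (h1 : ¬ (h.vnode v).val < key k) (h2 : (h.vnode v).val ≠ key k) :
      NStep t h (cvScan k v) h (idle (some false))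
  | cvScan_found (k : K) (v : ℕ) (h1 : (h.vnode v).val = key k) :
      NStep t h (cvScan k v) h (cvMark v)
  | cvMark (v : ℕ) :
      NStep t h (cvMark v) h (idle (some (!(h.vnode v).marked)))
  | vStart (j : VJob) (k : K) (v2 : ℕ) (h1 : (h.vnode vertexHead).vnext = some v2) :
      NStep t h (vStart j k) h (vScan j k vertexHead v2)
  | vScan_next (j : VJob) (k : K) (v1 v2 w : ℕ)
      (h1 : (h.vnode v2).val < key k) (h2 : (h.vnode v2).vnext = some w) :
      NStep t h (vScan j k v1 v2) h (vScan j k v2 w)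
  | vScan_stop (j : VJob) (k : K) (v1 v2 : ℕ) (h1 : key k ≤ (h.vnode v2).val) :
      NStep t h (vScan j k v1 v2) h (vAcq1 j k v1 v2)
  | vAcq1 (j : VJob) (k : K) (v1 v2 : ℕ) (h1 : (h.vnode v1).lock = none) :
      NStep t h (vAcq1 j k v1 v2) (h.setVLock v1 (some t)) (vAcq2 j k v1 v2)
  | vAcq2 (j : VJob) (k : K) (v1 v2 : ℕ) (h1 : (h.vnode v2).lock = none) :
      NStep t h (vAcq2 j k v1 v2) (h.setVLock v2 (some t)) (vVal1 j k v1 v2)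
  | vVal1_fail (j : VJob) (k : K) (v1 v2 : ℕ) (h1 : (h.vnode v1).marked = true) :
      NStep t h (vVal1 j k v1 v2) h (vRetry1 j k v1 v2)
  | vVal1_pass (j : VJob) (k : K) (v1 v2 : ℕ) (h1 : (h.vnode v1).marked = false) :
      NStep t h (vVal1 j k v1 v2) h (vVal2 j k v1 v2)
  | vVal2_fail (j : VJob) (k : K) (v1 v2 : ℕ) (h1 : (h.vnode v2).marked = true) :
      NStep t h (vVal2 j k v1 v2) h (vRetry1 j k v1 v2)
  | vVal2_pass (j : VJob) (k : K) (v1 v2 : ℕ) (h1 : (h.vnode v2).marked = false) :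
      NStep t h (vVal2 j k v1 v2) h (vVal3 j k v1 v2)
  | vVal3_fail (j : VJob) (k : K) (v1 v2 : ℕ) (h1 : (h.vnode v1).vnext ≠ some v2) :
      NStep t h (vVal3 j k v1 v2) h (vRetry1 j k v1 v2)
  | vVal3_pass (j : VJob) (k : K) (v1 v2 : ℕ) (h1 : (h.vnode v1).vnext = some v2) :
      NStep t h (vVal3 j k v1 v2) h (vBody j k v1 v2)
  | vRetry1 (j : VJob) (k : K) (v1 v2 : ℕ) :
      NStep t h (vRetry1 j k v1 v2) (h.setVLock v1 none) (vRetry2 j k v2)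
  | vRetry2 (j : VJob) (k : K) (v2 : ℕ) :
      NStep t h (vRetry2 j k v2) (h.setVLock v2 none) (vStart j k)
  | vBody_new (k : K) (v1 v2 : ℕ) (h1 : (h.vnode v2).val ≠ key k) :
      NStep t h (vBody .add k v1 v2) (h.newV (key k)) (vLink3 v1 v2 h.vcount)
  | vBody_present (k : K) (v1 v2 : ℕ) (h1 : (h.vnode v2).val = key k) :
      NStep t h (vBody .add k v1 v2) h (vRel1 .add true v1 v2)
  | vLink3 (v1 v2 v3 : ℕ) :
      NStep t h (vLink3 v1 v2 v3) (h.setVNext v3 (some v2)) (vLink1 v1 v2 v3)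
  | vLink1 (v1 v2 v3 : ℕ) :
      NStep t h (vLink1 v1 v2 v3) (h.setVNext v1 (some v3)) (vRel1 .add true v1 v2)
  | vBody_mark (k : K) (v1 v2 : ℕ) (h1 : (h.vnode v2).val = key k) :
      NStep t h (vBody .remove k v1 v2) (h.setMarked v2) (vReadNext v1 v2)
  | vBody_absent (k : K) (v1 v2 : ℕ) (h1 : (h.vnode v2).val ≠ key k) :
      NStep t h (vBody .remove k v1 v2) h (vRel1 .remove false v1 v2)
  | vReadNext (v1 v2 : ℕ) :
      NStep t h (vReadNext v1 v2) h (vUnlink v1 v2 (h.vnode v2).vnext)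
  | vUnlink (v1 v2 : ℕ) (x : Option ℕ) :
      NStep t h (vUnlink v1 v2 x) (h.setVNext v1 x) (vRel1 .remove true v1 v2)
  | vRel1 (j : VJob) (r : Bool) (v1 v2 : ℕ) :
      NStep t h (vRel1 j r v1 v2) (h.setVLock v1 none) (vRel2 j r v2)
  | vRel2 (j : VJob) (r : Bool) (v2 : ℕ) :
      NStep t h (vRel2 j r v2) (h.setVLock v2 none) (idle (some r))
  | hsScan1_next (o : EOp) (k1 k2 : K) (v w : ℕ)
      (h1 : (h.vnode v).val < key (min k1 k2)) (h2 : (h.vnode v).vnext = some w) :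
      NStep t h (hsScan1 o k1 k2 v) h (hsScan1 o k1 k2 w)
  | hsScan1_absent (o : EOp) (k1 k2 : K) (v : ℕ) :
      NStep t h (hsScan1 o k1 k2 v) h (idle (some false))
  | hsScan1_found (o : EOp) (k1 k2 : K) (v : ℕ) (h1 : (h.vnode v).val = key (min k1 k2)) :
      NStep t h (hsScan1 o k1 k2 v) h (hsMark1 o k1 k2 v)
  | hsMark1_fail (o : EOp) (k1 k2 : K) (v : ℕ) :
      NStep t h (hsMark1 o k1 k2 v) h (idle (some false))
  | hsMark1_pass (o : EOp) (k1 k2 : K) (v : ℕ) :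
      NStep t h (hsMark1 o k1 k2 v) h (hsNext o k1 k2 v)
  | hsNext (o : EOp) (k1 k2 : K) (v w : ℕ) (h1 : (h.vnode v).vnext = some w) :
      NStep t h (hsNext o k1 k2 v) h (hsScan2 o k1 k2 v w)
  | hsScan2_next (o : EOp) (k1 k2 : K) (v w x : ℕ)
      (h1 : (h.vnode w).val < key (max k1 k2)) (h2 : (h.vnode w).vnext = some x) :
      NStep t h (hsScan2 o k1 k2 v w) h (hsScan2 o k1 k2 v x)
  | hsScan2_absent (o : EOp) (k1 k2 : K) (v w : ℕ) :
      NStep t h (hsScan2 o k1 k2 v w) h (idle (some false))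
  | hsScan2_found (o : EOp) (k1 k2 : K) (v w : ℕ) :
      NStep t h (hsScan2 o k1 k2 v w) h (hsMark2 o k1 k2 v w)
  | hsMark2_fail (o : EOp) (k1 k2 : K) (v w : ℕ) :
      NStep t h (hsMark2 o k1 k2 v w) h (idle (some false))
  | hsMark2_lt (o : EOp) (k1 k2 : K) (v w : ℕ) :
      NStep t h (hsMark2 o k1 k2 v w) h (found h k1 k2 v w o)
  | hsMark2_ge (o : EOp) (k1 k2 : K) (v w : ℕ) :
      NStep t h (hsMark2 o k1 k2 v w) h (found h k1 k2 w v o)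
  | ceScan_next (k2 : K) (e f : ℕ)
      (h1 : (h.enode e).val < key k2) (h2 : (h.enode e).enext = some f) :
      NStep t h (ceScan k2 e) h (ceScan k2 f)
  | ceScan_absent (k2 : K) (e : ℕ) :
      NStep t h (ceScan k2 e) h (idle (some false))
  | ceScan_found (k2 : K) (e : ℕ) :
      NStep t h (ceScan k2 e) h (ceStatus e)
  | ceStatus (e : ℕ) :
      NStep t h (ceStatus e) h (idle (some (decide ((h.enode e).status = Status.added))))
  | eMark1_fail (j : EJob) (k1 k2 : K) (v1 v2 : ℕ) :
      NStep t h (eMark1 j k1 k2 v1 v2) h (idle (some false))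
  | eMark1_pass (j : EJob) (k1 k2 : K) (v1 v2 : ℕ) :
      NStep t h (eMark1 j k1 k2 v1 v2) h (eMark2 j k1 k2 v1 v2)
  | eMark2_fail (j : EJob) (k1 k2 : K) (v1 v2 : ℕ) :
      NStep t h (eMark2 j k1 k2 v1 v2) h (idle (some false))
  | eMark2_pass (j : EJob) (k1 k2 : K) (v1 v2 : ℕ) :
      NStep t h (eMark2 j k1 k2 v1 v2) h (eStart j k1 k2 v1)
  | eStart (j : EJob) (k1 k2 : K) (v1 e2 : ℕ)
      (h1 : (h.enode (h.vnode v1).edgeHead).enext = some e2) :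
      NStep t h (eStart j k1 k2 v1) h (eScan j k1 k2 v1 (h.vnode v1).edgeHead e2)
  | eScan_next (j : EJob) (k1 k2 : K) (v1 e1 e2 f : ℕ)
      (h1 : (h.enode e2).val < key k2) (h2 : (h.enode e2).enext = some f) :
      NStep t h (eScan j k1 k2 v1 e1 e2) h (eScan j k1 k2 v1 e2 f)
  | eScan_stop (j : EJob) (k1 k2 : K) (v1 e1 e2 : ℕ) (h1 : key k2 ≤ (h.enode e2).val) :
      NStep t h (eScan j k1 k2 v1 e1 e2) h (eAcq1 j k1 k2 v1 e1 e2)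
  | eAcq1 (j : EJob) (k1 k2 : K) (v1 e1 e2 : ℕ) (h1 : (h.enode e1).lock = none) :
      NStep t h (eAcq1 j k1 k2 v1 e1 e2) (h.setELock e1 (some t)) (eAcq2 j k1 k2 v1 e1 e2)
  | eAcq2 (j : EJob) (k1 k2 : K) (v1 e1 e2 : ℕ) (h1 : (h.enode e2).lock = none) :
      NStep t h (eAcq2 j k1 k2 v1 e1 e2) (h.setELock e2 (some t)) (eVal1 j k1 k2 v1 e1 e2)
  | eVal1_pass (j : EJob) (k1 k2 : K) (v1 e1 e2 : ℕ) (h1 : j.ok (h.enode e1).status) :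
      NStep t h (eVal1 j k1 k2 v1 e1 e2) h (eVal2 j k1 k2 v1 e1 e2)
  | eVal1_fail (j : EJob) (k1 k2 : K) (v1 e1 e2 : ℕ) (h1 : ¬ j.ok (h.enode e1).status) :
      NStep t h (eVal1 j k1 k2 v1 e1 e2) h (eRetry1 j k1 k2 v1 e1 e2)
  | eVal2_pass (j : EJob) (k1 k2 : K) (v1 e1 e2 : ℕ) (h1 : j.ok (h.enode e2).status) :
      NStep t h (eVal2 j k1 k2 v1 e1 e2) h (eVal3 j k1 k2 v1 e1 e2)
  | eVal2_fail (j : EJob) (k1 k2 : K) (v1 e1 e2 : ℕ) (h1 : ¬ j.ok (h.enode e2).status) :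
      NStep t h (eVal2 j k1 k2 v1 e1 e2) h (eRetry1 j k1 k2 v1 e1 e2)
  | eVal3_pass (j : EJob) (k1 k2 : K) (v1 e1 e2 : ℕ) (h1 : (h.enode e1).enext = some e2) :
      NStep t h (eVal3 j k1 k2 v1 e1 e2) h (eBody j k1 k2 v1 e1 e2)
  | eVal3_fail (j : EJob) (k1 k2 : K) (v1 e1 e2 : ℕ) (h1 : (h.enode e1).enext ≠ some e2) :
      NStep t h (eVal3 j k1 k2 v1 e1 e2) h (eRetry1 j k1 k2 v1 e1 e2)
  | eRetry1 (j : EJob) (k1 k2 : K) (v1 e1 e2 : ℕ) :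
      NStep t h (eRetry1 j k1 k2 v1 e1 e2) (h.setELock e1 none) (eRetry2 j k1 k2 v1 e2)
  | eRetry2 (j : EJob) (k1 k2 : K) (v1 e2 : ℕ) :
      NStep t h (eRetry2 j k1 k2 v1 e2) (h.setELock e2 none) (eStart j k1 k2 v1)
  | eBody_new (k1 k2 : K) (v1 e1 e2 : ℕ) (h1 : (h.enode e2).val ≠ key k2) :
      NStep t h (eBody .add k1 k2 v1 e1 e2) (h.newE (key k2)) (eLink3 k1 k2 v1 e1 e2 h.ecount)
  | eBody_present (k1 k2 : K) (v1 e1 e2 : ℕ) (h1 : (h.enode e2).val = key k2) :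
      NStep t h (eBody .add k1 k2 v1 e1 e2) h (eRel1 .add (.ret true) e1 e2)
  | eLink3 (k1 k2 : K) (v1 e1 e2 e3 : ℕ) :
      NStep t h (eLink3 k1 k2 v1 e1 e2 e3) (h.setENext e3 (some e2)) (eLink1 k1 k2 v1 e1 e2 e3)
  | eLink1 (k1 k2 : K) (v1 e1 e2 e3 : ℕ) :
      NStep t h (eLink1 k1 k2 v1 e1 e2 e3) (h.setENext e1 (some e3))
        (eRel1 .add (.detect k1 k2 v1 e3) e1 e2)
  | eBody_mark (k1 k2 : K) (v1 e1 e2 : ℕ) (h1 : (h.enode e2).val = key k2) :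
      NStep t h (eBody .remove k1 k2 v1 e1 e2) (h.setStatus e2 Status.marked)
        (eReadNext .remove e1 e2 e2)
  | eBody_absent (k1 k2 : K) (v1 e1 e2 : ℕ) (h1 : (h.enode e2).val ≠ key k2) :
      NStep t h (eBody .remove k1 k2 v1 e1 e2) h (eRel1 .remove (.ret true) e1 e2)
  | eBody_undo (k1 k2 : K) (v1 e1 e2 e3 : ℕ) :
      NStep t h (eBody (.undo e3) k1 k2 v1 e1 e2) (h.setStatus e3 Status.marked)
        (eReadNext (.undo e3) e1 e2 e3)
  | eReadNext (j : EJob) (e1 e2 d : ℕ) :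
      NStep t h (eReadNext j e1 e2 d) h (eUnlink j e1 e2 (h.enode d).enext)
  | eUnlink (j : EJob) (b : Bool) (e1 e2 : ℕ) (x : Option ℕ) :
      NStep t h (eUnlink j e1 e2 x) (h.setENext e1 x) (eRel1 j (.ret b) e1 e2)
  | eRel1 (j : EJob) (a : After K) (e1 e2 : ℕ) :
      NStep t h (eRel1 j a e1 e2) (h.setELock e1 none) (eRel2 j a e2)
  | eRel2 (j : EJob) (a : After K) (e2 : ℕ) :
      NStep t h (eRel2 j a e2) (h.setELock e2 none) (afterRelease a)
  | eCommit (e3 : ℕ) :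
      NStep t h (eCommit e3) (h.setStatus e3 Status.added) (idle (some true))
  | pScan_next (p : PVars K) (v w : ℕ)
      (h1 : (h.vnode v).val < p.cur) (h2 : (h.vnode v).vnext = some w) :
      NStep t h (pScan p v) h (pScan p w)
  | pScan_found (p : PVars K) (v : ℕ) :
      NStep t h (pScan p v) h (pMark p v)
  | pScan_fail (p : PVars K) (v : ℕ) :
      NStep t h (pScan p v) h (exitPath p.caller false)
  | pScan_absent (p : PVars K) (v : ℕ) :
      NStep t h (pScan p v) h (pPick { p with X := insert p.cur p.X })
  | pMark_pass (p : PVars K) (v : ℕ) :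
      NStep t h (pMark p v) h (pTest p (h.vnode v).edgeHead)
  | pMark_fail (p : PVars K) (v : ℕ) :
      NStep t h (pMark p v) h (exitPath p.caller false)
  | pMark_absent (p : PVars K) (v : ℕ) :
      NStep t h (pMark p v) h (pPick { p with X := insert p.cur p.X })
  | pTest_stop (p : PVars K) (e : ℕ) :
      NStep t h (pTest p e) h (pCheck p)
  | pTest_go (p : PVars K) (e : ℕ) (h1 : (h.enode e).enext ≠ none) :
      NStep t h (pTest p e) h (pStatus p e)
  | pStatus_add (p : PVars K) (e : ℕ) :
      NStep t h (pStatus p e) h (pNext { p with R := insert (h.enode e).val p.R } e)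
  | pStatus_skip (p : PVars K) (e : ℕ) :
      NStep t h (pStatus p e) h (pNext p e)
  | pNext (p : PVars K) (e f : ℕ) (h1 : (h.enode e).enext = some f) :
      NStep t h (pNext p e) h (pTest p f)
  | pCheck_found (p : PVars K) :
      NStep t h (pCheck p) h (exitPath p.caller true)
  | pCheck_not (p : PVars K) :
      NStep t h (pCheck p) h (pPick { p with X := insert p.cur p.X })
  | pPick_done (p : PVars K) :
      NStep t h (pPick p) h (exitPath p.caller false)
  | pPick_go (p : PVars K) (x : Key K) (h1 : x ∉ p.X) :
      NStep t h (pPick p) h (pScan { p with cur := x, first := false } vertexHead)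

/-- Only this inclusion is needed, which is why constructors may omit conditions: invariants and
ranks concern steps that occur, while the existence of a step is proved for `next` itself. -/
theorem nstep_of_mem_next {K T : Type*} [LinearOrder K] {t : T} {h h' : Heap K T} {l l' : Loc K}
    (hn : (h', l') ∈ next t h l) : NStep t h l h' l' := by
  cases l with
  | vBody j k v1 v2 =>
    cases j <;> simp only [next] at hn <;> split_ifs at hn <;> obtain ⟨rfl, rfl⟩ := hn
    · exact .vBody_new _ _ _ ‹_›
    · exact .vBody_present _ _ _ (not_not.1 ‹_›)
    · exact .vBody_mark _ _ _ ‹_›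
    · exact .vBody_absent _ _ _ ‹_›
  | eBody j k1 k2 v1 e1 e2 =>
    cases j <;> simp only [next] at hn <;> (try split_ifs at hn) <;> obtain ⟨rfl, rfl⟩ := hn
    · exact .eBody_new _ _ _ _ _ ‹_›
    · exact .eBody_present _ _ _ _ _ (not_not.1 ‹_›)
    · exact .eBody_mark _ _ _ _ _ ‹_›
    · exact .eBody_absent _ _ _ _ _ ‹_›
    · exact .eBody_undo _ _ _ _ _ _
  | eUnlink j e1 e2 x =>
    cases j <;> simp only [next] at hn <;> obtain ⟨rfl, rfl⟩ := hn <;> exact .eUnlink _ _ _ _ _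
  | pPick p =>
    simp only [next] at hn
    split_ifs at hn
    · obtain ⟨rfl, rfl⟩ := hn; exact .pPick_done _
    · obtain ⟨x, hx, he⟩ := hn
      obtain ⟨rfl, rfl⟩ := he
      exact .pPick_go _ _ (Finset.mem_sdiff.1 hx).2
  | _ =>
    simp only [next, Option.isNone_iff_eq_none] at hn
    first
      | exact hn.elim
      | repeat' split at hn
    all_goals first
      | exact hn.elim
      | (obtain ⟨rfl, rfl⟩ := hn
         constructor <;> first | assumption | grind)

end AcyclicGraph

/-! ### Heaps and control states seen as abstract nodes; facts that survive interference -/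

namespace AcyclicGraph

variable {K T : Type*}

/-- The nodes of a heap, vertex nodes and edge nodes alike. -/
def view (h : Heap K T) : Node → Cell K T
  | .vertex a => ⟨(h.vnode a).val, (h.vnode a).vnext.map .vertex,
      -- Vertex nodes are never in transit, so for them the strict and the weak test both mean
      -- "unmarked".
      if (h.vnode a).marked then .marked else .added, (h.vnode a).lock⟩
  | .edge a => ⟨(h.enode a).val, (h.enode a).enext.map .edge, (h.enode a).status,
      (h.enode a).lock⟩

theorem view_lock (h : Heap K T) (n : Node) : (view h n).lock = h.owner n := by
  cases n <;> rfl

theorem view_setVNext (h : Heap K T) (a : ℕ) (x : Option ℕ) :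
    view (h.setVNext a x) = Function.update (view h) (.vertex a)
      { view h (.vertex a) with next := x.map .vertex } := by
  funext n
  rcases n with b | b
  · by_cases hb : b = a
    · subst hb; simp [view, Heap.setVNext, Heap.modV]
    · simp [view, Heap.setVNext, Heap.modV, hb]
  · simp [view, Heap.setVNext, Heap.modV]

theorem view_setMarked (h : Heap K T) (a : ℕ) :
    view (h.setMarked a) = Function.update (view h) (.vertex a)
      { view h (.vertex a) with status := .marked } := by
  funext n
  rcases n with b | b
  · by_cases hb : b = a
    · subst hb; simp [view, Heap.setMarked, Heap.modV]
    · simp [view, Heap.setMarked, Heap.modV, hb]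
  · simp [view, Heap.setMarked, Heap.modV]

theorem view_setVLock (h : Heap K T) (a : ℕ) (x : Option T) :
    view (h.setVLock a x) = Function.update (view h) (.vertex a)
      { view h (.vertex a) with lock := x } := by
  funext n
  rcases n with b | b
  · by_cases hb : b = a
    · subst hb; simp [view, Heap.setVLock, Heap.modV]
    · simp [view, Heap.setVLock, Heap.modV, hb]
  · simp [view, Heap.setVLock, Heap.modV]

theorem view_setENext (h : Heap K T) (a : ℕ) (x : Option ℕ) :
    view (h.setENext a x) = Function.update (view h) (.edge a)
      { view h (.edge a) with next := x.map .edge } := by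
  funext n
  rcases n with b | b
  · rw [Function.update_of_ne (by simp)]; rfl
  · by_cases hb : b = a
    · subst hb; simp [view, Heap.setENext, Heap.modE]
    · simp [view, Heap.setENext, Heap.modE, hb]

theorem view_setStatus (h : Heap K T) (a : ℕ) (x : Status) :
    view (h.setStatus a x) = Function.update (view h) (.edge a)
      { view h (.edge a) with status := x } := by
  funext n
  rcases n with b | b
  · rw [Function.update_of_ne (by simp)]; rfl
  · by_cases hb : b = a
    · subst hb; simp [view, Heap.setStatus, Heap.modE]
    · simp [view, Heap.setStatus, Heap.modE, hb]

theorem view_setELock (h : Heap K T) (a : ℕ) (x : Option T) :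
    view (h.setELock a x) = Function.update (view h) (.edge a)
      { view h (.edge a) with lock := x } := by
  funext n
  rcases n with b | b
  · rw [Function.update_of_ne (by simp)]; rfl
  · by_cases hb : b = a
    · subst hb; simp [view, Heap.setELock, Heap.modE]
    · simp [view, Heap.setELock, Heap.modE, hb]

theorem view_newV (h : Heap K T) (k : Key K) :
    view (h.newV k) = Function.update
      (Function.update (Function.update (view h) (.edge h.ecount)
        ⟨⊥, some (.edge (h.ecount + 1)), .added, none⟩) (.edge (h.ecount + 1))
        ⟨⊤, none, .added, none⟩) (.vertex h.vcount) ⟨k, none, .added, none⟩ := by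
  funext n
  rcases n with b | b
  · by_cases hb : b = h.vcount
    · subst hb; simp [view, Heap.newV]
    · simp [view, Heap.newV, hb]
  · by_cases hb : b = h.ecount + 1
    · subst hb; simp [view, Heap.newV]
    · by_cases hb' : b = h.ecount
      · subst hb'; simp [view, Heap.newV]
      · simp [view, Heap.newV, hb, hb']

theorem view_newE (h : Heap K T) (k : Key K) :
    view (h.newE k) = Function.update (view h) (.edge h.ecount) ⟨k, none, .transit, none⟩ := by
  funext n
  rcases n with b | b
  · rw [Function.update_of_ne (by simp)]; rfl
  · by_cases hb : b = h.ecount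
    · subst hb; simp [view, Heap.newE]
    · simp [view, Heap.newE, hb]

/-- The transit node owned by a thread that executes a job. -/
def EJob.tr : EJob → Option Node
  | undo e3 => some (.edge e3)
  | _ => none

def EJob.strict : EJob → Bool
  | remove => true
  | _ => false

def After.tr : After K → Option Node
  | ret _ => none
  | detect _ _ _ e3 => some (.edge e3)

def PCaller.tr : PCaller K → Option Node
  | method => none
  | addEdge _ _ _ e3 => some (.edge e3)

theorem EJob.ok_iff (j : EJob) (s : Status) : j.ok s ↔ Passes j.strict s := by
  cases j <;> simp [EJob.ok, Passes, EJob.strict]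
  rintro rfl; decide

namespace Loc

/-- What matters about a control state for locks and list operations. -/
def abs : Loc K → ALoc
  | vAcq2 _ _ v1 _ => .one none (.vertex v1)
  | vVal1 _ _ v1 v2 | vRetry1 _ _ v1 v2 | vRel1 _ _ v1 v2 => .both none (.vertex v1) (.vertex v2)
  | vVal2 _ _ v1 v2 => .val2 true none (.vertex v1) (.vertex v2)
  | vVal3 _ _ v1 v2 => .val3 true none (.vertex v1) (.vertex v2)
  | vBody _ _ v1 v2 => .body true none (.vertex v1) (.vertex v2)
  | vRetry2 _ _ v2 | vRel2 _ _ v2 => .one none (.vertex v2)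
  | vLink3 v1 v2 v3 => .link3 none (.vertex v1) (.vertex v2) (.vertex v3)
  | vLink1 v1 v2 v3 => .link1 none (.vertex v1) (.vertex v2) (.vertex v3)
  | vReadNext v1 v2 => .readNext (.vertex v1) (.vertex v2) (.vertex v2)
  | vUnlink v1 v2 x => .unlink (.vertex v1) (.vertex v2) (x.map .vertex)
  | eStart j _ _ _ | eScan j _ _ _ _ _ | eAcq1 j _ _ _ _ _ => .free j.tr
  | eAcq2 j _ _ _ e1 _ => .one j.tr (.edge e1)
  | eVal1 j _ _ _ e1 e2 | eRetry1 j _ _ _ e1 e2 => .both j.tr (.edge e1) (.edge e2)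
  | eVal2 j _ _ _ e1 e2 => .val2 j.strict j.tr (.edge e1) (.edge e2)
  | eVal3 j _ _ _ e1 e2 => .val3 j.strict j.tr (.edge e1) (.edge e2)
  | eBody j _ _ _ e1 e2 => .body j.strict j.tr (.edge e1) (.edge e2)
  | eRetry2 j _ _ _ e2 => .one j.tr (.edge e2)
  | eLink3 _ _ _ e1 e2 e3 => .link3 (some (.edge e3)) (.edge e1) (.edge e2) (.edge e3)
  | eLink1 _ _ _ e1 e2 e3 => .link1 (some (.edge e3)) (.edge e1) (.edge e2) (.edge e3)
  | eReadNext _ e1 e2 d => .readNext (.edge e1) (.edge e2) (.edge d)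
  | eUnlink _ e1 e2 x => .unlink (.edge e1) (.edge e2) (x.map .edge)
  | eRel1 _ a e1 e2 => .both a.tr (.edge e1) (.edge e2)
  | eRel2 _ a e2 => .one a.tr (.edge e2)
  | eCommit e3 => .free (some (.edge e3))
  | pScan p _ | pMark p _ | pTest p _ | pStatus p _ | pNext p _ | pCheck p | pPick p =>
    .free p.caller.tr
  | _ => .free none

end Loc

/-- The transit node `e3` belongs to the edge list of the vertex node `v1` and has the key `k2`. -/
def TransitAt (h : Heap K T) (g : Ghost) (k2 : K) (v1 e3 : ℕ) : Prop :=
  g.Pub (.vertex v1) ∧ g.Pub (.edge e3) ∧ (h.enode e3).val = key k2 ∧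
    g.home (.edge e3) = .edge (h.vnode v1).edgeHead

def EJob.Fits (h : Heap K T) (g : Ghost) (k2 : K) (v1 : ℕ) : EJob → Prop
  | undo e3 => TransitAt h g k2 v1 e3
  | _ => True

def After.Fits (h : Heap K T) (g : Ghost) : After K → Prop
  | ret _ => True
  | detect _ k2 v1 e3 => TransitAt h g k2 v1 e3

def PCaller.Fits (h : Heap K T) (g : Ghost) : PCaller K → Prop
  | method => True
  | addEdge _ k2 v1 e3 => TransitAt h g k2 v1 e3

variable [LinearOrder K]

def VPos (h : Heap K T) (g : Ghost) (k : K) (v1 v2 : ℕ) : Prop :=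
  g.Pub (.vertex v1) ∧ g.Pub (.vertex v2) ∧ (h.vnode v1).val < key k ∧ key k ≤ (h.vnode v2).val

def EPos (h : Heap K T) (g : Ghost) (k2 : K) (v1 e1 e2 : ℕ) : Prop :=
  g.Pub (.vertex v1) ∧ g.Pub (.edge e1) ∧ g.Pub (.edge e2) ∧
    g.home (.edge e1) = .edge (h.vnode v1).edgeHead ∧
    g.home (.edge e2) = .edge (h.vnode v1).edgeHead ∧
    (h.enode e1).val < key k2 ∧ key k2 ≤ (h.enode e2).val

open Loc in
/-- The facts about the local variables that no step of another thread can invalidate. -/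
def Static (h : Heap K T) (g : Ghost) : Loc K → Prop
  | cvScan _ v => g.Pub (.vertex v)
  | vScan _ k v1 v2 => g.Pub (.vertex v1) ∧ g.Pub (.vertex v2) ∧ (h.vnode v1).val < key k
  | vAcq1 _ k v1 v2 | vAcq2 _ k v1 v2 | vVal1 _ k v1 v2 | vVal2 _ k v1 v2 | vVal3 _ k v1 v2
  | vRetry1 _ k v1 v2 | vBody _ k v1 v2 => VPos h g k v1 v2
  | vLink3 v1 v2 v3 | vLink1 v1 v2 v3 => g.Pub (.vertex v1) ∧ g.Pub (.vertex v2) ∧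
      g.place (.vertex v3) ≠ .unalloc ∧ (h.vnode v1).val < (h.vnode v3).val ∧
      (h.vnode v3).val < (h.vnode v2).val
  -- The removed node is not the tail sentinel, so the pointer about to be read is not null.
  | vReadNext v1 v2 => g.Pub (.vertex v1) ∧ g.Pub (.vertex v2) ∧
      (h.vnode v1).val < (h.vnode v2).val ∧ (h.vnode v2).val ≠ ⊤
  | vUnlink v1 v2 x => g.Pub (.vertex v1) ∧ g.Pub (.vertex v2) ∧
      (h.vnode v1).val < (h.vnode v2).val ∧ (h.vnode v2).val ≠ ⊤ ∧ x ≠ none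
  | vRel1 _ _ v1 v2 => v1 ≠ v2
  | hsScan1 _ _ _ v => g.Pub (.vertex v)
  | hsMark1 _ _ _ v | hsNext _ _ _ v => g.Pub (.vertex v) ∧ (h.vnode v).val ≠ ⊤
  | hsScan2 _ _ _ v w | hsMark2 _ _ _ v w => g.Pub (.vertex v) ∧ g.Pub (.vertex w)
  | ceScan _ e => g.Pub (.edge e)
  | eMark1 j _ _ v1 _ | eMark2 j _ _ v1 _ => g.Pub (.vertex v1) ∧ ∀ e3, j ≠ .undo e3
  | eStart j _ k2 v1 => g.Pub (.vertex v1) ∧ j.Fits h g k2 v1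
  | eScan j _ k2 v1 e1 e2 => j.Fits h g k2 v1 ∧ g.Pub (.vertex v1) ∧ g.Pub (.edge e1) ∧
      g.Pub (.edge e2) ∧ g.home (.edge e1) = .edge (h.vnode v1).edgeHead ∧
      g.home (.edge e2) = .edge (h.vnode v1).edgeHead ∧ (h.enode e1).val < key k2
  | eAcq1 j _ k2 v1 e1 e2 | eAcq2 j _ k2 v1 e1 e2 | eVal1 j _ k2 v1 e1 e2 | eVal2 j _ k2 v1 e1 e2
  | eVal3 j _ k2 v1 e1 e2 | eRetry1 j _ k2 v1 e1 e2 | eBody j _ k2 v1 e1 e2 =>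
      j.Fits h g k2 v1 ∧ EPos h g k2 v1 e1 e2
  | eRetry2 j _ k2 v1 _ => g.Pub (.vertex v1) ∧ j.Fits h g k2 v1
  | eLink3 _ k2 v1 e1 e2 e3 | eLink1 _ k2 v1 e1 e2 e3 => EPos h g k2 v1 e1 e2 ∧
      g.place (.edge e3) ≠ .unalloc ∧ g.home (.edge e3) = .edge (h.vnode v1).edgeHead ∧
      (h.enode e3).val = key k2 ∧ (h.enode e3).val < (h.enode e2).val
  | eReadNext _ e1 e2 d => g.Pub (.edge e1) ∧ g.Pub (.edge e2) ∧ g.Pub (.edge d) ∧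
      (h.enode e1).val < (h.enode e2).val ∧ (h.enode d).val ≠ ⊤
  | eUnlink _ e1 e2 x => g.Pub (.edge e1) ∧ g.Pub (.edge e2) ∧
      (h.enode e1).val < (h.enode e2).val ∧ x ≠ none
  | eRel1 _ a e1 e2 => e1 ≠ e2 ∧ a.Fits h g
  | eRel2 _ a _ => a.Fits h g
  | pScan p v => p.caller.Fits h g ∧ g.Pub (.vertex v)
  | pMark p v => p.caller.Fits h g ∧ g.Pub (.vertex v)
  | pTest p e => p.caller.Fits h g ∧ g.Pub (.edge e)
  | pStatus p e | pNext p e => p.caller.Fits h g ∧ g.Pub (.edge e) ∧ (h.enode e).val ≠ ⊤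
  | pCheck p | pPick p => p.caller.Fits h g
  | _ => True

/-- The link between the heap and the auxiliary state. -/
structure HeapInv (h : Heap K T) (g : Ghost) : Prop where
  vAlloc : ∀ a, g.place (.vertex a) = .unalloc ↔ h.vcount ≤ a
  eAlloc : ∀ a, g.place (.edge a) = .unalloc ↔ h.ecount ≤ a
  vHome : ∀ a, g.home (.vertex a) = .vertex 0
  -- This keeps homes away from addresses still to be allocated, so that the head of a new edge list
  -- is not already the home of some node.
  eHome : ∀ a, g.place (.edge a) ≠ .unalloc → g.place (g.home (.edge a)) ≠ .unalloc
  vHead : g.place (.vertex vertexHead) = .live ∧ (h.vnode vertexHead).val = ⊥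
  eHead : ∀ a, g.place (.vertex a) ≠ .unalloc →
    g.place (.edge (h.vnode a).edgeHead) = .live ∧ (h.enode (h.vnode a).edgeHead).val = ⊥ ∧
      g.home (.edge (h.vnode a).edgeHead) = .edge (h.vnode a).edgeHead

/-- Allocated nodes keep their immutable fields, published nodes remain published. -/
structure Extends (h : Heap K T) (g : Ghost) (h' : Heap K T) (g' : Ghost) : Prop where
  pub : ∀ n, g.Pub n → g'.Pub n
  alloc : ∀ n, g.place n ≠ .unalloc → g'.place n ≠ .unalloc
  home : ∀ n, g.place n ≠ .unalloc → g'.home n = g.home n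
  vval : ∀ a, g.place (.vertex a) ≠ .unalloc → (h'.vnode a).val = (h.vnode a).val
  edgeHead : ∀ a, g.place (.vertex a) ≠ .unalloc → (h'.vnode a).edgeHead = (h.vnode a).edgeHead
  eval : ∀ a, g.place (.edge a) ≠ .unalloc → (h'.enode a).val = (h.enode a).val

theorem Ghost.Pub.alloc {g : Ghost} {n : Node} (h : g.Pub n) : g.place n ≠ .unalloc := by
  rcases h with h | h <;> simp [h]

theorem TransitAt.mono {h h' : Heap K T} {g g' : Ghost} (H : Extends h g h' g') {k2 : K}
    {v1 e3 : ℕ} (hs : TransitAt h g k2 v1 e3) : TransitAt h' g' k2 v1 e3 := by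
  obtain ⟨h1, h2, h3, h4⟩ := hs
  refine ⟨H.pub _ h1, H.pub _ h2, ?_, ?_⟩
  · rw [H.eval _ h2.alloc, h3]
  · rw [H.home _ h2.alloc, h4, H.edgeHead _ h1.alloc]

theorem EJob.Fits.mono {h h' : Heap K T} {g g' : Ghost} (H : Extends h g h' g') {k2 : K} {v1 : ℕ}
    {j : EJob} (hs : j.Fits h g k2 v1) : j.Fits h' g' k2 v1 := by
  cases j
  · trivial
  · trivial
  · exact TransitAt.mono H hs

theorem After.Fits.mono {h h' : Heap K T} {g g' : Ghost} (H : Extends h g h' g')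
    {a : After K} (hs : a.Fits h g) : a.Fits h' g' := by
  cases a
  · trivial
  · exact TransitAt.mono H hs

theorem PCaller.Fits.mono {h h' : Heap K T} {g g' : Ghost} (H : Extends h g h' g')
    {a : PCaller K} (hs : a.Fits h g) : a.Fits h' g' := by
  cases a
  · trivial
  · exact TransitAt.mono H hs

/-- Apart from relations among local variables, these facts concern immutable fields, homes,
allocation and publication, all of which are permanent. -/
theorem Static.mono {h h' : Heap K T} {g g' : Ghost} (H : Extends h g h' g')
    {l : Loc K} (hs : Static h g l) : Static h' g' l := by
  obtain ⟨h1, h2, h3, h4, h5, h6⟩ := id H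
  have p : ∀ n, g.Pub n → g.place n ≠ .unalloc := fun n h => h.alloc
  cases l <;> simp only [Static, VPos, EPos] at hs ⊢ <;>
    grind [EJob.Fits.mono, After.Fits.mono, PCaller.Fits.mono]

end AcyclicGraph

/-! ### Effect of writes and allocations on the link between heap and auxiliary state -/

namespace AcyclicGraph

variable {K T : Type*}

/-- The two heaps have the same nodes, with the same immutable fields. -/
structure SameShape (h h' : Heap K T) : Prop where
  vcount : h'.vcount = h.vcount
  ecount : h'.ecount = h.ecount
  vval : ∀ a, (h'.vnode a).val = (h.vnode a).val
  edgeHead : ∀ a, (h'.vnode a).edgeHead = (h.vnode a).edgeHead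
  eval : ∀ a, (h'.enode a).val = (h.enode a).val

theorem SameShape.modV (h : Heap K T) (a : ℕ) (f : VNode K T → VNode K T)
    (hf : ∀ n, (f n).val = n.val ∧ (f n).edgeHead = n.edgeHead) : SameShape h (h.modV a f) := by
  refine ⟨rfl, rfl, fun b => ?_, fun b => ?_, fun b => rfl⟩ <;> by_cases hb : b = a
  · subst hb; simp [Heap.modV, hf]
  · simp [Heap.modV, hb]
  · subst hb; simp [Heap.modV, hf]
  · simp [Heap.modV, hb]

theorem SameShape.modE (h : Heap K T) (a : ℕ) (f : ENode K T → ENode K T)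
    (hf : ∀ n, (f n).val = n.val) : SameShape h (h.modE a f) := by
  refine ⟨rfl, rfl, fun b => rfl, fun b => rfl, fun b => ?_⟩
  by_cases hb : b = a
  · subst hb; simp [Heap.modE, hf]
  · simp [Heap.modE, hb]

variable [LinearOrder K]

theorem HeapInv.shape {h h' : Heap K T} {g : Ghost} (H : HeapInv h g) (hs : SameShape h h') :
    HeapInv h' g := by
  obtain ⟨s1, s2, s3, s4, s5⟩ := hs
  obtain ⟨h1, h2, h3, h4, h5, h6⟩ := H
  refine ⟨?_, ?_, h3, h4, ?_, ?_⟩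
  · simpa [s1] using h1
  · simpa [s2] using h2
  · simpa [s3] using h5
  · simpa [s4, s5] using h6

theorem Extends.shape {h h' : Heap K T} (g : Ghost) (hs : SameShape h h') :
    Extends h g h' g :=
  ⟨fun _ h => h, fun _ h => h, fun _ _ => rfl, fun a _ => hs.vval a, fun a _ => hs.edgeHead a,
    fun a _ => hs.eval a⟩

theorem Extends.trans {h h' h'' : Heap K T} {g g' g'' : Ghost} (H : Extends h g h' g')
    (H' : Extends h' g' h'' g'') : Extends h g h'' g'' := by
  refine ⟨fun n hn => H'.pub n (H.pub n hn), fun n hn => H'.alloc n (H.alloc n hn),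
    fun n hn => (H'.home n (H.alloc n hn)).trans (H.home n hn),
    fun n hn => (H'.vval n (H.alloc _ hn)).trans (H.vval n hn),
    fun n hn => (H'.edgeHead n (H.alloc _ hn)).trans (H.edgeHead n hn),
    fun n hn => (H'.eval n (H.alloc _ hn)).trans (H.eval n hn)⟩

/-- Head sentinels must stay live. They have key `⊥`, which `hd` excludes for a node that does not
become live. -/
theorem HeapInv.setPlace {h : Heap K T} {g : Ghost} (H : HeapInv h g) {n : Node} {p : Place}
    (hn : g.place n ≠ .unalloc) (hp : p ≠ .unalloc) (hd : p = .live ∨ (view h n).val ≠ ⊥) :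
    HeapInv h (g.setPlace n p) := by
  have e : ∀ m, (g.setPlace n p).place m = if m = n then p else g.place m := by
    intro m; simp [Ghost.setPlace, Function.update_apply]
  have e' : (g.setPlace n p).home = g.home := rfl
  have e'' : ∀ m, (g.setPlace n p).place m = .unalloc ↔ g.place m = .unalloc := by
    intro m; rw [e]; split_ifs with hm
    · subst hm; simp [hn, hp]
    · rfl
  obtain ⟨h1, h2, h3, h4, h5, h6⟩ := H
  refine ⟨fun a => by rw [e'', h1], fun a => by rw [e'', h2], h3, ?_, ?_, ?_⟩
  · intro a ha
    rw [ne_eq, e''] at ha ⊢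
    exact h4 a ha
  · refine ⟨?_, h5.2⟩
    rw [e]; split_ifs with hm
    · subst hm; exact hd.resolve_right fun h => h h5.2
    · exact h5.1
  · intro a ha
    rw [ne_eq, e''] at ha
    obtain ⟨k1, k2, k3⟩ := h6 a ha
    refine ⟨?_, k2, k3⟩
    rw [e]; split_ifs with hm
    · subst hm; exact hd.resolve_right fun h => h k2
    · exact k1

theorem Extends.setPlace (h : Heap K T) {g : Ghost} {n : Node} {p : Place}
    (hp : p = .live ∨ p = .dead) : Extends h g h (g.setPlace n p) := by
  have e : ∀ m, (g.setPlace n p).place m = if m = n then p else g.place m := by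
    intro m; simp [Ghost.setPlace, Function.update_apply]
  refine ⟨fun m hm => ?_, fun m hm => ?_, fun _ _ => rfl, fun _ _ => rfl, fun _ _ => rfl,
    fun _ _ => rfl⟩
  · simp only [Ghost.Pub, e]; split_ifs
    · exact hp
    · exact hm
  · rw [e]; split_ifs
    · rcases hp with rfl | rfl <;> simp
    · exact hm

theorem HeapInv.newE {h : Heap K T} {g : Ghost} (H : HeapInv h g) (k : Key K) {e : ℕ}
    (he : g.place (.edge e) ≠ .unalloc) :
    HeapInv (h.newE k)
      ((g.setPlace (.edge h.ecount) .fresh).setHome (.edge h.ecount) (g.home (.edge e))) := by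
  generalize hg' : (g.setPlace (.edge h.ecount) .fresh).setHome (.edge h.ecount)
    (g.home (.edge e)) = g'
  have e1 : ∀ m, g'.place m = if m = .edge h.ecount then .fresh else g.place m := by
    intro m; simp [← hg', Ghost.setPlace, Ghost.setHome, Function.update_apply]
  have e2 : ∀ m, g'.home m = if m = .edge h.ecount then g.home (.edge e) else g.home m := by
    intro m; simp [← hg', Ghost.setPlace, Ghost.setHome, Function.update_apply]
  have e3 : ∀ a, ((h.newE k).enode a) = if a = h.ecount then ⟨k, none, .transit, none⟩ else
      h.enode a := by
    intro a; simp [Heap.newE, Function.update_apply]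
  obtain ⟨h1, h2, h3, h4, h5, h6⟩ := H
  have hu := (h2 h.ecount).2 le_rfl
  refine ⟨?_, ?_, ?_, ?_, ?_, ?_⟩
  · intro a; simp [e1, h1, Heap.newE]
  · intro a
    rw [e1]
    simp only [Heap.newE, Node.edge.injEq]
    split_ifs with ha
    · simp [ha]
    · rw [h2]; omega
  · intro a; simp [e2, h3]
  · intro a ha
    rw [e2]
    by_cases hae : Node.edge a = .edge h.ecount
    · rw [if_pos hae, e1]
      have := h4 e he
      split_ifs
      · simp
      · exact this
    · rw [if_neg hae, e1]
      rw [e1, if_neg hae] at ha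
      have := h4 a ha
      split_ifs
      · simp
      · exact this
  · refine ⟨?_, h5.2⟩
    simp [e1, h5.1]
  · intro a ha
    have ha' : g.place (.vertex a) ≠ .unalloc := by simpa [e1] using ha
    obtain ⟨k1, k2, k3⟩ := h6 a ha'
    have hne : ((h.newE k).vnode a).edgeHead ≠ h.ecount := by
      intro hc
      change (h.vnode a).edgeHead = _ at hc
      rw [hc, hu] at k1
      cases k1
    simp only [e1, e2, e3, Node.edge.injEq, hne, if_false]
    exact ⟨k1, k2, k3⟩

theorem Extends.newE {h : Heap K T} {g : Ghost} (H : HeapInv h g) (k : Key K) (m : Node) :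
    Extends h g (h.newE k)
      ((g.setPlace (.edge h.ecount) .fresh).setHome (.edge h.ecount) m) := by
  have hu := (H.eAlloc h.ecount).2 le_rfl
  have hne : ∀ n, g.place n ≠ .unalloc → n ≠ .edge h.ecount := by rintro n hn rfl; exact hn hu
  refine ⟨fun n hn => ?_, fun n hn => ?_, fun n hn => ?_, fun _ _ => rfl, fun _ _ => rfl,
    fun a ha => ?_⟩
  · simpa [Ghost.Pub, Ghost.setPlace, Ghost.setHome, hne n hn.alloc] using hn
  · simpa [Ghost.setPlace, Ghost.setHome, hne n hn] using hn
  · simp [Ghost.setPlace, Ghost.setHome, hne n hn]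
  · have : a ≠ h.ecount := by simpa using hne _ ha
    simp [Heap.newE, this]

/-- The auxiliary state after the creation of the edge list of a new vertex node. -/
noncomputable def Ghost.newList (g : Ghost) (n m : Node) : Ghost :=
  (((g.setPlace n .live).setPlace m .live).setHome n n).setHome m n

/-- The auxiliary state after the creation of a new vertex node. -/
noncomputable def Ghost.newV (g : Ghost) (h : Heap K T) (m : Node) : Ghost :=
  ((g.newList (.edge h.ecount) (.edge (h.ecount + 1))).setPlace (.vertex h.vcount) .fresh).setHome
    (.vertex h.vcount) m

omit [LinearOrder K] in
theorem Ghost.newV_place (g : Ghost) (h : Heap K T) (m n : Node) :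
    (g.newV h m).place n = if n = .vertex h.vcount then .fresh else
      if n = .edge (h.ecount + 1) then .live else if n = .edge h.ecount then .live
      else g.place n := by
  simp [Ghost.newV, Ghost.newList, Ghost.setPlace, Ghost.setHome, Function.update_apply]

omit [LinearOrder K] in
theorem Ghost.newV_home (g : Ghost) (h : Heap K T) (m n : Node) :
    (g.newV h m).home n = if n = .vertex h.vcount then m else
      if n = .edge (h.ecount + 1) then .edge h.ecount else
      if n = .edge h.ecount then .edge h.ecount else g.home n := by
  simp [Ghost.newV, Ghost.newList, Ghost.setPlace, Ghost.setHome, Function.update_apply]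

theorem HeapInv.newV {h : Heap K T} {g : Ghost} (H : HeapInv h g) (k : Key K) :
    HeapInv (h.newV k) (g.newV h (.vertex 0)) := by
  have e1 := g.newV_place h (.vertex 0)
  have e2 := g.newV_home h (.vertex 0)
  generalize g.newV h (.vertex 0) = g' at e1 e2
  have e3 : ∀ a, ((h.newV k).vnode a) = if a = h.vcount then ⟨k, none, h.ecount, false, none⟩ else
      h.vnode a := by
    intro a; simp [Heap.newV, Function.update_apply]
  have e4 : ∀ a, ((h.newV k).enode a) = if a = h.ecount + 1 then ⟨⊤, none, Status.added, none⟩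
      else if a = h.ecount then ⟨⊥, some (h.ecount + 1), Status.added, none⟩ else h.enode a := by
    intro a; simp [Heap.newV, Function.update_apply]
  obtain ⟨h1, h2, h3, h4, h5, h6⟩ := H
  have hu := (h2 h.ecount).2 le_rfl
  have hu' := (h2 (h.ecount + 1)).2 (by omega)
  have hv := (h1 h.vcount).2 le_rfl
  refine ⟨?_, ?_, ?_, ?_, ?_, ?_⟩
  · intro a
    rw [e1]
    simp only [Heap.newV, Node.vertex.injEq, reduceCtorEq, if_false]
    split_ifs with ha
    · simp [ha]
    · rw [h1]; omega
  · intro a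
    rw [e1]
    simp only [Heap.newV, Node.edge.injEq, reduceCtorEq, if_false]
    split_ifs with ha hb
    · simp [ha]
    · simp [hb]
    · rw [h2]; omega
  · intro a; simp [e2, h3]
  · intro a ha
    by_cases hae : a = h.ecount ∨ a = h.ecount + 1
    · have : g'.home (.edge a) = .edge h.ecount := by rw [e2]; grind
      rw [this, e1]; simp
    · have : g'.home (.edge a) = g.home (.edge a) := by rw [e2]; grind
      rw [this]
      rw [e1] at ha ⊢
      have := h4 a (by grind)
      grind
  · have h0 : vertexHead ≠ h.vcount := by
      intro hc; rw [hc, hv] at h5; cases h5.1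
    rw [e1, e3, if_neg (by simpa using h0), if_neg h0]
    simpa using h5
  · intro a ha
    rw [e3]
    split_ifs with hav
    · simp [e1, e2, e4]
    · obtain ⟨k1, k2, k3⟩ := h6 a (by rw [e1] at ha; grind)
      have n1 : (h.vnode a).edgeHead ≠ h.ecount := by
        intro hc; rw [hc, hu] at k1; cases k1
      have n2 : (h.vnode a).edgeHead ≠ h.ecount + 1 := by
        intro hc; rw [hc, hu'] at k1; cases k1
      rw [e1, e2, e4]
      simp [n1, n2, k1, k2, k3]

theorem Extends.newV {h : Heap K T} {g : Ghost} (H : HeapInv h g) (k : Key K) (m : Node) :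
    Extends h g (h.newV k) (g.newV h m) := by
  have hu := (H.eAlloc h.ecount).2 le_rfl
  have hu' := (H.eAlloc (h.ecount + 1)).2 (by omega)
  have hv := (H.vAlloc h.vcount).2 le_rfl
  have hne : ∀ n, g.place n ≠ .unalloc → n ≠ .edge h.ecount ∧ n ≠ .edge (h.ecount + 1) ∧
      n ≠ .vertex h.vcount := by grind
  refine ⟨fun n hn => ?_, fun n hn => ?_, fun n hn => ?_, fun a ha => ?_, fun a ha => ?_,
    fun a ha => ?_⟩
  · simpa [Ghost.Pub, Ghost.newV_place, hne n hn.alloc] using hn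
  · simpa [Ghost.newV_place, hne n hn] using hn
  · simp [Ghost.newV_home, hne n hn]
  · have := hne _ ha
    have : a ≠ h.vcount := by simpa using this
    simp [Heap.newV, this]
  · have := hne _ ha
    have : a ≠ h.vcount := by simpa using this
    simp [Heap.newV, this]
  · have := hne _ ha
    have h1 : a ≠ h.ecount := by simpa using this.1
    have h2 : a ≠ h.ecount + 1 := by simpa using this.2.1
    simp [Heap.newV, h1, h2]

variable [DecidableEq T]

/-- The invariant of a thread and the heap after a step. -/
def Preserved (h : Heap K T) (g : Ghost) (A : T → ALoc) (t : T) (h' : Heap K T) (l' : Loc K) :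
    Prop :=
  ∃ g', AInv (view h') g' (Function.update A t l'.abs) ∧ HeapInv h' g' ∧ Extends h g h' g' ∧
    Static h' g' l'

/-- For steps that only read: the thread's claim may change, the rest of its abstraction does not.
-/
theorem Preserved.of_same {h : Heap K T} {g : Ghost} {A : T → ALoc} {t : T} {l l' : Loc K}
    (I : AInv (view h) g A) (H : HeapInv h g) (hA : A t = l.abs)
    (h1 : l'.abs.held = l.abs.held) (h2 : l'.abs.tr = l.abs.tr) (h3 : l'.abs.fr = l.abs.fr)
    (h4 : l'.abs.rm = l.abs.rm) (h5 : l.abs.Claim (view h) g → l'.abs.Claim (view h) g)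
    (hS : Static h g l') : Preserved h g A t h l' :=
  ⟨g, I.step (.reloc _ _ _ _ h1 h2 h3 h4 h5) hA, H,
    Extends.shape g ⟨rfl, rfl, fun _ => rfl, fun _ => rfl, fun _ => rfl⟩, hS⟩

theorem Preserved.of_abs_eq {h : Heap K T} {g : Ghost} {A : T → ALoc} {t : T} {l l' : Loc K}
    (I : AInv (view h) g A) (H : HeapInv h g) (hA : A t = l.abs) (he : l'.abs = l.abs)
    (hS : Static h g l') : Preserved h g A t h l' :=
  .of_same I H hA (by rw [he]) (by rw [he]) (by rw [he]) (by rw [he]) (by rw [he]; exact id) hS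

theorem Preserved.of_shape {h h' : Heap K T} {g : Ghost} {A : T → ALoc} {t : T} {l l' : Loc K}
    (I : AInv (view h) g A) (H : HeapInv h g) (hA : A t = l.abs)
    (hs : AStep t (view h) g l.abs (view h') g l'.abs) (hh : SameShape h h')
    (hS : Static h g l') : Preserved h g A t h' l' :=
  ⟨g, I.step hs hA, H.shape hh, .shape g hh, hS.mono (.shape g hh)⟩

/-- For the two writes that move a node along its life cycle, linking and unlinking. -/
theorem Preserved.of_place {h h' : Heap K T} {g : Ghost} {A : T → ALoc} {t : T} {l l' : Loc K}
    (I : AInv (view h) g A) (H : HeapInv h g) (hA : A t = l.abs) {n : Node} {p : Place}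
    (hs : AStep t (view h) g l.abs (view h') (g.setPlace n p) l'.abs) (hh : SameShape h h')
    (hn : g.place n ≠ .unalloc) (hp : p = .live ∨ (p = .dead ∧ (view h n).val ≠ ⊥))
    (hS : Static h (g.setPlace n p) l') : Preserved h g A t h' l' := by
  have hp' : p = .live ∨ p = .dead := hp.imp id And.left
  refine ⟨_, I.step hs hA, (H.setPlace hn ?_ (hp.imp id And.right)).shape hh,
    (Extends.setPlace h hp').trans (.shape _ hh), hS.mono (.shape _ hh)⟩
  rcases hp' with rfl | rfl <;> simp

end AcyclicGraph

/-! ### Preservation of the invariant by the program -/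

namespace AcyclicGraph

variable {K T : Type*} [LinearOrder K]

theorem AInv.vnext {h : Heap K T} {g : Ghost} {A : T → ALoc} (I : AInv (view h) g A) {v w : ℕ}
    (hv : g.Pub (.vertex v)) (hw : (h.vnode v).vnext = some w) :
    g.Pub (.vertex w) ∧ (h.vnode v).val < (h.vnode w).val := by
  have := I.pubNext (.vertex v) (.vertex w) hv (by simp [view, hw])
  exact ⟨this.1, this.2.1⟩

theorem AInv.enext {h : Heap K T} {g : Ghost} {A : T → ALoc} (I : AInv (view h) g A) {v w : ℕ}
    (hv : g.Pub (.edge v)) (hw : (h.enode v).enext = some w) :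
    g.Pub (.edge w) ∧ (h.enode v).val < (h.enode w).val ∧ g.home (.edge w) = g.home (.edge v) :=
  I.pubNext (.edge v) (.edge w) hv (by simp [view, hw])

theorem AInv.vnext_ne_none {h : Heap K T} {g : Ghost} {A : T → ALoc} (I : AInv (view h) g A)
    {v : ℕ} (hv : g.Pub (.vertex v)) (ht : (h.vnode v).val ≠ ⊤) : (h.vnode v).vnext ≠ none :=
  fun hn => ht (I.pubNil (.vertex v) hv (by simp [view, hn]))

theorem AInv.enext_ne_none {h : Heap K T} {g : Ghost} {A : T → ALoc} (I : AInv (view h) g A)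
    {v : ℕ} (hv : g.Pub (.edge v)) (ht : (h.enode v).val ≠ ⊤) : (h.enode v).enext ≠ none :=
  fun hn => ht (I.pubNil (.edge v) hv (by simp [view, hn]))

theorem AInv.enode_ne_top {h : Heap K T} {g : Ghost} {A : T → ALoc} (I : AInv (view h) g A)
    {v : ℕ} (hv : g.Pub (.edge v)) (hn : (h.enode v).enext ≠ none) : (h.enode v).val ≠ ⊤ := by
  obtain ⟨w, hw⟩ := Option.ne_none_iff_exists'.1 hn
  exact (I.enext hv hw).2.1.ne_top

omit [LinearOrder K] in
theorem key_ne_top (k : K) : key k ≠ ⊤ := by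
  intro h
  have := WithBot.coe_injective (h : ((k : WithTop K) : WithBot (WithTop K)) = ((⊤ : WithTop K) : WithBot (WithTop K)))
  exact WithTop.coe_ne_top this

theorem bot_lt_key (k : K) : (⊥ : Key K) < key k := WithBot.bot_lt_coe _

variable [DecidableEq T]

/-- A step of a thread preserves the invariant of the heap, of the locks and of the thread. -/
theorem NStep.preserved {h h' : Heap K T} {g : Ghost} {A : T → ALoc} {t : T} {l l' : Loc K}
    (I : AInv (view h) g A) (H : HeapInv h g) (hA : A t = l.abs) (hS : Static h g l)
    (hn : NStep t h l h' l') : Preserved h g A t h' l' := by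
  have hp0 : g.Pub (.vertex vertexHead) := .inl H.vHead.1
  have hv0 := H.vHead.2
  have hcl := I.claim t
  rw [hA] at hcl
  cases hn with
  | cvScan_next k v w h1 h2 => exact .of_abs_eq I H hA rfl (I.vnext hS h2).1
  | cvScan_absent => exact .of_abs_eq I H hA rfl trivial
  | cvScan_found => exact .of_abs_eq I H hA rfl trivial
  | cvMark => exact .of_abs_eq I H hA rfl trivial
  | vStart j k v2 h1 =>
    exact .of_abs_eq I H hA rfl ⟨hp0, (I.vnext hp0 h1).1, by rw [hv0]; exact bot_lt_key k⟩
  | vScan_next j k v1 v2 w h1 h2 => exact .of_abs_eq I H hA rfl ⟨hS.2.1, (I.vnext hS.2.1 h2).1, h1⟩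
  | vScan_stop j k v1 v2 h1 => exact .of_abs_eq I H hA rfl ⟨hS.1, hS.2.1, hS.2.2, h1⟩
  | vAcq1 j k v1 v2 h1 =>
    refine .of_shape I H hA ?_ (.modV _ _ _ fun n => ⟨rfl, rfl⟩) hS
    rw [view_setVLock]
    exact .acq1 _ _ _ _ h1 hS.1
  | vAcq2 j k v1 v2 h1 =>
    refine .of_shape I H hA ?_ (.modV _ _ _ fun n => ⟨rfl, rfl⟩) hS
    rw [view_setVLock]
    exact .acq2 _ _ _ _ _ h1 hS.2.1
  | vVal1_fail => exact .of_abs_eq I H hA rfl hS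
  | vVal1_pass j k v1 v2 h1 =>
    refine .of_same I H hA rfl rfl rfl rfl (fun _ => ?_) hS
    simp [Loc.abs, ALoc.Claim, Passes, view, h1]
  | vVal2_fail => exact .of_same I H hA rfl rfl rfl rfl (fun _ => trivial) hS
  | vVal2_pass j k v1 v2 h1 =>
    refine .of_same I H hA rfl rfl rfl rfl (fun hc => ⟨hc, ?_⟩) hS
    simp [Passes, view, h1]
  | vVal3_fail => exact .of_same I H hA rfl rfl rfl rfl (fun _ => trivial) hS
  | vVal3_pass j k v1 v2 h1 =>
    refine .of_same I H hA rfl rfl rfl rfl (fun hc => ⟨hc.1, hc.2, ?_⟩) hS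
    simp [view, h1]
  | vRetry1 j k v1 v2 =>
    refine .of_shape I H hA ?_ (.modV _ _ _ fun n => ⟨rfl, rfl⟩) trivial
    rw [view_setVLock]
    refine .rel1 _ _ _ _ _ ?_
    have := hS.2.2.1.trans_le hS.2.2.2
    rintro ⟨⟩; exact this.false
  | vRetry2 j k v2 =>
    refine .of_shape I H hA ?_ (.modV _ _ _ fun n => ⟨rfl, rfl⟩) trivial
    rw [view_setVLock]
    exact .rel2 _ _ _ _
  | vBody_new k v1 v2 h1 =>
    have hv := (H.vAlloc h.vcount).2 le_rfl
    have hu := (H.eAlloc h.ecount).2 le_rfl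
    have hu' := (H.eAlloc (h.ecount + 1)).2 (by omega)
    -- Creating a vertex node amounts to creating its edge list and then the node. No live node has
    -- the new head as home: the home of a vertex node is a vertex node, and that of an edge node is
    -- already allocated.
    have J := I.newList (.edge h.ecount) (.edge (h.ecount + 1)) (by simp) hu hu' (by
      rintro (k | k) hk hc
      · rw [H.vHome] at hc; cases hc
      · exact H.eHome k (by simp [hk]) (hc ▸ hu))
    have hh : (g.newList (.edge h.ecount) (.edge (h.ecount + 1))).home (.vertex v1) =
        .vertex 0 := by
      simp [Ghost.newList, Ghost.setHome, Ghost.setPlace, H.vHome]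
    have J2 := J.step (.alloc (t := t) _ _ true (.vertex v1) (.vertex v2) (.vertex h.vcount) none
      ⟨key k, none, .added, none⟩ (by simp [Ghost.setHome, Ghost.setPlace, hv]) rfl rfl
      (.inr ⟨rfl, rfl⟩)) hA
    rw [← view_newV] at J2
    have E := Extends.newV H (key k) (.vertex 0)
    refine ⟨_, J2, ?_, ?_, ?_⟩
    · have := H.newV (key k)
      rw [Ghost.newV, ← hh] at this
      exact this
    · rw [Ghost.newV, ← hh] at E
      exact E
    · have n1 : v1 ≠ h.vcount := by rintro rfl; exact hS.1.alloc hv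
      have n2 : v2 ≠ h.vcount := by rintro rfl; exact hS.2.1.alloc hv
      have p1 := E.pub _ hS.1
      have p2 := E.pub _ hS.2.1
      rw [Ghost.newV, ← hh] at p1 p2
      refine ⟨p1, p2, ?_, ?_, ?_⟩
      · simp [Ghost.setHome, Ghost.setPlace]
      · simpa [Heap.newV, n1] using hS.2.2.1
      · simpa [Heap.newV, n2] using lt_of_le_of_ne hS.2.2.2 (Ne.symm h1)
  | vBody_present k v1 v2 h1 =>
    refine .of_same I H hA rfl rfl rfl rfl (fun _ => trivial) ?_
    have := hS.2.2.1.trans_le hS.2.2.2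
    rintro rfl; exact this.false
  | vLink3 v1 v2 v3 =>
    refine .of_shape I H hA ?_ (.modV _ _ _ fun n => ⟨rfl, rfl⟩) hS
    rw [view_setVNext]
    exact .setNext _ _ _ _ _ _
  | vLink1 v1 v2 v3 =>
    refine .of_place (n := .vertex v3) (p := .live) I H hA ?_ (.modV _ _ _ fun n => ⟨rfl, rfl⟩)
      hS.2.2.1 (.inl rfl) ?_
    · rw [view_setVNext]
      exact .link _ _ _ _ _ _ hS.2.2.2.1 hS.2.2.2.2 (by rw [H.vHome, H.vHome])
    · have := hS.2.2.2.1.trans hS.2.2.2.2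
      rintro rfl; exact this.false
  | vBody_mark k v1 v2 h1 =>
    refine .of_shape I H hA ?_ (.modV _ _ _ fun n => ⟨rfl, rfl⟩) ⟨hS.1, hS.2.1,
      hS.2.2.1.trans_le hS.2.2.2, by rw [h1]; exact key_ne_top k⟩
    rw [view_setMarked]
    exact .mark _ _ _ _
  | vBody_absent k v1 v2 h1 =>
    refine .of_same I H hA rfl rfl rfl rfl (fun _ => trivial) ?_
    have := hS.2.2.1.trans_le hS.2.2.2
    rintro rfl; exact this.false
  | vReadNext v1 v2 =>
    refine .of_same I H hA rfl rfl rfl rfl (fun hc => ?_) ⟨hS.1, hS.2.1, hS.2.2.1, hS.2.2.2,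
      I.vnext_ne_none hS.2.1 hS.2.2.2⟩
    exact ⟨hc.1, hc.2.1, hc.2.2.1, hc.2.2.2.1, rfl⟩
  | vUnlink v1 v2 x =>
    refine .of_place (n := .vertex v2) (p := .dead) I H hA ?_ (.modV _ _ _ fun n => ⟨rfl, rfl⟩)
      hS.2.1.alloc (.inr ⟨rfl, hS.2.2.1.ne_bot⟩) ?_
    · rw [view_setVNext]
      exact .unlink _ _ _ _ _ hS.2.2.2.1
    · have := hS.2.2.1
      rintro rfl; exact this.false
  | vRel1 j r v1 v2 =>
    refine .of_shape I H hA ?_ (.modV _ _ _ fun n => ⟨rfl, rfl⟩) trivial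
    rw [view_setVLock]
    exact .rel1 _ _ _ _ _ (by simpa [Static] using hS)
  | vRel2 j r v2 =>
    refine .of_shape I H hA ?_ (.modV _ _ _ fun n => ⟨rfl, rfl⟩) trivial
    rw [view_setVLock]
    exact .rel2 _ _ _ _
  | hsScan1_next o k1 k2 v w h1 h2 => exact .of_abs_eq I H hA rfl (I.vnext hS h2).1
  | hsScan1_absent => exact .of_abs_eq I H hA rfl trivial
  | hsScan1_found o k1 k2 v h1 =>
    exact .of_abs_eq I H hA rfl ⟨hS, by rw [h1]; exact key_ne_top _⟩
  | hsMark1_fail => exact .of_abs_eq I H hA rfl trivial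
  | hsMark1_pass => exact .of_abs_eq I H hA rfl hS
  | hsNext o k1 k2 v w h1 => exact .of_abs_eq I H hA rfl ⟨hS.1, (I.vnext hS.1 h1).1⟩
  | hsScan2_next o k1 k2 v w x h1 h2 =>
    exact .of_abs_eq I H hA rfl ⟨hS.1, (I.vnext hS.2 h2).1⟩
  | hsScan2_absent => exact .of_abs_eq I H hA rfl trivial
  | hsScan2_found => exact .of_abs_eq I H hA rfl hS
  | hsMark2_fail => exact .of_abs_eq I H hA rfl trivial
  | hsMark2_lt o k1 k2 v w =>
    cases o
    · exact .of_abs_eq I H hA rfl ⟨hS.1, by simp⟩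
    · exact .of_abs_eq I H hA rfl ⟨hS.1, by simp⟩
    · exact .of_abs_eq I H hA rfl (.inl (H.eHead v hS.1.alloc).1)
  | hsMark2_ge o k1 k2 v w =>
    cases o
    · exact .of_abs_eq I H hA rfl ⟨hS.2, by simp⟩
    · exact .of_abs_eq I H hA rfl ⟨hS.2, by simp⟩
    · exact .of_abs_eq I H hA rfl (.inl (H.eHead w hS.2.alloc).1)
  | ceScan_next k2 e f h1 h2 => exact .of_abs_eq I H hA rfl (I.enext hS h2).1
  | ceScan_absent => exact .of_abs_eq I H hA rfl trivial
  | ceScan_found => exact .of_abs_eq I H hA rfl trivial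
  | ceStatus => exact .of_abs_eq I H hA rfl trivial
  | eMark1_fail => exact .of_abs_eq I H hA rfl trivial
  | eMark1_pass => exact .of_abs_eq I H hA rfl hS
  | eMark2_fail => exact .of_abs_eq I H hA rfl trivial
  | eMark2_pass j k1 k2 v1 v2 =>
    cases j with
    | undo e3 => exact absurd rfl (hS.2 e3)
    | add => exact .of_abs_eq I H hA rfl ⟨hS.1, trivial⟩
    | remove => exact .of_abs_eq I H hA rfl ⟨hS.1, trivial⟩
  | eStart j k1 k2 v1 e2 h1 =>
    obtain ⟨q1, q2, q3⟩ := H.eHead v1 hS.1.alloc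
    have hn := I.enext (.inl q1) h1
    exact .of_abs_eq I H hA rfl ⟨hS.2, hS.1, .inl q1, hn.1, q3, hn.2.2.trans q3,
      by rw [q2]; exact bot_lt_key k2⟩
  | eScan_next j k1 k2 v1 e1 e2 f h1 h2 =>
    obtain ⟨s1, s2, s3, s4, s5, s6, s7⟩ := hS
    have hn := I.enext s4 h2
    exact .of_abs_eq I H hA rfl ⟨s1, s2, s4, hn.1, s6, hn.2.2.trans s6, h1⟩
  | eScan_stop j k1 k2 v1 e1 e2 h1 =>
    obtain ⟨s1, s2, s3, s4, s5, s6, s7⟩ := hS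
    exact .of_abs_eq I H hA rfl ⟨s1, s2, s3, s4, s5, s6, s7, h1⟩
  | eAcq1 j k1 k2 v1 e1 e2 h1 =>
    refine .of_shape I H hA ?_ (.modE _ _ _ fun n => rfl) hS
    rw [view_setELock]
    exact .acq1 _ _ _ _ h1 hS.2.2.1
  | eAcq2 j k1 k2 v1 e1 e2 h1 =>
    refine .of_shape I H hA ?_ (.modE _ _ _ fun n => rfl) hS
    rw [view_setELock]
    exact .acq2 _ _ _ _ _ h1 hS.2.2.2.1
  | eVal1_pass j k1 k2 v1 e1 e2 h1 =>
    exact .of_same I H hA rfl rfl rfl rfl (fun _ => (j.ok_iff _).1 h1) hS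
  | eVal1_fail => exact .of_abs_eq I H hA rfl hS
  | eVal2_pass j k1 k2 v1 e1 e2 h1 =>
    exact .of_same I H hA rfl rfl rfl rfl (fun hc => ⟨hc, (j.ok_iff _).1 h1⟩) hS
  | eVal2_fail => exact .of_same I H hA rfl rfl rfl rfl (fun _ => trivial) hS
  | eVal3_pass j k1 k2 v1 e1 e2 h1 =>
    exact .of_same I H hA rfl rfl rfl rfl (fun hc => ⟨hc.1, hc.2, by simp [view, h1]⟩) hS
  | eVal3_fail => exact .of_same I H hA rfl rfl rfl rfl (fun _ => trivial) hS
  | eRetry1 j k1 k2 v1 e1 e2 =>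
    obtain ⟨s1, s2, s3, s4, s5, s6, s7, s8⟩ := hS
    refine .of_shape I H hA ?_ (.modE _ _ _ fun n => rfl) ⟨s2, s1⟩
    rw [view_setELock]
    refine .rel1 _ _ _ _ _ ?_
    have := s7.trans_le s8
    rintro ⟨⟩; exact this.false
  | eRetry2 j k1 k2 v1 e2 =>
    refine .of_shape I H hA ?_ (.modE _ _ _ fun n => rfl) hS
    rw [view_setELock]
    exact .rel2 _ _ _ _
  | eBody_new k1 k2 v1 e1 e2 h1 =>
    have hu := (H.eAlloc h.ecount).2 le_rfl
    have J := I.step (.alloc (t := t) _ _ false (.edge e1) (.edge e2) (.edge h.ecount)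
      (some (.edge h.ecount)) ⟨key k2, none, .transit, none⟩ hu rfl rfl (.inl ⟨rfl, rfl⟩)) hA
    rw [← view_newE] at J
    have E := Extends.newE H (key k2) (g.home (.edge e1))
    have P : EPos (h.newE (key k2)) _ k2 v1 e1 e2 :=
      (Static.mono (l := .eAcq1 .add k1 k2 v1 e1 e2) E hS).2
    have n2 : e2 ≠ h.ecount := by rintro rfl; exact hS.2.2.2.1.alloc hu
    refine ⟨_, J, H.newE _ hS.2.2.1.alloc, E, P, ?_, ?_, ?_, ?_⟩
    · simp [Ghost.setHome, Ghost.setPlace]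
    · simpa [Ghost.setHome, Ghost.setPlace, Heap.newE] using hS.2.2.2.2.1
    · simp [Heap.newE]
    · have := lt_of_le_of_ne hS.2.2.2.2.2.2.2 (Ne.symm h1)
      simpa [Heap.newE, n2] using this
  | eBody_present k1 k2 v1 e1 e2 h1 =>
    refine .of_same I H hA rfl rfl rfl rfl (fun _ => trivial) ⟨?_, trivial⟩
    have := hS.2.2.2.2.2.2.1.trans_le hS.2.2.2.2.2.2.2
    rintro rfl; exact this.false
  | eLink3 k1 k2 v1 e1 e2 e3 =>
    refine .of_shape I H hA ?_ (.modE _ _ _ fun n => rfl) hS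
    rw [view_setENext]
    exact .setNext _ _ _ _ _ _
  | eLink1 k1 k2 v1 e1 e2 e3 =>
    obtain ⟨⟨s1, s2, s3, s4, s5, s6, s7⟩, s8, s9, s10, s11⟩ := hS
    have hlt : (h.enode e1).val < (h.enode e3).val := by rw [s10]; exact s6
    refine .of_place (n := .edge e3) (p := .live) I H hA ?_ (.modE _ _ _ fun n => rfl)
      s8 (.inl rfl) ⟨?_, ?_, ?_, s10, s9⟩
    · rw [view_setENext]
      exact .link _ _ _ _ _ _ hlt s11 (s9.trans s4.symm)
    · have := hlt.trans s11
      rintro rfl; exact this.false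
    · exact (Extends.setPlace h (.inl rfl)).pub _ s1
    · exact .inl (by simp [Ghost.setPlace])
  | eBody_mark k1 k2 v1 e1 e2 h1 =>
    obtain ⟨-, s1, s2, s3, s4, s5, s6, s7⟩ := hS
    refine .of_shape I H hA ?_ (.modE _ _ _ fun n => rfl) ⟨s2, s3, s3, s6.trans_le s7,
      by rw [h1]; exact key_ne_top k2⟩
    rw [view_setStatus]
    exact .mark _ _ _ _
  | eBody_absent k1 k2 v1 e1 e2 h1 =>
    refine .of_same I H hA rfl rfl rfl rfl (fun _ => trivial) ⟨?_, trivial⟩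
    have := hS.2.2.2.2.2.2.1.trans_le hS.2.2.2.2.2.2.2
    rintro rfl; exact this.false
  | eBody_undo k1 k2 v1 e1 e2 e3 =>
    -- `TransitAt` remembers the list and the key `k2` of the transit node, and the located `e1` and
    -- `e2` enclose `k2`: just what `markOwn` asks for.
    obtain ⟨⟨q1, q2, q3, q4⟩, s1, s2, s3, s4, s5, s6, s7⟩ := hS
    refine .of_shape I H hA ?_ (.modE _ _ _ fun n => rfl) ⟨s2, s3, q2, s6.trans_le s7,
      by rw [q3]; exact key_ne_top k2⟩
    rw [view_setStatus]
    exact .markOwn _ _ _ _ _ _ q2 (q4.trans s4.symm) (s6.trans_eq q3.symm) (q3.trans_le s7)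
  | eReadNext j e1 e2 d =>
    refine .of_same I H hA rfl rfl rfl rfl (fun hc => ?_) ⟨hS.1, hS.2.1, hS.2.2.2.1,
      I.enext_ne_none hS.2.2.1 hS.2.2.2.2⟩
    refine ⟨hc.1, hc.2.1, hc.2.2.1, hc.2.2.2.1, ?_⟩
    have : d = e2 := by simpa using hc.2.2.2.2
    rw [this]; rfl
  | eUnlink j b e1 e2 x =>
    obtain ⟨s1, s2, s3, s4⟩ := hS
    refine .of_place (n := .edge e2) (p := .dead) I H hA ?_ (.modE _ _ _ fun n => rfl)
      s2.alloc (.inr ⟨rfl, s3.ne_bot⟩) ⟨?_, trivial⟩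
    · rw [view_setENext]
      -- The pointer read from `e2` is not null, so `e2` has a successor with a larger key and is
      -- not the tail.
      refine .unlink _ _ _ _ _ fun ht => ?_
      obtain ⟨f, rfl⟩ := Option.ne_none_iff_exists'.1 s4
      have := (I.pubNext (.edge e2) (.edge f) s2 (by simpa using hcl.2.2.2.2)).2.1
      rw [ht] at this
      exact not_top_lt this
    · rintro rfl; exact s3.false
  | eRel1 j a e1 e2 =>
    refine .of_shape I H hA ?_ (.modE _ _ _ fun n => rfl) hS.2
    rw [view_setELock]
    exact .rel1 _ _ _ _ _ (by simpa using hS.1)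
  | eRel2 j a e2 =>
    cases a with
    | ret b =>
      refine .of_shape I H hA ?_ (.modE _ _ _ fun n => rfl) trivial
      rw [view_setELock]
      exact .rel2 _ _ _ _
    | detect k1 k2 v1 e3 =>
      refine .of_shape I H hA ?_ (.modE _ _ _ fun n => rfl) ⟨hS, hp0⟩
      rw [view_setELock]
      exact .rel2 _ _ _ _
  | eCommit e3 =>
    refine .of_shape I H hA ?_ (.modE _ _ _ fun n => rfl) trivial
    rw [view_setStatus]
    exact .commit _ _ _
  | pScan_next p v w h1 h2 => exact .of_abs_eq I H hA rfl ⟨hS.1, (I.vnext hS.2 h2).1⟩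
  | pScan_found => exact .of_abs_eq I H hA rfl hS
  | pScan_absent => exact .of_abs_eq I H hA rfl hS.1
  | pMark_pass p v => exact .of_abs_eq I H hA rfl ⟨hS.1, .inl (H.eHead v hS.2.alloc).1⟩
  | pMark_absent => exact .of_abs_eq I H hA rfl hS.1
  | pTest_stop => exact .of_abs_eq I H hA rfl hS.1
  | pTest_go p e h1 => exact .of_abs_eq I H hA rfl ⟨hS.1, hS.2, I.enode_ne_top hS.2 h1⟩
  | pStatus_add => exact .of_abs_eq I H hA rfl hS
  | pStatus_skip => exact .of_abs_eq I H hA rfl hS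
  | pNext p e f h1 => exact .of_abs_eq I H hA rfl ⟨hS.1, (I.enext hS.2.1 h1).1⟩
  | pCheck_not => exact .of_abs_eq I H hA rfl hS
  | pPick_go => exact .of_abs_eq I H hA rfl ⟨hS, hp0⟩
  | pScan_fail p =>
    rcases p with ⟨_ | ⟨k1, k2, v1, e3⟩, _, _, _, _, _⟩
    · exact .of_abs_eq I H hA rfl trivial
    · exact .of_abs_eq I H hA rfl trivial
  | pMark_fail p =>
    rcases p with ⟨_ | ⟨k1, k2, v1, e3⟩, _, _, _, _, _⟩
    · exact .of_abs_eq I H hA rfl trivial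
    · exact .of_abs_eq I H hA rfl trivial
  | pPick_done p =>
    rcases p with ⟨_ | ⟨k1, k2, v1, e3⟩, _, _, _, _, _⟩
    · exact .of_abs_eq I H hA rfl trivial
    · exact .of_abs_eq I H hA rfl trivial
  | pCheck_found p =>
    rcases p with ⟨_ | ⟨k1, k2, v1, e3⟩, _, _, _, _, _⟩
    · exact .of_abs_eq I H hA rfl trivial
    · exact .of_abs_eq I H hA rfl ⟨hS.1, hS⟩

/-- The invariant of the executions. -/
def Inv (s : State K T) : Prop :=
  ∃ g, AInv (view s.heap) g (fun t => (s.loc t).abs) ∧ HeapInv s.heap g ∧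
    ∀ t, Static s.heap g (s.loc t)

theorem Inv.step {s s' : State K T} {t : T} (I : Inv s) (ha : Act t s s') : Inv s' := by
  obtain ⟨g, I, H, S⟩ := I
  cases ha with
  | invoke r l hr hl =>
    have hp0 : g.Pub (.vertex vertexHead) := .inl H.vHead.1
    -- A call begins with no locks and no transit node, which to the abstract invariant is the same
    -- as being idle.
    have habs : l.abs = (s.loc t).abs := by rw [hr]; cases hl <;> rfl
    refine ⟨g, ?_, H, ?_⟩
    · convert I using 2 with u
      by_cases hu : u = t
      · subst hu; simp [habs]
      · simp [hu]
    · intro u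
      by_cases hu : u = t
      · subst hu
        simp only [Function.update_self]
        cases hl <;> trivial
      · simpa [hu] using S u
  | step h l hn =>
    obtain ⟨g', I', H', E, S'⟩ := (nstep_of_mem_next hn).preserved I H rfl (S t)
    refine ⟨g', ?_, H', ?_⟩
    · convert I' using 2 with u
      by_cases hu : u = t
      · subst hu; simp
      · simp [hu]
    · intro u
      by_cases hu : u = t
      · subst hu; simpa using S'
      · simpa [hu] using (S u).mono E

omit [LinearOrder K] [DecidableEq T] in
theorem view_initial (n : Node) : view (Heap.initial : Heap K T) n = match n with
    | .vertex a => if a = 0 then ⟨⊥, some (.vertex 1), .added, none⟩ else ⟨⊤, none, .added, none⟩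
    | .edge a => if a = 0 then ⟨⊥, some (.edge 1), .added, none⟩ else
        if a = 2 then ⟨⊥, some (.edge 3), .added, none⟩ else ⟨⊤, none, .added, none⟩ := by
  rcases n with a | a
  · rcases a with _ | _ | a <;>
      simp [view, Heap.initial, Heap.newV, Heap.empty, Heap.setVNext, Heap.modV]
  · rcases a with _ | _ | _ | _ | a <;>
      simp [view, Heap.initial, Heap.newV, Heap.empty, Heap.setVNext, Heap.modV,
        Function.update_apply]

theorem Inv.initial : Inv (State.initial K T) := by
  have bt : (⊥ : Key K) < ⊤ := by simp
  -- Vertex nodes `0` and `1` are the sentinels. Edge nodes `0, 1` and `2, 3` form their edge lists,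
  -- with heads `0` and `2`.
  refine ⟨⟨fun n => match n with
      | .vertex a => if a < 2 then .live else .unalloc
      | .edge a => if a < 4 then .live else .unalloc,
    fun n => match n with
      | .vertex _ => .vertex 0
      | .edge a => .edge (if a < 2 then 0 else 2)⟩, ?_, ?_, fun _ => trivial⟩
  · refine ⟨?_, ?_, ?_, ?_, ?_, ?_, ?_, ?_, ?_, ?_, ?_, ?_, ?_⟩ <;>
      simp only [State.initial, view_initial, Loc.abs, ALoc.held, ALoc.tr, ALoc.fr, ALoc.rm,
        ALoc.Claim, Ghost.Pub]
    · grind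
    · grind
    · grind
    · grind
    · grind
    · grind
    · grind
    · rintro (a | a) (b | b) <;> grind
    · grind
    · rintro (a | a) (b | b) <;> grind
    · rintro (a | a) (b | b) <;> grind
    · grind
    · grind
  · refine ⟨?_, ?_, ?_, ?_, ?_, ?_⟩
    · intro a
      simp [State.initial, Heap.initial, Heap.newV, Heap.empty, Heap.setVNext, Heap.modV]
      try omega
    · intro a
      simp [State.initial, Heap.initial, Heap.newV, Heap.empty, Heap.setVNext, Heap.modV]
      try omega
    · intro a; rfl
    · intro a; grind
    · simp [State.initial, Heap.initial, Heap.newV, Heap.empty, Heap.setVNext, Heap.modV,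
        vertexHead]
    · intro a ha
      rcases a with _ | _ | a
      · simp [State.initial, Heap.initial, Heap.newV, Heap.empty, Heap.setVNext, Heap.modV,
          Function.update_apply]
      · simp [State.initial, Heap.initial, Heap.newV, Heap.empty, Heap.setVNext, Heap.modV,
          Function.update_apply]
      · grind

theorem Execution.inv (σ : Execution K T) (n : ℕ) : Inv (σ.state n) := by
  induction n with
  | zero => rw [σ.start]; exact Inv.initial
  | succ n ih =>
    rcases ha : σ.actor n with _ | t
    · rw [σ.idle_step n ha]; exact ih
    · exact ih.step (σ.act_step n t ha)

end AcyclicGraph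

/-! ### Ranks bounding the remaining steps, and absence of null dereferences -/

namespace AcyclicGraph

variable {K T : Type*} [LinearOrder K]

section Rank

variable [Fintype K]

/-- The number of larger keys. -/
def height (x : Key K) : ℕ := (Finset.univ.filter fun y => x < y).card

theorem height_lt {x y : Key K} (h : x < y) : height y < height x := by
  refine Finset.card_lt_card (Finset.ssubset_iff_of_subset ?_ |>.2 ⟨y, by simpa using h, by simp⟩)
  intro z hz
  simp only [Finset.mem_filter, Finset.mem_univ, true_and] at hz ⊢
  exact h.trans hz

theorem height_lt_card (x : Key K) : height x < Fintype.card (Key K) :=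
  Finset.card_lt_univ_of_notMem (x := x) (by simp)

/-- The steps that one exploration of `PathExists` may take. -/
def exploreBound (K : Type*) [Fintype K] : ℕ := 4 * Fintype.card (Key K) + 6

/-- The steps that `PathExists` may take, and some more. -/
def pathBound (K : Type*) [Fintype K] : ℕ := 8 + exploreBound K * Fintype.card (Key K)

/-- A bound on the rank during the exploration of a key. -/
def PVars.rank (p : PVars K) : ℕ := 7 + exploreBound K * ((insert p.cur p.X)ᶜ).card

open Loc in
/-- A bound on the number of steps that remain, in the absence of failed validations. -/
def rank (h : Heap K T) : Loc K → ℕ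
  | idle _ => 0
  | cvScan _ v => 2 + height (h.vnode v).val
  | cvMark _ => 1
  -- The value is constant on the loop, which failed validations may repeat without limit.
  | vStart _ _ | vScan _ _ _ _ | vAcq1 _ _ _ _ | vAcq2 _ _ _ _ | vVal1 _ _ _ _ | vVal2 _ _ _ _
  | vVal3 _ _ _ _ | vRetry1 _ _ _ _ | vRetry2 _ _ _ => 6
  | vBody _ _ _ _ => 5
  | vLink3 _ _ _ | vReadNext _ _ => 4
  | vLink1 _ _ _ | vUnlink _ _ _ => 3
  | vRel1 _ _ _ _ => 2
  | vRel2 _ _ _ => 1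
  | hsScan1 _ _ _ v => pathBound K + 2 * Fintype.card (Key K) + 13 + height (h.vnode v).val
  | hsMark1 _ _ _ _ => pathBound K + 2 * Fintype.card (Key K) + 12
  | hsNext _ _ _ _ => pathBound K + 2 * Fintype.card (Key K) + 11
  | hsScan2 _ _ _ _ w => pathBound K + Fintype.card (Key K) + 10 + height (h.vnode w).val
  | hsMark2 _ _ _ _ _ => pathBound K + Fintype.card (Key K) + 9
  | ceScan _ e => 2 + height (h.enode e).val
  | ceStatus _ => 1
  | eMark1 _ _ _ _ _ => pathBound K + 8
  | eMark2 _ _ _ _ _ => pathBound K + 7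
  -- Before the insertion in `AcyclicAddEdge` the cycle detection is still to come, in the
  -- withdrawal it is over. `AcyclicRemoveEdge` shares the larger value.
  | eStart j _ _ _ | eScan j _ _ _ _ _ | eAcq1 j _ _ _ _ _ | eAcq2 j _ _ _ _ _
  | eVal1 j _ _ _ _ _ | eVal2 j _ _ _ _ _ | eVal3 j _ _ _ _ _ | eRetry1 j _ _ _ _ _
  | eRetry2 j _ _ _ _ => (match j with | .undo _ => 0 | _ => pathBound K) + 6
  | eBody j _ _ _ _ _ => (match j with | .undo _ => 0 | _ => pathBound K) + 5
  | eLink3 _ _ _ _ _ _ => pathBound K + 4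
  | eLink1 _ _ _ _ _ _ => pathBound K + 3
  | eReadNext _ _ _ _ => 4
  | eUnlink _ _ _ _ => 3
  | eRel1 _ a _ _ => (match a with | .ret _ => 0 | _ => pathBound K) + 2
  | eRel2 _ a _ => (match a with | .ret _ => 0 | _ => pathBound K) + 1
  | eCommit _ => 1
  -- The value `p.rank` is that of `pPick` after `p.cur` has joined `X`. On top of it come the
  -- vertex traversal and three steps for each edge node. The summand `7` in it exceeds the `6` of
  -- the withdrawal loop that a detected cycle leads to.
  | pScan p v => p.rank + 3 * Fintype.card (Key K) + 5 + height (h.vnode v).val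
  | pMark p _ => p.rank + 3 * Fintype.card (Key K) + 4
  | pTest p e => p.rank + 3 * height (h.enode e).val + 4
  | pStatus p e => p.rank + 3 * height (h.enode e).val + 3
  | pNext p e => p.rank + 3 * height (h.enode e).val + 2
  | pCheck p => p.rank + 1
  | pPick p => 7 + exploreBound K * (p.Xᶜ).card

/-- A bound on all ranks. -/
def rankBound (K : Type*) [Fintype K] : ℕ := pathBound K + 3 * Fintype.card (Key K) + 14

/-- The heap enters the rank only through keys of published nodes, which never change; so other
threads cannot raise it. -/
theorem rank_mono {h h' : Heap K T} {g g' : Ghost} (H : Extends h g h' g') {l : Loc K}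
    (hs : Static h g l) : rank h' l = rank h l := by
  cases l <;> simp only [rank] <;> simp only [Static] at hs
  · rw [H.vval _ hs.alloc]
  · rw [H.vval _ hs.alloc]
  · rw [H.vval _ hs.2.alloc]
  · rw [H.eval _ hs.alloc]
  · rw [H.vval _ hs.2.alloc]
  · rw [H.eval _ hs.2.alloc]
  · rw [H.eval _ hs.2.1.alloc]
  · rw [H.eval _ hs.2.1.alloc]

/-- The key under exploration is not among those left to explore, which leaves one `exploreBound` to
spare. -/
theorem PVars.rank_lt (p : PVars K) : p.rank + exploreBound K < pathBound K := by
  have h : ((insert p.cur p.X)ᶜ).card + 1 ≤ Fintype.card (Key K) := by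
    have := Finset.card_lt_univ_of_notMem (s := (insert p.cur p.X)ᶜ) (x := p.cur) (by simp)
    omega
  have := Nat.mul_le_mul_left (exploreBound K) h
  rw [PVars.rank, pathBound]
  rw [Nat.mul_add] at this
  omega

/-- Picking an unexplored key releases one `exploreBound`, which pays for its exploration. Only `X`
is counted, so the growth of `R` costs nothing. -/
theorem PVars.rank_pick (p : PVars K) {x : Key K} (hx : x ∉ p.X) (b : Bool) :
    PVars.rank { p with cur := x, first := b } + exploreBound K ≤
      7 + exploreBound K * (p.Xᶜ).card := by
  have h : ((insert x p.X)ᶜ).card + 1 ≤ (p.Xᶜ).card := by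
    refine Finset.card_lt_card (Finset.ssubset_iff_of_subset ?_ |>.2 ⟨x, by simpa using hx, by simp⟩)
    exact Finset.compl_subset_compl.2 (Finset.subset_insert _ _)
  have := Nat.mul_le_mul_left (exploreBound K) h
  rw [PVars.rank]
  rw [Nat.mul_add] at this
  simp only
  omega

theorem rank_le (h : Heap K T) (l : Loc K) : rank h l < rankBound K := by
  have h1 := fun x => height_lt_card (K := K) x
  have h2 := fun p => PVars.rank_lt (K := K) p
  have hp : 8 ≤ pathBound K := by simp [pathBound]
  cases l with
  | cvScan k v => have := h1 (h.vnode v).val; simp only [rank, rankBound]; omega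
  | hsScan1 o k1 k2 v => have := h1 (h.vnode v).val; simp only [rank, rankBound]; omega
  | hsScan2 o k1 k2 v w => have := h1 (h.vnode w).val; simp only [rank, rankBound]; omega
  | ceScan k e => have := h1 (h.enode e).val; simp only [rank, rankBound]; omega
  | pScan p v =>
    have := h1 (h.vnode v).val; have := h2 p; simp only [rank, rankBound, exploreBound] at *; omega
  | pMark p v => have := h2 p; simp only [rank, rankBound, exploreBound] at *; omega
  | pTest p e =>
    have := h1 (h.enode e).val; have := h2 p; simp only [rank, rankBound, exploreBound] at *; omega
  | pStatus p e =>
    have := h1 (h.enode e).val; have := h2 p; simp only [rank, rankBound, exploreBound] at *; omega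
  | pNext p e =>
    have := h1 (h.enode e).val; have := h2 p; simp only [rank, rankBound, exploreBound] at *; omega
  | pCheck p => have := h2 p; simp only [rank, rankBound, exploreBound] at *; omega
  | pPick p =>
    have : (p.Xᶜ).card ≤ Fintype.card (Key K) := Finset.card_le_univ _
    have := Nat.mul_le_mul_left (exploreBound K) this
    simp only [rank, rankBound, pathBound] at *; omega
  | _ => simp only [rank, rankBound]; first | omega | (split <;> omega)

end Rank

namespace Loc

/-- The thread is locating, locking and validating a position in a list. -/
def Loop : Loc K → Prop
  | vStart _ _ | vScan _ _ _ _ | vAcq1 _ _ _ _ | vAcq2 _ _ _ _ | vVal1 _ _ _ _ | vVal2 _ _ _ _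
  | vVal3 _ _ _ _ | vRetry1 _ _ _ _ | vRetry2 _ _ _ => True
  | eStart _ _ _ _ | eScan _ _ _ _ _ _ | eAcq1 _ _ _ _ _ _ | eAcq2 _ _ _ _ _ _
  | eVal1 _ _ _ _ _ _ | eVal2 _ _ _ _ _ _ | eVal3 _ _ _ _ _ _ | eRetry1 _ _ _ _ _ _
  | eRetry2 _ _ _ _ _ => True
  | _ => False

/-- A call of an update method is pending. -/
def Upd (l : Loc K) : Prop := ∃ μ, l.method = some μ ∧ μ.IsUpdate

end Loc

/-- What a step of a thread does to its rank. -/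
theorem NStep.rank [Fintype K] {h h' : Heap K T} {g : Ghost} {A : T → ALoc} {t : T} {l l' : Loc K}
    (I : AInv (view h) g A) (hS : Static h g l) (hn : NStep t h l h' l') :
    (∃ b, l' = .idle (some b)) ∨
      ((∀ μ : Method, μ.IsReadOnly → l.method = some μ → l'.method = some μ) ∧ (l.Upd → l'.Upd) ∧
        ((l.Loop ∧ l'.Loop ∧ AcyclicGraph.rank h' l' = AcyclicGraph.rank h l) ∨
          AcyclicGraph.rank h' l' < AcyclicGraph.rank h l)) := by
  have hN := fun x => height_lt_card (K := K) x
  have hr := fun p => PVars.rank_lt (K := K) p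
  have hp : 8 ≤ pathBound K := by simp [pathBound]
  have aux : ∀ p : PVars K, 7 ≤ p.rank := fun p => by simp [PVars.rank]
  cases hn with
  | cvScan_next k v w h1 h2 =>
    have := height_lt (I.vnext hS h2).2
    exact .inr ⟨fun _ _ h => h, id, .inr (by simp only [AcyclicGraph.rank]; omega)⟩
  | hsScan1_next o k1 k2 v w h1 h2 =>
    have := height_lt (I.vnext hS h2).2
    exact .inr ⟨fun _ _ h => h, id, .inr (by simp only [AcyclicGraph.rank]; omega)⟩
  | hsNext o k1 k2 v w h1 =>
    have := hN (h.vnode w).val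
    exact .inr ⟨fun _ _ h => h, id, .inr (by simp only [AcyclicGraph.rank]; omega)⟩
  | hsScan2_next o k1 k2 v w x h1 h2 =>
    have := height_lt (I.vnext hS.2 h2).2
    exact .inr ⟨fun _ _ h => h, id, .inr (by simp only [AcyclicGraph.rank]; omega)⟩
  | hsMark2_lt o k1 k2 v w =>
    have := hN (h.enode (h.vnode v).edgeHead).val
    cases o <;>
      exact .inr ⟨fun _ _ h => h, id, .inr (by simp only [AcyclicGraph.rank, Loc.found]; omega)⟩
  | hsMark2_ge o k1 k2 v w =>
    have := hN (h.enode (h.vnode w).edgeHead).val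
    cases o <;>
      exact .inr ⟨fun _ _ h => h, id, .inr (by simp only [AcyclicGraph.rank, Loc.found]; omega)⟩
  | ceScan_next k2 e f h1 h2 =>
    have := height_lt (I.enext hS h2).2.1
    exact .inr ⟨fun _ _ h => h, id, .inr (by simp only [AcyclicGraph.rank]; omega)⟩
  | eMark2_pass j k1 k2 v1 v2 =>
    cases j <;> exact .inr ⟨fun _ _ h => h, id, .inr (by simp only [AcyclicGraph.rank]; omega)⟩
  | eRel2 j a e2 =>
    cases a with
    | ret b => exact .inl ⟨b, rfl⟩
    | detect k1 k2 v1 e3 =>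
      refine .inr ⟨fun μ h1 h2 => ?_, fun _ => ⟨_, rfl, trivial⟩, .inr ?_⟩
      · cases j <;> cases h2 <;> exact h1.elim
      · have := hN ((h.setELock e2 none).vnode vertexHead).val
        have := hr ⟨.addEdge k1 k2 v1 e3, k1, key k2, true, ∅, ∅⟩
        simp only [AcyclicGraph.rank, Loc.afterRelease, Loc.enterPath, exploreBound] at *
        omega
  | pScan_next p v w h1 h2 =>
    have := height_lt (I.vnext hS.2 h2).2
    exact .inr ⟨fun _ _ h => h, id, .inr (by simp only [AcyclicGraph.rank]; omega)⟩
  | pScan_absent p v =>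
    exact .inr ⟨fun _ _ h => h, id, .inr (by simp only [AcyclicGraph.rank, PVars.rank]; omega)⟩
  | pMark_absent p v =>
    exact .inr ⟨fun _ _ h => h, id, .inr (by simp only [AcyclicGraph.rank, PVars.rank]; omega)⟩
  | pCheck_not p =>
    exact .inr ⟨fun _ _ h => h, id, .inr (by simp only [AcyclicGraph.rank, PVars.rank]; omega)⟩
  | pMark_pass p v =>
    have := hN (h.enode (h.vnode v).edgeHead).val
    exact .inr ⟨fun _ _ h => h, id, .inr (by simp only [AcyclicGraph.rank]; omega)⟩
  | pStatus_add p e =>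
    exact .inr ⟨fun _ _ h => h, id, .inr (by simp only [AcyclicGraph.rank, PVars.rank]; omega)⟩
  | pNext p e f h1 =>
    have := height_lt (I.enext hS.2.1 h1).2.1
    exact .inr ⟨fun _ _ h => h, id, .inr (by simp only [AcyclicGraph.rank]; omega)⟩
  | pPick_go p x h1 =>
    have := hN (h.vnode vertexHead).val
    have := p.rank_pick h1 false
    refine .inr ⟨fun _ _ h => h, id, .inr ?_⟩
    simp only [AcyclicGraph.rank, exploreBound] at *
    omega
  | pScan_fail p v =>
    have := aux p
    rcases hc : p.caller with _ | ⟨k1, k2, v1, e3⟩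
    · exact .inl ⟨_, rfl⟩
    · refine .inr ⟨fun μ h1 h2 => ?_, fun _ => ⟨_, rfl, trivial⟩, .inr ?_⟩
      · simp only [Loc.method, hc] at h2; cases h2; exact h1.elim
      · simp only [AcyclicGraph.rank, Loc.exitPath]; omega
  | pMark_fail p v =>
    have := aux p
    rcases hc : p.caller with _ | ⟨k1, k2, v1, e3⟩
    · exact .inl ⟨_, rfl⟩
    · refine .inr ⟨fun μ h1 h2 => ?_, fun _ => ⟨_, rfl, trivial⟩, .inr ?_⟩
      · simp only [Loc.method, hc] at h2; cases h2; exact h1.elim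
      · simp only [AcyclicGraph.rank, Loc.exitPath]; omega
  | pPick_done p =>
    rcases hc : p.caller with _ | ⟨k1, k2, v1, e3⟩
    · exact .inl ⟨_, rfl⟩
    · refine .inr ⟨fun μ h1 h2 => ?_, fun _ => ⟨_, rfl, trivial⟩, .inr ?_⟩
      · simp only [Loc.method, hc] at h2; cases h2; exact h1.elim
      · simp only [AcyclicGraph.rank, Loc.exitPath]; omega
  | pCheck_found p =>
    have := aux p
    rcases hc : p.caller with _ | ⟨k1, k2, v1, e3⟩
    · exact .inl ⟨_, rfl⟩
    · refine .inr ⟨fun μ h1 h2 => ?_, fun _ => ⟨_, rfl, trivial⟩, .inr ?_⟩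
      · simp only [Loc.method, hc] at h2; cases h2; exact h1.elim
      · simp only [AcyclicGraph.rank, Loc.exitPath]; omega
  | _ =>
    first
      | exact .inl ⟨_, rfl⟩
      | exact .inr ⟨fun _ _ h => h, id, .inl ⟨trivial, trivial, rfl⟩⟩
      | exact .inr ⟨fun _ _ h => h, id, .inr (by simp only [AcyclicGraph.rank]; omega)⟩

/-- All writes, lock operations and allocations occur in update methods. -/
theorem NStep.heap_eq {h h' : Heap K T} {t : T} {l l' : Loc K} (hn : NStep t h l h' l')
    (hu : ¬ l.Upd) : h' = h := by
  have e : ∀ j : EJob, (Loc.ofEJob j).IsUpdate := by rintro (_ | _ | _) <;> trivial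
  have v : ∀ j : VJob, (Loc.ofVJob j).IsUpdate := by rintro (_ | _) <;> trivial
  cases hn <;> first
    | rfl
    | (refine absurd ⟨_, rfl, ?_⟩ hu
       first | trivial | exact e _ | exact v _)

/-- A thread with a pending call is never about to dereference a null pointer. -/
theorem next_nonempty {h : Heap K T} {g : Ghost} {A : T → ALoc} {t : T} {l : Loc K}
    (I : AInv (view h) g A) (H : HeapInv h g) (hS : Static h g l) (hl : ∀ r, l ≠ .idle r)
    (hr : ∀ n, l.request = some n → h.owner n = none) : (next t h l).Nonempty := by
  have hp0 : g.Pub (.vertex vertexHead) := .inl H.vHead.1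
  have hv0 := H.vHead.2
  -- Traversals move on only from nodes whose key lies below another one, hence is not `⊤`.
  have ne : ∀ {v x}, g.Pub (.vertex v) → (h.vnode v).val < x → ∃ w, (h.vnode v).vnext = some w :=
    fun h1 h2 => Option.ne_none_iff_exists'.1 (I.vnext_ne_none h1 h2.ne_top)
  have nee : ∀ {v x}, g.Pub (.edge v) → (h.enode v).val < x → ∃ w, (h.enode v).enext = some w :=
    fun h1 h2 => Option.ne_none_iff_exists'.1 (I.enext_ne_none h1 h2.ne_top)
  have hb : ∀ x : Key K, x = ⊥ → x < ⊤ := by rintro _ rfl; simp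
  cases l with
  | idle r => exact absurd rfl (hl r)
  | cvScan k v =>
    simp only [next]; split_ifs with h1
    · obtain ⟨w, hw⟩ := ne hS h1; simp [hw]
    · simp
    · simp
  | vStart j k =>
    obtain ⟨w, hw⟩ := ne hp0 (hb _ hv0)
    simp [next, hw]
  | vScan j k v1 v2 =>
    simp only [next]; split_ifs with h1
    · obtain ⟨w, hw⟩ := ne hS.2.1 h1; simp [hw]
    · simp
  | hsScan1 o k1 k2 v =>
    simp only [next]; split_ifs with h1
    · obtain ⟨w, hw⟩ := ne hS h1; simp [hw]
    · simp
    · simp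
  | hsNext o k1 k2 v =>
    obtain ⟨w, hw⟩ := ne hS.1 (lt_top_iff_ne_top.2 hS.2)
    simp [next, hw]
  | hsScan2 o k1 k2 v w =>
    simp only [next]; split_ifs with h1
    · obtain ⟨w, hw⟩ := ne hS.2 h1; simp [hw]
    · simp
    · simp
  | ceScan k e =>
    simp only [next]; split_ifs with h1
    · obtain ⟨w, hw⟩ := nee hS h1; simp [hw]
    · simp
    · simp
  | eStart j k1 k2 v1 =>
    obtain ⟨q1, q2, -⟩ := H.eHead v1 hS.1.alloc
    obtain ⟨w, hw⟩ := nee (.inl q1) (hb _ q2)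
    simp [next, hw]
  | eScan j k1 k2 v1 e1 e2 =>
    simp only [next]; split_ifs with h1
    · obtain ⟨w, hw⟩ := nee hS.2.2.2.1 h1; simp [hw]
    · simp
  | pScan p v =>
    simp only [next]; split_ifs with h1
    · obtain ⟨w, hw⟩ := ne hS.2 h1; simp [hw]
    all_goals simp
  | pNext p e =>
    obtain ⟨w, hw⟩ := nee hS.2.1 (lt_top_iff_ne_top.2 hS.2.2)
    simp [next, hw]
  | pPick p =>
    simp only [next]; split_ifs with h1
    · simp
    · obtain ⟨x, hx, hx'⟩ := Finset.not_subset.1 h1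
      exact ⟨_, x, Finset.mem_sdiff.2 ⟨hx, hx'⟩, rfl⟩
  | vAcq1 j k v1 v2 =>
    have := hr _ rfl
    simp only [Heap.owner] at this
    simp [next, this]
  | vAcq2 j k v1 v2 =>
    have := hr _ rfl
    simp only [Heap.owner] at this
    simp [next, this]
  | eAcq1 j k1 k2 v1 v2 =>
    have := hr _ rfl
    simp only [Heap.owner] at this
    simp [next, this]
  | eAcq2 j k1 k2 v1 v2 =>
    have := hr _ rfl
    simp only [Heap.owner] at this
    simp [next, this]
  | vBody j k v1 v2 => cases j <;> simp only [next] <;> split_ifs <;> simp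
  | eBody j k1 k2 v1 e1 e2 => cases j <;> simp only [next] <;> (try split_ifs) <;> simp
  | eUnlink j e1 e2 x => cases j <;> simp [next]
  | _ => simp only [next] <;> (repeat' split) <;> simp

end AcyclicGraph

/-! ### Lock order, absence of deadlock, wait-freedom -/

namespace AcyclicGraph

variable {K T : Type*} [LinearOrder K] [DecidableEq T]

namespace Inv

/-- The owner of a lock is a thread at a program point where it should hold this lock. -/
theorem held {s : State K T} (I : Inv s) {n : Node} {t : T} (h : s.heap.owner n = some t) :
    (s.loc t).abs.held n := by
  obtain ⟨g, I, -, -⟩ := I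
  rw [← view_lock] at h
  exact (I.lock n t).1 h

theorem owner {s : State K T} (I : Inv s) {n : Node} {t : T} (h : (s.loc t).abs.held n) :
    s.heap.owner n = some t := by
  obtain ⟨g, I, -, -⟩ := I
  rw [← view_lock]
  exact (I.lock n t).2 h

/-- A thread requests a lock while holding one only at its second acquisition. The key sought then
lies above that of the held node and not above that of the requested one. -/
theorem before {s : State K T} (I : Inv s) {t : T} {c d : Node}
    (hc : (s.loc t).request = some c) (hd : s.heap.owner d = some t) : s.heap.Before d c := by
  have hh := I.held hd
  obtain ⟨g, -, -, S⟩ := I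
  have hS := S t
  revert hc hh hS
  cases s.loc t <;> simp only [Loc.request, reduceCtorEq, false_implies, Option.some.injEq] <;>
    simp only [Loc.abs, ALoc.held] <;> rintro rfl <;> try exact False.elim
  · rintro rfl hS
    exact hS.2.2.1.trans_le hS.2.2.2
  · rintro rfl hS
    exact hS.2.2.2.2.2.2.1.trans_le hS.2.2.2.2.2.2.2

theorem canStep {s : State K T} (I : Inv s) {t : T} (hl : ∀ r, s.loc t ≠ .idle r)
    (hr : ∀ n, (s.loc t).request = some n → s.heap.owner n = none) : s.CanStep t := by
  obtain ⟨g, I, H, S⟩ := I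
  exact next_nonempty I H (S t) hl hr

end Inv

omit [DecidableEq T] in
theorem Heap.Before.trans {h : Heap K T} {a b c : Node} (h1 : h.Before a b) (h2 : h.Before b c) :
    h.Before a c := by
  cases a <;> cases b <;> cases c <;> simp only [Heap.Before] at * <;> exact lt_trans h1 h2

omit [DecidableEq T] in
theorem Heap.Before.irrefl {h : Heap K T} {a : Node} (h1 : h.Before a a) : False := by
  cases a <;> exact lt_irrefl _ h1

omit [LinearOrder K] [DecidableEq T] in
theorem Loc.Upd.not_idle {l : Loc K} (h : l.Upd) (r : Option Bool) : l ≠ .idle r := by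
  rintro rfl
  obtain ⟨μ, h, -⟩ := h
  cases h

theorem Execution.locksOrdered (σ : Execution K T) : σ.LocksOrdered :=
  fun n _ _ hc _ hd => (σ.inv n).before hc hd

theorem Execution.noDeadlock (σ : Execution K T) : σ.NoDeadlock := by
  intro n t
  have I := σ.inv n
  constructor
  -- Each thread of the chain holds what the one before it requests, so the requested keys increase.
  · have key : ∀ u, Relation.TransGen (σ.state n).WaitsFor t u →
        ∃ c, ((σ.state n).loc t).request = some c ∧
          ∀ d, ((σ.state n).loc u).request = some d → (σ.state n).heap.Before c d := by
      intro u hu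
      induction hu with
      | single h =>
        obtain ⟨c, h1, h2⟩ := h
        exact ⟨c, h1, fun d hd => I.before hd h2⟩
      | tail _ h ih =>
        obtain ⟨c, h1, h2⟩ := ih
        obtain ⟨d, h3, h4⟩ := h
        exact ⟨c, h1, fun e he => (h2 d h3).trans (I.before he h4)⟩
    intro h
    obtain ⟨c, h1, h2⟩ := key t h
    exact (h2 c h1).irrefl
  · intro hu
    by_cases hr : ∀ c, ((σ.state n).loc t).request = some c → (σ.state n).heap.owner c = none
    · exact .inl (I.canStep (Loc.Upd.not_idle hu) hr)
    · push Not at hr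
      obtain ⟨c, h1, h2⟩ := hr
      obtain ⟨u, ho⟩ := Option.ne_none_iff_exists'.1 h2
      refine .inr ⟨u, ?_, c, h1, ho⟩
      rintro rfl
      exact (I.before h1 ho).irrefl

/-- What a step of the execution does, as seen from the thread that moves. -/
theorem Execution.own_step (σ : Execution K T) {n : ℕ} {t : T} (ha : σ.actor n = some t)
    (hl : ∀ r, (σ.state n).loc t ≠ .idle r) :
    ((σ.state (n + 1)).heap, (σ.state (n + 1)).loc t) ∈
      next t (σ.state n).heap ((σ.state n).loc t) := by
  have h := σ.act_step n t ha
  generalize σ.state n = s, σ.state (n + 1) = s' at *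
  cases h with
  | invoke r l hr _ => exact absurd hr (hl r)
  | step h l hn => simpa using hn

theorem Execution.loc_of_ne (σ : Execution K T) {n : ℕ} {t : T} (ha : σ.actor n ≠ some t) :
    (σ.state (n + 1)).loc t = (σ.state n).loc t := by
  rcases hu : σ.actor n with _ | u
  · rw [σ.idle_step n hu]
  · have hne : t ≠ u := by rintro rfl; exact ha hu
    have h := σ.act_step n u hu
    generalize σ.state n = s, σ.state (n + 1) = s' at *
    cases h <;> simp [hne]

section

variable [Fintype K]

/-- The rank of a thread at a time. -/
def Execution.rankAt (σ : Execution K T) (n : ℕ) (t : T) : ℕ :=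
  rank (σ.state n).heap ((σ.state n).loc t)

theorem Execution.rankAt_of_ne (σ : Execution K T) {n : ℕ} {t : T} (ha : σ.actor n ≠ some t) :
    σ.rankAt (n + 1) t = σ.rankAt n t := by
  rw [rankAt, rankAt, σ.loc_of_ne ha]
  rcases hu : σ.actor n with _ | u
  · rw [σ.idle_step n hu]
  · obtain ⟨g, I, H, S⟩ := σ.inv n
    have h := σ.act_step n u hu
    generalize σ.state n = s, σ.state (n + 1) = s' at *
    cases h with
    | invoke => rfl
    | step h l hn =>
      obtain ⟨g', -, -, E, -⟩ := (nstep_of_mem_next hn).preserved I H rfl (S u)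
      exact rank_mono E (S t)

theorem Execution.rank_step (σ : Execution K T) {n : ℕ} {t : T} (ha : σ.actor n = some t)
    (hl : ∀ r, (σ.state n).loc t ≠ .idle r) :
    (∃ b, (σ.state (n + 1)).loc t = .idle (some b)) ∨
      ((∀ μ : Method, μ.IsReadOnly → ((σ.state n).loc t).method = some μ →
        ((σ.state (n + 1)).loc t).method = some μ) ∧
        (((σ.state n).loc t).Upd → ((σ.state (n + 1)).loc t).Upd) ∧
        ((((σ.state n).loc t).Loop ∧ ((σ.state (n + 1)).loc t).Loop ∧
          σ.rankAt (n + 1) t = σ.rankAt n t) ∨ σ.rankAt (n + 1) t < σ.rankAt n t)) := by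
  obtain ⟨g, I, H, S⟩ := σ.inv n
  exact (nstep_of_mem_next (σ.own_step ha hl)).rank I (S t)

omit [Fintype K] [LinearOrder K] in
theorem Loc.free_of_readOnly {l : Loc K} {μ : Method} (h : l.method = some μ)
    (hμ : μ.IsReadOnly) : (∃ tr, l.abs = .free tr) ∧ l.request = none ∧ ¬ l.Loop := by
  have hv : ∀ j, ¬ (Loc.ofVJob j).IsReadOnly := by rintro (_ | _) <;> exact id
  have he : ∀ j, ¬ (Loc.ofEJob j).IsReadOnly := by rintro (_ | _ | _) <;> exact id
  cases l <;> simp only [Loc.method, Option.some.injEq, reduceCtorEq] at h <;> subst h <;> first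
    | exact ⟨⟨_, rfl⟩, rfl, id⟩ | exact absurd hμ (hv _) | exact absurd hμ (he _) | exact hμ.elim

omit [Fintype K] [LinearOrder K] in
theorem Loc.free_of_inPathExists {l : Loc K} (h : l.InPathExists) :
    (∃ tr, l.abs = .free tr) ∧ l.request = none ∧ ¬ l.Loop ∧ ∀ r, l ≠ .idle r := by
  cases l <;> first | exact h.elim | exact ⟨⟨_, rfl⟩, rfl, id, by rintro _ ⟨⟩⟩

omit [Fintype K] in
theorem Inv.owner_ne {s : State K T} (I : Inv s) {t : T} (h : ∃ tr, (s.loc t).abs = .free tr)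
    (c : Node) : s.heap.owner c ≠ some t := by
  intro hc
  have := I.held hc
  obtain ⟨tr, h⟩ := h
  rw [h] at this
  exact this

omit [Fintype K] in
theorem Execution.moves_succ (σ : Execution K T) (t : T) {n m : ℕ} (h : n ≤ m) :
    σ.moves t n (m + 1) = σ.moves t n m + if σ.actor m = some t then 1 else 0 := by
  rw [moves, moves, Finset.Ico_add_one_right_eq_Icc, ← Finset.Ico_insert_right h,
    Finset.filter_insert]
  split_ifs
  · rw [Finset.card_insert_of_notMem (by simp)]
  · rfl

/-- Outside the loop each own move lowers the rank, and the moves of others keep it. So the rank at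
time `n` bounds the number of moves before the return. -/
theorem Execution.waitFree (σ : Execution K T) {μ : Method} (hμ : μ.IsReadOnly) :
    σ.WaitFree (rankBound K) μ := by
  intro n t hn
  obtain ⟨h1, h2, -⟩ := Loc.free_of_readOnly hn hμ
  have notIdle : ∀ m, ((σ.state m).loc t).method = some μ → ∀ r, (σ.state m).loc t ≠ .idle r := by
    intro m hm r hr
    rw [hr] at hm
    cases hm
  refine ⟨(σ.inv n).owner_ne h1, (σ.inv n).canStep (notIdle n hn) (by simp [h2]), ?_⟩
  intro m hm
  by_contra hc
  push Not at hc
  have key : ∀ k, n ≤ k → k ≤ m → ((σ.state k).loc t).method = some μ ∧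
      σ.rankAt k t + σ.moves t n k ≤ σ.rankAt n t := by
    intro k hk
    induction k, hk using Nat.le_induction with
    | base => exact fun _ => ⟨hn, by simp [moves]⟩
    | succ k hk ih =>
      intro hkm
      obtain ⟨i1, i2⟩ := ih (by omega)
      rw [σ.moves_succ t hk]
      by_cases ha : σ.actor k = some t
      · rw [if_pos ha]
        rcases σ.rank_step ha (notIdle k i1) with ⟨b, hb⟩ | ⟨q1, -, q2⟩
        · exact absurd ⟨ha, ⟨μ, i1⟩, b, hb⟩ (hc k hk (by omega))
        · refine ⟨q1 μ hμ i1, ?_⟩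
          rcases q2 with q2 | q2
          · exact absurd q2.1 (Loc.free_of_readOnly i1 hμ).2.2
          · omega
      · rw [if_neg ha, σ.rankAt_of_ne ha, σ.loc_of_ne ha]
        exact ⟨i1, i2⟩
  by_cases hnm : n ≤ m
  · have h3 := (key m hnm le_rfl).2
    have h4 := rank_le (σ.state n).heap ((σ.state n).loc t)
    rw [rankAt, rankAt] at h3
    omega
  -- For `m < n` no moves are counted, whereas the bound is positive.
  · have : σ.moves t n m = 0 := by simp [moves, Finset.Ico_eq_empty_of_le (by omega : m ≤ n)]
    have h4 : 0 < rankBound K := by simp [rankBound]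
    omega

/-- The same count of moves, except that it ends when control leaves the code of `PathExists`, be it
by a return or towards a commit or a withdrawal. -/
theorem Execution.pathExistsWaitFree (σ : Execution K T) :
    σ.PathExistsWaitFree (rankBound K) := by
  intro n t hn
  obtain ⟨h1, h2, -, h3⟩ := Loc.free_of_inPathExists hn
  refine ⟨(σ.inv n).owner_ne h1, (σ.inv n).canStep h3 (by simp [h2]), ?_⟩
  intro m hm
  by_contra hc
  push Not at hc
  have key : ∀ k, n ≤ k → k ≤ m → ((σ.state k).loc t).InPathExists ∧
      σ.rankAt k t + σ.moves t n k ≤ σ.rankAt n t := by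
    intro k hk
    induction k, hk using Nat.le_induction with
    | base => exact fun _ => ⟨hn, by simp [moves]⟩
    | succ k hk ih =>
      intro hkm
      obtain ⟨i1, i2⟩ := ih (by omega)
      have i3 := hc (k + 1) (by omega) hkm
      refine ⟨i3, ?_⟩
      rw [σ.moves_succ t hk]
      obtain ⟨-, -, i4, i5⟩ := Loc.free_of_inPathExists i1
      by_cases ha : σ.actor k = some t
      · rw [if_pos ha]
        rcases σ.rank_step ha i5 with ⟨b, hb⟩ | ⟨-, -, q2⟩
        · rw [hb] at i3; exact i3.elim
        · rcases q2 with q2 | q2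
          · exact absurd q2.1 i4
          · omega
      · rw [if_neg ha, σ.rankAt_of_ne ha]
        exact i2
  by_cases hnm : n ≤ m
  · have h3 := (key m hnm le_rfl).2
    have h4 := rank_le (σ.state n).heap ((σ.state n).loc t)
    rw [rankAt, rankAt] at h3
    omega
  · have : σ.moves t n m = 0 := by simp [moves, Finset.Ico_eq_empty_of_le (by omega : m ≤ n)]
    have h4 : 0 < rankBound K := by simp [rankBound]
    omega

end

end AcyclicGraph

/-! ### Attempts to locate a position while only locks change -/

namespace AcyclicGraph

variable {K T : Type*}

/-- The two heaps differ at most in the locks. -/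
structure SameCore (h h' : Heap K T) : Prop where
  vval : ∀ a, (h'.vnode a).val = (h.vnode a).val
  vnext : ∀ a, (h'.vnode a).vnext = (h.vnode a).vnext
  marked : ∀ a, (h'.vnode a).marked = (h.vnode a).marked
  edgeHead : ∀ a, (h'.vnode a).edgeHead = (h.vnode a).edgeHead
  eval : ∀ a, (h'.enode a).val = (h.enode a).val
  enext : ∀ a, (h'.enode a).enext = (h.enode a).enext
  status : ∀ a, (h'.enode a).status = (h.enode a).status

theorem SameCore.refl (h : Heap K T) : SameCore h h :=
  ⟨fun _ => rfl, fun _ => rfl, fun _ => rfl, fun _ => rfl, fun _ => rfl, fun _ => rfl, fun _ => rfl⟩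

theorem SameCore.trans {h h' h'' : Heap K T} (H : SameCore h h') (H' : SameCore h' h'') :
    SameCore h h'' :=
  ⟨fun a => (H'.vval a).trans (H.vval a), fun a => (H'.vnext a).trans (H.vnext a),
    fun a => (H'.marked a).trans (H.marked a), fun a => (H'.edgeHead a).trans (H.edgeHead a),
    fun a => (H'.eval a).trans (H.eval a), fun a => (H'.enext a).trans (H.enext a),
    fun a => (H'.status a).trans (H.status a)⟩

theorem SameCore.setVLock (h : Heap K T) (a : ℕ) (x : Option T) :
    SameCore h (h.setVLock a x) := by
  refine ⟨fun b => ?_, fun b => ?_, fun b => ?_, fun b => ?_, fun _ => rfl, fun _ => rfl,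
    fun _ => rfl⟩ <;> by_cases hb : b = a <;>
    first | (subst hb; simp [Heap.setVLock, Heap.modV]) | simp [Heap.setVLock, Heap.modV, hb]

theorem SameCore.setELock (h : Heap K T) (a : ℕ) (x : Option T) :
    SameCore h (h.setELock a x) := by
  refine ⟨fun _ => rfl, fun _ => rfl, fun _ => rfl, fun _ => rfl, fun b => ?_, fun b => ?_,
    fun b => ?_⟩ <;> by_cases hb : b = a <;>
    first | (subst hb; simp [Heap.setELock, Heap.modE]) | simp [Heap.setELock, Heap.modE, hb]

theorem SameCore.view_val {h h' : Heap K T} (H : SameCore h h') (n : Node) :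
    (view h' n).val = (view h n).val := by
  cases n
  · exact H.vval _
  · exact H.eval _

variable [LinearOrder K]

theorem NStep.sameCore {h h' : Heap K T} {t : T} {l l' : Loc K} (hn : NStep t h l h' l')
    (h1 : l.Loop) (h2 : l'.Loop) : SameCore h h' := by
  cases hn <;> first
    | exact h1.elim | exact h2.elim | exact .refl _ | exact .setVLock _ _ _ | exact .setELock _ _ _

namespace Loc

def Start : Loc K → Prop
  | vStart _ _ | eStart _ _ _ _ => True
  | _ => False

/-- The thread is not executing `AcyclicRemoveEdge`, if it is in an edge list. -/
def Lenient : Loc K → Prop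
  | eStart j _ _ _ | eScan j _ _ _ _ _ | eAcq1 j _ _ _ _ _ | eAcq2 j _ _ _ _ _
  | eVal1 j _ _ _ _ _ | eVal2 j _ _ _ _ _ | eVal3 j _ _ _ _ _ | eRetry1 j _ _ _ _ _
  | eRetry2 j _ _ _ _ => j ≠ .remove
  | _ => True

/-- A bound on the number of steps until the next attempt to locate the position. -/
def attemptRank [Fintype K] (h : Heap K T) : Loc K → ℕ
  | vStart _ _ | eStart _ _ _ _ => Fintype.card (Key K) + 10
  | vScan _ _ _ v2 => 9 + height (h.vnode v2).val
  | eScan _ _ _ _ _ e2 => 9 + height (h.enode e2).val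
  | vAcq1 _ _ _ _ | eAcq1 _ _ _ _ _ _ => 8
  | vAcq2 _ _ _ _ | eAcq2 _ _ _ _ _ _ => 7
  | vVal1 _ _ _ _ | eVal1 _ _ _ _ _ _ => 6
  | vVal2 _ _ _ _ | eVal2 _ _ _ _ _ _ => 5
  | vVal3 _ _ _ _ | eVal3 _ _ _ _ _ _ => 4
  | vRetry1 _ _ _ _ | eRetry1 _ _ _ _ _ _ => 3
  | vRetry2 _ _ _ | eRetry2 _ _ _ _ _ => 2
  | _ => 0

omit [LinearOrder K] in
theorem upd_of_held {l : Loc K} {n : Node} (h : l.abs.held n) : l.Upd := by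
  have he : ∀ j, (ofEJob j).IsUpdate := by rintro (_ | _ | _) <;> trivial
  have hv : ∀ j, (ofVJob j).IsUpdate := by rintro (_ | _) <;> trivial
  cases l <;> first
    | exact h.elim
    | (refine ⟨_, rfl, ?_⟩
       first | trivial | exact he _ | exact hv _)

omit [LinearOrder K] in
theorem upd_of_rm {l : Loc K} {n : Node} (h : l.abs.rm = some n) : l.Upd ∧ ¬ l.Loop := by
  have he : ∀ j, (ofEJob j).IsUpdate := by rintro (_ | _ | _) <;> trivial
  cases l <;> first
    | (cases h; done)
    | (refine ⟨⟨_, rfl, ?_⟩, id⟩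
       first | trivial | exact he _)

omit [LinearOrder K] in
theorem upd_of_tr {l : Loc K} {n : Node} (h : l.abs.tr = some n) : l.Upd := by
  have he : ∀ j, (ofEJob j).IsUpdate := by rintro (_ | _ | _) <;> trivial
  have hp : ∀ c : PCaller K, c.tr = some n → (ofPCaller c).IsUpdate := by
    rintro (_ | _) h
    · cases h
    · trivial
  cases l <;> first
    | (cases h; done)
    | (refine ⟨_, rfl, ?_⟩
       first | trivial | exact he _ | exact hp _ h)

omit [LinearOrder K] in
-- In the loop, the owner of a transit node can only be withdrawing it: in the first phase of
-- `AcyclicAddEdge` the node does not exist yet.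
theorem lenient_of_tr {l : Loc K} {n : Node} (h : l.abs.tr = some n) (hl : l.Loop) :
    l.Lenient := by
  cases l <;> first
    | exact hl.elim
    | trivial
    | (rintro rfl; cases h)

end Loc

/-- Within the loop, a step either starts a new attempt or comes closer to one. -/
theorem NStep.attempt [Fintype K] {h0 h h' : Heap K T} {g : Ghost} {A : T → ALoc} {t : T}
    {l l' : Loc K} (I : AInv (view h) g A) (hS : Static h g l) (hc : SameCore h0 h)
    (hn : NStep t h l h' l') (h1 : l.Loop) (h2 : l'.Loop) :
    (l.Lenient → l'.Lenient) ∧ (l'.Start ∨ l'.attemptRank h0 < l.attemptRank h0) := by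
  have hN := fun x => height_lt_card (K := K) x
  cases hn with
  | vStart j k v2 h3 =>
    have := hN (h0.vnode v2).val
    exact ⟨id, .inr (by simp only [Loc.attemptRank]; omega)⟩
  | eStart j k1 k2 v1 e2 h3 =>
    have := hN (h0.enode e2).val
    exact ⟨id, .inr (by simp only [Loc.attemptRank]; omega)⟩
  | vScan_next j k v1 v2 w h3 h4 =>
    have := (I.vnext hS.2.1 h4).2
    -- Keys are read in the fixed heap `h0`, so that ranks at different times can be compared.
    rw [hc.vval, hc.vval] at this
    have := height_lt this
    exact ⟨id, .inr (by simp only [Loc.attemptRank]; omega)⟩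
  | eScan_next j k1 k2 v1 e1 e2 f h3 h4 =>
    have := (I.enext hS.2.2.2.1 h4).2.1
    rw [hc.eval, hc.eval] at this
    have := height_lt this
    exact ⟨id, .inr (by simp only [Loc.attemptRank]; omega)⟩
  | _ =>
    first
      | exact h1.elim
      | exact h2.elim
      | exact ⟨id, .inl trivial⟩
      | exact ⟨id, .inr (by simp only [Loc.attemptRank]; omega)⟩

def VReach (h : Heap K T) (v : ℕ) : Prop :=
  Relation.ReflTransGen (fun a b => (h.vnode a).vnext = some b) vertexHead v

def EReach (h : Heap K T) (v1 e : ℕ) : Prop :=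
  Relation.ReflTransGen (fun a b => (h.enode a).enext = some b) (h.vnode v1).edgeHead e

/-- The first clause covers every node that the traversal can still come to, so moving on does not
invalidate it. -/
def VOk (h : Heap K T) (v1 v2 : ℕ) : Prop :=
  (∀ v, VReach h v → (h.vnode v).marked = false) ∧ VReach h v1 ∧ (h.vnode v1).vnext = some v2

def EOk (h : Heap K T) (j : EJob) (v1 e1 e2 : ℕ) : Prop :=
  (∀ e, EReach h v1 e → j.ok (h.enode e).status) ∧ EReach h v1 e1 ∧
    (h.enode e1).enext = some e2

open Loc in
/-- The current attempt will be successful if nobody interferes. -/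
def OnTrack (h : Heap K T) : Loc K → Prop
  | vStart _ _ => ∀ v, VReach h v → (h.vnode v).marked = false
  | vScan _ _ v1 v2 | vAcq1 _ _ v1 v2 | vAcq2 _ _ v1 v2 | vVal1 _ _ v1 v2 | vVal2 _ _ v1 v2
  | vVal3 _ _ v1 v2 => VOk h v1 v2
  | eStart j _ _ v1 => ∀ e, EReach h v1 e → j.ok (h.enode e).status
  | eScan j _ _ v1 e1 e2 | eAcq1 j _ _ v1 e1 e2 | eAcq2 j _ _ v1 e1 e2 | eVal1 j _ _ v1 e1 e2
  | eVal2 j _ _ v1 e1 e2 | eVal3 j _ _ v1 e1 e2 => EOk h j v1 e1 e2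
  | _ => False

theorem VOk.next {h : Heap K T} {v1 v2 : ℕ} (H : VOk h v1 v2) : VReach h v2 :=
  H.2.1.tail H.2.2

theorem EOk.next {h : Heap K T} {j : EJob} {v1 e1 e2 : ℕ} (H : EOk h j v1 e1 e2) :
    EReach h v1 e2 :=
  H.2.1.tail H.2.2

/-- In an unchanging list the traversal meets only reachable nodes and its last two are adjacent, so
no test of the validation fails. The attempt stays on track until it leaves the loop. -/
theorem NStep.onTrack {h0 h h' : Heap K T} {t : T} {l l' : Loc K} (hc : SameCore h0 h)
    (hn : NStep t h l h' l') (h1 : OnTrack h0 l) (h2 : l'.Loop) :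
    OnTrack h0 l' ∧ ¬ l'.Start := by
  cases hn with
  | vStart j k v2 h3 => exact ⟨⟨h1, .refl, by rw [← hc.vnext]; exact h3⟩, id⟩
  | vScan_next j k v1 v2 w h3 h4 => exact ⟨⟨h1.1, h1.next, by rw [← hc.vnext]; exact h4⟩, id⟩
  | vVal1_fail j k v1 v2 h3 =>
    have := h1.1 _ h1.2.1
    rw [← hc.marked, h3] at this; cases this
  | vVal2_fail j k v1 v2 h3 =>
    have := h1.1 _ h1.next
    rw [← hc.marked, h3] at this; cases this
  | vVal3_fail j k v1 v2 h3 => exact absurd (by rw [hc.vnext]; exact h1.2.2) h3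
  | eStart j k1 k2 v1 e2 h3 =>
    rw [hc.edgeHead] at h3 ⊢
    exact ⟨⟨h1, .refl, by rw [← hc.enext]; exact h3⟩, id⟩
  | eScan_next j k1 k2 v1 e1 e2 f h3 h4 =>
    exact ⟨⟨h1.1, h1.next, by rw [← hc.enext]; exact h4⟩, id⟩
  | eVal1_fail j k1 k2 v1 e1 e2 h3 => exact absurd (by rw [hc.status]; exact h1.1 _ h1.2.1) h3
  | eVal2_fail j k1 k2 v1 e1 e2 h3 => exact absurd (by rw [hc.status]; exact h1.1 _ h1.next) h3
  | eVal3_fail j k1 k2 v1 e1 e2 h3 => exact absurd (by rw [hc.enext]; exact h1.2.2) h3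
  | _ => first | exact h2.elim | exact h1.elim | exact ⟨h1, id⟩

/-- The head is live, and `succ` passes this on to each successor. -/
theorem AInv.vReach_live {h : Heap K T} {g : Ghost} {A : T → ALoc} (I : AInv (view h) g A)
    (H : HeapInv h g) {v : ℕ} (hv : VReach h v) : g.place (.vertex v) = .live := by
  induction hv with
  | refl => exact H.vHead.1
  | tail _ h1 ih => exact (I.succ _ (.vertex _) ih (by simp [view, h1])).1

theorem AInv.eReach_live {h : Heap K T} {g : Ghost} {A : T → ALoc} (I : AInv (view h) g A)
    (H : HeapInv h g) {v1 e : ℕ} (hv1 : g.place (.vertex v1) ≠ .unalloc) (hv : EReach h v1 e) :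
    g.place (.edge e) = .live := by
  induction hv with
  | refl => exact (H.eHead v1 hv1).1
  | tail _ h1 ih => exact (I.succ _ (.edge _) ih (by simp [view, h1])).1

end AcyclicGraph

/-! ### Deadlock-freedom of the update methods -/

namespace AcyclicGraph

variable {K T : Type*} [LinearOrder K] [DecidableEq T]

omit [LinearOrder K] [DecidableEq T] in
theorem SameCore.vReach {h h' : Heap K T} (H : SameCore h h') {v : ℕ} (hv : VReach h v) :
    VReach h' v := by
  simpa only [VReach, H.vnext] using hv

omit [LinearOrder K] [DecidableEq T] in
theorem SameCore.eReach {h h' : Heap K T} (H : SameCore h h') {v e : ℕ} (he : EReach h v e) :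
    EReach h' v e := by
  simpa only [EReach, H.enext, H.edgeHead] using he

omit [LinearOrder K] in
theorem Loc.loop_of_request {l : Loc K} {c : Node} (h : l.request = some c) : l.Loop := by
  cases l <;> trivial

namespace Execution

/-- From time `N` on, all threads that execute update methods are locating positions, forever. -/
structure Stuck (σ : Execution K T) (N : ℕ) : Prop where
  upd : ∀ m, N ≤ m → ∀ u, ((σ.state m).loc u).Upd → ((σ.state (m + 1)).loc u).Upd
  loop : ∀ m, N ≤ m → ∀ u, ((σ.state m).loc u).Upd → ((σ.state m).loc u).Loop
  core : ∀ m, N ≤ m → SameCore (σ.state N).heap (σ.state m).heap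

theorem loc_eq_of_forall_ne (σ : Execution K T) {u : T} {m m' : ℕ} (h : m ≤ m')
    (hk : ∀ k, m ≤ k → k < m' → σ.actor k ≠ some u) :
    (σ.state m').loc u = (σ.state m).loc u := by
  induction m', h using Nat.le_induction with
  | base => rfl
  | succ k h ih =>
    rw [σ.loc_of_ne (hk k h (by omega)), ih fun i h1 h2 => hk i h1 (by omega)]

/-- The first move of a thread from time `m` on. -/
theorem exists_first (σ : Execution K T) {u : T} {m : ℕ} (h : ∃ m', m ≤ m' ∧ σ.actor m' = some u) :
    ∃ m', m ≤ m' ∧ σ.actor m' = some u ∧ (σ.state m').loc u = (σ.state m).loc u := by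
  classical
  refine ⟨Nat.find h, (Nat.find_spec h).1, (Nat.find_spec h).2,
    σ.loc_eq_of_forall_ne (Nat.find_spec h).1 fun k h1 h2 h3 => Nat.find_min h h2 ⟨h1, h3⟩⟩

/-- In a fair execution, a thread that does not move any more is eventually blocked forever. -/
theorem exists_blocked (σ : Execution K T) (hF : σ.Fair) {u : T} {m : ℕ}
    (hc : ∀ m', m ≤ m' → σ.actor m' ≠ some u) :
    ∃ m1, m ≤ m1 ∧ ∀ m', m1 ≤ m' →
      (σ.state m').loc u = (σ.state m).loc u ∧ ¬ (σ.state m').CanStep u := by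
  have hf : ¬ ∃ᶠ n in Filter.atTop, (σ.state n).CanStep u := by
    intro hf
    obtain ⟨b, h1, h2⟩ := Filter.frequently_atTop.1 (hF u hf) m
    exact hc b h1 h2
  rw [Filter.not_frequently, Filter.eventually_atTop] at hf
  obtain ⟨a, ha⟩ := hf
  exact ⟨max a m, le_max_right _ _, fun m' h' =>
    ⟨σ.loc_eq_of_forall_ne ((le_max_right _ _).trans h') fun k h1 _ => hc k h1,
      ha m' ((le_max_left _ _).trans h')⟩⟩

namespace Stuck

variable {σ : Execution K T} {N : ℕ}

theorem upd_le (S : σ.Stuck N) {m m' : ℕ} (hN : N ≤ m) (h : m ≤ m') {u : T}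
    (hu : ((σ.state m).loc u).Upd) : ((σ.state m').loc u).Upd := by
  induction m', h using Nat.le_induction with
  | base => exact hu
  | succ k h ih => exact S.upd k (hN.trans h) u ih

theorem own_step (S : σ.Stuck N) {m : ℕ} (hN : N ≤ m) {u : T} (hu : ((σ.state m).loc u).Upd)
    (ha : σ.actor m = some u) :
    NStep u (σ.state m).heap ((σ.state m).loc u) (σ.state (m + 1)).heap
      ((σ.state (m + 1)).loc u) ∧ ((σ.state (m + 1)).loc u).Loop :=
  ⟨nstep_of_mem_next (σ.own_step ha hu.not_idle),
    S.loop _ (by omega) u (S.upd m hN u hu)⟩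

variable [Fintype K]

theorem attempt (S : σ.Stuck N) {m : ℕ} (hN : N ≤ m) {u : T} (hu : ((σ.state m).loc u).Upd)
    (ha : σ.actor m = some u) :
    (((σ.state m).loc u).Lenient → ((σ.state (m + 1)).loc u).Lenient) ∧
      (((σ.state (m + 1)).loc u).Start ∨
        ((σ.state (m + 1)).loc u).attemptRank (σ.state N).heap <
          ((σ.state m).loc u).attemptRank (σ.state N).heap) := by
  obtain ⟨h1, h2⟩ := S.own_step hN hu ha
  obtain ⟨g, I, H, St⟩ := σ.inv m
  exact h1.attempt I (St u) (S.core m hN) (S.loop m hN u hu) h2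

omit [Fintype K] in
theorem before_val (S : σ.Stuck N) {m : ℕ} (hN : N ≤ m) {u : T} {c d : Node}
    (hc : ((σ.state m).loc u).request = some c) (hd : (σ.state m).heap.owner d = some u) :
    (view (σ.state N).heap d).val < (view (σ.state N).heap c).val := by
  have h := (σ.inv m).before hc hd
  rw [← (S.core m hN).view_val, ← (S.core m hN).view_val]
  cases c <;> cases d <;> first | exact h.elim | exact h

/-- A thread that holds a lock releases it, if the threads that hold locks move. -/
theorem exists_release (S : σ.Stuck N) {c : Node} {m1 : ℕ} (hN : N ≤ m1)
    (hmove : ∀ m w, m1 ≤ m → (σ.state m).heap.owner c = some w →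
      ∃ m', m ≤ m' ∧ σ.actor m' = some w) (r : ℕ) :
    ∀ m w, m1 ≤ m → (σ.state m).heap.owner c = some w →
      ((σ.state m).loc w).attemptRank (σ.state N).heap < r →
      ∃ m', m1 ≤ m' ∧ (σ.state m').heap.owner c = none := by
  induction r with
  | zero => intro m w _ _ h; omega
  | succ r ih =>
    intro m w hm hw hr
    obtain ⟨m2, h1, h2, h3⟩ := σ.exists_first (hmove m w hm hw)
    have hh : ((σ.state m2).loc w).abs.held c := by rw [h3]; exact (σ.inv m).held hw
    have hupd := Loc.upd_of_held hh
    have hN2 : N ≤ m2 := by omega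
    obtain ⟨-, h4⟩ := S.attempt hN2 hupd h2
    -- Only `w` moves at time `m2`, so afterwards the lock is free or still held by `w`.
    rcases ho : (σ.state (m2 + 1)).heap.owner c with _ | w'
    · exact ⟨m2 + 1, by omega, ho⟩
    · have hh' := (σ.inv (m2 + 1)).held ho
      have hww : w' = w := by
        by_contra hne
        rw [σ.loc_of_ne (by rw [h2]; simpa using Ne.symm hne)] at hh'
        have e1 := (σ.inv m2).owner hh'
        have e2 := (σ.inv m2).owner hh
        rw [e1] at e2
        exact hne (by simpa using e2)
      subst hww
      refine ih (m2 + 1) w' (by omega) ho ?_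
      rcases h4 with h4 | h4
      -- At the start of an attempt no lock is held, so this case is void.
      · revert h4 hh'
        cases (σ.state (m2 + 1)).loc w' <;> first | exact fun h _ => h.elim | exact fun _ h => h.elim
      · rw [h3] at h4; omega

/-- Every thread in the loop moves again and again. -/
theorem exists_move (S : σ.Stuck N) (hF : σ.Fair) (d : ℕ) : ∀ (m : ℕ) (u : T), N ≤ m →
    ((σ.state m).loc u).Upd →
    (∀ c, ((σ.state m).loc u).request = some c →
      height (view (σ.state N).heap c).val < d) →
    ∃ m', m ≤ m' ∧ σ.actor m' = some u := by
  -- The induction is on the height of the requested key. For `d = 0` nothing can be requested, and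
  -- then nothing blocks the thread.
  induction d with
  | zero =>
    intro m u hN hu hr
    by_contra hc
    push Not at hc
    obtain ⟨m1, h1, h2⟩ := σ.exists_blocked hF hc
    obtain ⟨h3, h4⟩ := h2 m1 le_rfl
    refine h4 ((σ.inv m1).canStep ?_ ?_)
    · rw [h3]; exact hu.not_idle
    · intro c hc
      rw [h3] at hc
      exact absurd (hr c hc) (by omega)
  | succ d ih =>
    intro m u hN hu hr
    by_contra hc
    push Not at hc
    obtain ⟨m1, h1, h2⟩ := σ.exists_blocked hF hc
    have hblk : ∀ m', m1 ≤ m' → ∃ c, ((σ.state m).loc u).request = some c ∧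
        (σ.state m').heap.owner c ≠ none := by
      intro m' h'
      obtain ⟨h3, h4⟩ := h2 m' h'
      by_contra hno
      push Not at hno
      refine h4 ((σ.inv m').canStep ?_ ?_)
      · rw [h3]; exact hu.not_idle
      · rw [h3]; exact hno
    obtain ⟨c, hreq, -⟩ := hblk m1 le_rfl
    have hne : ∀ m', m1 ≤ m' → (σ.state m').heap.owner c ≠ none := by
      intro m' h'
      obtain ⟨c', h3, h4⟩ := hblk m' h'
      rw [hreq] at h3
      cases h3
      exact h4
    obtain ⟨w, hw⟩ := Option.ne_none_iff_exists'.1 (hne m1 le_rfl)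
    -- Whoever holds `c` can request only a larger key, so the induction hypothesis keeps it moving
    -- until `c` is free. A single free moment suffices, as `u` is supposed to be blocked at all
    -- times from `m1` on.
    obtain ⟨m', h5, h6⟩ := S.exists_release (c := c) (m1 := m1) (by omega) (fun m' w h' ho =>
      ih m' w (by omega) (Loc.upd_of_held ((σ.inv m').held ho)) fun c' hc' => by
        have := height_lt (S.before_val (by omega) hc' ho)
        have := hr c hreq
        omega) _ m1 w le_rfl hw (Nat.lt_succ_self _)
    exact hne m' h5 h6

theorem exists_first_move (S : σ.Stuck N) (hF : σ.Fair) {m : ℕ} {u : T} (hN : N ≤ m)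
    (hu : ((σ.state m).loc u).Upd) :
    ∃ m', m ≤ m' ∧ σ.actor m' = some u ∧ (σ.state m').loc u = (σ.state m).loc u :=
  σ.exists_first (S.exists_move hF (Fintype.card (Key K)) m u hN hu fun _ _ => height_lt_card _)

/-- Every thread in the loop starts a new attempt. -/
theorem exists_start (S : σ.Stuck N) (hF : σ.Fair) {u : T} (r : ℕ) : ∀ m, N ≤ m →
    ((σ.state m).loc u).Upd → ((σ.state m).loc u).attemptRank (σ.state N).heap < r →
    ∃ m', m ≤ m' ∧ ((σ.state m').loc u).Start ∧
      (((σ.state m).loc u).Lenient → ((σ.state m').loc u).Lenient) := by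
  induction r with
  | zero => intro m _ _ h; omega
  | succ r ih =>
    intro m hN hu hr
    obtain ⟨m2, h1, h2, h3⟩ := S.exists_first_move hF hN hu
    have hu2 : ((σ.state m2).loc u).Upd := by rw [h3]; exact hu
    obtain ⟨h4, h5⟩ := S.attempt (hN.trans h1) hu2 h2
    rw [h3] at h4 h5
    rcases h5 with h5 | h5
    · exact ⟨m2 + 1, by omega, h5, h4⟩
    · obtain ⟨m3, h6, h7, h8⟩ := ih (m2 + 1) (by omega) (S.upd m2 (by omega) u hu2) (by omega)
      exact ⟨m3, by omega, h7, fun h => h8 (h4 h)⟩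

/-- An attempt that is on track leads out of the loop. -/
theorem not_onTrack (S : σ.Stuck N) (hF : σ.Fair) {u : T} (r : ℕ) : ∀ m, N ≤ m →
    ((σ.state m).loc u).Upd → ((σ.state m).loc u).attemptRank (σ.state N).heap < r →
    ¬ OnTrack (σ.state N).heap ((σ.state m).loc u) := by
  induction r with
  | zero => intro m _ _ h; omega
  | succ r ih =>
    intro m hN hu hr ht
    obtain ⟨m2, h1, h2, h3⟩ := S.exists_first_move hF hN hu
    have hu2 : ((σ.state m2).loc u).Upd := by rw [h3]; exact hu
    obtain ⟨-, h5⟩ := S.attempt (hN.trans h1) hu2 h2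
    obtain ⟨h6, h7⟩ := S.own_step (hN.trans h1) hu2 h2
    rw [h3] at h5 h6
    obtain ⟨h8, h9⟩ := h6.onTrack (S.core m2 (by omega)) ht h7
    have h10 := h5.resolve_left h9
    exact ih (m2 + 1) (by omega) (S.upd m2 (by omega) u hu2) (by omega) h8

omit [Fintype K] in
-- A live marked node is about to be unlinked by an update thread outside the loop, and there is no
-- such thread.
theorem not_marked (S : σ.Stuck N) {m : ℕ} (hN : N ≤ m) {g : Ghost} {n : Node}
    (I : AInv (view (σ.state m).heap) g fun t => ((σ.state m).loc t).abs)
    (hn : g.place n = .live) : (view (σ.state m).heap n).status ≠ .marked := by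
  intro hm
  obtain ⟨u, hu⟩ := I.liveMarked n hn hm
  obtain ⟨h1, h2⟩ := Loc.upd_of_rm hu
  exact h2 (S.loop m hN u h1)

omit [Fintype K] in
/-- The next attempt of a thread is on track, unless it has to wait for a transit edge. -/
theorem onTrack_of_start (S : σ.Stuck N) {m : ℕ} (hN : N ≤ m) {u : T}
    (hs : ((σ.state m).loc u).Start)
    (ht : ((σ.state m).loc u).Lenient ∨ ∀ e, ((σ.state N).heap.enode e).status ≠ .transit) :
    OnTrack (σ.state N).heap ((σ.state m).loc u) := by
  obtain ⟨g, I, H, St⟩ := σ.inv m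
  have hc := S.core m hN
  have hSt := St u
  revert hs ht hSt
  cases (σ.state m).loc u with
  | vStart j k =>
    intro _ _ _ v hv
    have h1 := S.not_marked hN I (I.vReach_live H (hc.vReach hv))
    rw [← hc.marked]
    simpa [view] using h1
  | eStart j k1 k2 v1 =>
    intro _ ht hSt e he
    have h1 := S.not_marked hN I (I.eReach_live H hSt.1.alloc (hc.eReach he))
    simp only [view, hc.status] at h1
    cases j with
    | add => exact h1
    | undo e3 => exact h1
    | remove =>
      -- A node that is neither marked nor in transit is `added`, so the strict test passes.
      have h2 := ht.resolve_left (fun h => h rfl) e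
      revert h1 h2
      cases h : ((σ.state N).heap.enode e).status <;> simp [EJob.ok]
  | _ => exact fun h => h.elim

/-- The weak test asks only for unmarked nodes, and all reachable nodes are unmarked; so the next
attempt would be on track. -/
theorem not_lenient (S : σ.Stuck N) (hF : σ.Fair) {m : ℕ} (hN : N ≤ m) {u : T}
    (hu : ((σ.state m).loc u).Upd) : ¬ ((σ.state m).loc u).Lenient := by
  intro hl
  obtain ⟨m', h1, h2, h3⟩ := S.exists_start hF _ m hN hu (Nat.lt_succ_self _)
  exact S.not_onTrack hF _ m' (hN.trans h1) (S.upd_le hN h1 hu) (Nat.lt_succ_self _)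
    (S.onTrack_of_start (hN.trans h1) h2 (.inl (h3 hl)))

/-- In a fair execution, no thread is locating a position forever while nothing else happens. -/
theorem not_upd (S : σ.Stuck N) (hF : σ.Fair) {m : ℕ} (hN : N ≤ m) {u : T} :
    ¬ ((σ.state m).loc u).Upd := by
  intro hu
  obtain ⟨m', h1, h2, -⟩ := S.exists_start hF _ m hN hu (Nat.lt_succ_self _)
  refine S.not_onTrack hF _ m' (hN.trans h1) (S.upd_le hN h1 hu) (Nat.lt_succ_self _)
    (S.onTrack_of_start (hN.trans h1) h2 (.inr fun e he => ?_))
  obtain ⟨g, I, -, -⟩ := σ.inv N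
  -- The owner of a transit node would be in the loop as well, and there with the weak test.
  obtain ⟨w, hw⟩ := I.trOwner (.edge e) he
  have h3 := Loc.upd_of_tr hw
  exact S.not_lenient hF le_rfl h3 (Loc.lenient_of_tr hw (S.loop N le_rfl w h3))

end Stuck

theorem core_step (σ : Execution K T) {m : ℕ}
    (h : ∀ u, ((σ.state m).loc u).Upd → σ.actor m = some u →
      ((σ.state m).loc u).Loop ∧ ((σ.state (m + 1)).loc u).Loop) :
    SameCore (σ.state m).heap (σ.state (m + 1)).heap := by
  rcases hu : σ.actor m with _ | u
  · rw [σ.idle_step m hu]; exact .refl _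
  · have hact := σ.act_step m u hu
    have h' := h u
    generalize σ.state m = s, σ.state (m + 1) = s' at *
    cases hact with
    | invoke => exact .refl _
    | step h0 l hn =>
      have hs := nstep_of_mem_next hn
      by_cases hU : (s.loc u).Upd
      · obtain ⟨h1, h2⟩ := h' hU hu
        exact hs.sameCore h1 (by simpa using h2)
      · rw [show h0 = s.heap from hs.heap_eq hU]; exact .refl _

theorem updatesProgress [Fintype K] [Finite T] (σ : Execution K T) (hF : σ.Fair) :
    σ.UpdatesProgress := by
  classical
  intro n t ht
  by_contra hc
  push Not at hc
  -- As no update returns, the rank of a pending update never increases, and a move that keeps it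
  -- stays inside the loop.
  have hstep : ∀ m u, n ≤ m → ((σ.state m).loc u).Upd → ((σ.state (m + 1)).loc u).Upd ∧
      (σ.rankAt (m + 1) u < σ.rankAt m u ∨ (σ.rankAt (m + 1) u = σ.rankAt m u ∧
        (σ.actor m = some u → ((σ.state m).loc u).Loop ∧ ((σ.state (m + 1)).loc u).Loop))) := by
    intro m u hm hu
    by_cases ha : σ.actor m = some u
    · rcases σ.rank_step ha hu.not_idle with ⟨b, hb⟩ | ⟨-, h1, h2⟩
      · obtain ⟨μ, h3, -⟩ := id hu
        exact absurd ⟨ha, ⟨μ, h3⟩, b, hb⟩ (hc m hm u hu)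
      · rcases h2 with ⟨h3, h4, h5⟩ | h2
        · exact ⟨h1 hu, .inr ⟨h5, fun _ => ⟨h3, h4⟩⟩⟩
        · exact ⟨h1 hu, .inl h2⟩
    · rw [σ.rankAt_of_ne ha, σ.loc_of_ne ha]
      exact ⟨hu, .inr ⟨rfl, fun h => absurd h ha⟩⟩
  have hmono : ∀ u m m', n ≤ m → m ≤ m' → ((σ.state m).loc u).Upd →
      ((σ.state m').loc u).Upd ∧ σ.rankAt m' u ≤ σ.rankAt m u := by
    intro u m m' hm hmm hu
    induction m', hmm using Nat.le_induction with
    | base => exact ⟨hu, le_rfl⟩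
    | succ k hk ih =>
      obtain ⟨h1, h2⟩ := hstep k u (hm.trans hk) ih.1
      exact ⟨h1, by omega⟩
  have hlim : ∀ u, ∃ N, n ≤ N ∧ ∀ m, N ≤ m → ((σ.state m).loc u).Upd → σ.actor m = some u →
      ((σ.state m).loc u).Loop ∧ ((σ.state (m + 1)).loc u).Loop := by
    intro u
    -- Choose a time at which the rank of `u` is least among the times with a pending update;
    -- without such times any choice will do.
    by_cases hex : ∃ r m, n ≤ m ∧ ((σ.state m).loc u).Upd ∧ σ.rankAt m u = r
    · obtain ⟨N, h1, h2, h3⟩ := Nat.find_spec hex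
      refine ⟨N, h1, fun m hm hu ha => ?_⟩
      have h4 := (hmono u N m h1 hm h2).2
      obtain ⟨h5, h6⟩ := hstep m u (h1.trans hm) hu
      rcases h6 with h6 | h6
      · exact absurd ⟨m + 1, by omega, h5, rfl⟩ (Nat.find_min hex (by omega))
      · exact h6.2 ha
    · exact ⟨n, le_rfl, fun m hm hu _ => absurd ⟨_, m, hm, hu, rfl⟩ hex⟩
  choose N hN hlim using hlim
  -- Finiteness of the set of threads provides a common time.
  obtain ⟨M, hM⟩ := Finite.exists_le N
  have hn : n ≤ M := (hN t).trans (hM t)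
  have S : σ.Stuck M := by
    refine ⟨fun m hm u hu => (hstep m u (by omega) hu).1, fun m hm u hu => ?_, fun m hm => ?_⟩
    -- A pending update outside the loop could never move again, by the choice of `M`. But there it
    -- requests no lock, so it is not blocked, and fairness makes it move.
    · by_contra hl
      have hk : ∀ m', m ≤ m' → σ.actor m' ≠ some u := by
        intro m' h1 h2
        obtain ⟨m2, h3, h4, h5⟩ := σ.exists_first ⟨m', h1, h2⟩
        refine hl ?_
        rw [← h5]
        exact (hlim u m2 ((hM u).trans (hm.trans h3)) (by rw [h5]; exact hu) h4).1
      obtain ⟨m1, -, h2⟩ := σ.exists_blocked hF hk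
      obtain ⟨h3, h4⟩ := h2 m1 le_rfl
      refine h4 ((σ.inv m1).canStep ?_ ?_)
      · rw [h3]; exact hu.not_idle
      · intro c hc
        rw [h3] at hc
        exact absurd (Loc.loop_of_request hc) hl
    · induction m, hm using Nat.le_induction with
      | base => exact .refl _
      | succ k hk ih =>
        exact ih.trans (σ.core_step fun u hu ha => hlim u k ((hM u).trans hk) hu ha)
  exact S.not_upd hF le_rfl (hmono t n M le_rfl hn ht).1

end Execution

end AcyclicGraph

theorem mainTheorem7 (K : Type*) [LinearOrder K] [Fintype K] :
    (∀ (T : Type*) [Fintype T] [DecidableEq T] (σ : AcyclicGraph.Execution K T),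
      (σ.Fair → σ.UpdatesProgress) ∧ σ.NoDeadlock ∧ σ.LocksOrdered) ∧
    ∃ B : ℕ, ∀ (T : Type*) [DecidableEq T] (σ : AcyclicGraph.Execution K T),
      (∀ μ : AcyclicGraph.Method, μ.IsReadOnly → σ.WaitFree B μ) ∧ σ.PathExistsWaitFree B :=
  ⟨fun _ _ _ σ => ⟨σ.updatesProgress, σ.noDeadlock, σ.locksOrdered⟩,
    AcyclicGraph.rankBound K, fun _ _ σ => ⟨fun _ hμ => σ.waitFree hμ, σ.pathExistsWaitFree⟩⟩
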